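/- **Theorem A.** Let $r$ and $s$ be multiplicatively independent positive integers, that is, $\log r/\log s$ is irrational. Let $X, Y \subseteq [0,1]$ be non-empty closed sets that are $\times r$- and $\times s$-invariant, respectively: $T_rX\subseteq X$ and $T_sY\subseteq Y$, where $T_r x = \{rx\}$ denotes the fractional part of $rx$. For $A\subseteq\mathbb{R}$ and $\gamma\ge 0$ let $$\mathcal{H}^\gamma_\infty(A)=\inf\Big\{\sum_{i}\delta_i^\gamma \ :\ A\subseteq\bigcup_{i}B_i,\ B_i \text{ an open ball of diameter } \delta_i>0\Big\}$$ (the infimum over all finite or countable covers) be the unlimited $\gamma$-Hausdorff content of $A$, and let $\overline\gamma=\min(\dim_{\mathrm H}X+\dim_{\mathrm H}Y,\,1)$. Then for every compact $I\subseteq\mathbb{R}\setminus\{0\}$ and every $0\le\gamma<\overline\gamma$, $$\inf_{\lambda,\eta\in I}\ \mathcal{H}^\gamma_\infty(\lambda X+\eta Y)>0 .$$ Moreover (Furstenberg's sumset conjecture), $\dim_{\mathrm H}(X+Y)=\min(1,\ \dim_{\mathrm H}X+\dim_{\mathrm H}Y)$. -/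

import Mathlib

open scoped ENNReal Pointwise

/-- The map `T_r : x ↦ r x (mod 1)`, i.e. the fractional part of `r x`. -/
noncomputable def timesMap (r : ℕ) (x : ℝ) : ℝ := Int.fract ((r : ℝ) * x)

/-- A set `X ⊆ [0,1]` is `×r`-invariant if it is closed and `T_r X ⊆ X`. -/
structure IsTimesInvariant (r : ℕ) (X : Set ℝ) : Prop where
  subset_Icc : X ⊆ Set.Icc 0 1
  isClosed : IsClosed X
  image_subset : timesMap r '' X ⊆ X

/-- The unlimited `γ`-Hausdorff content of `A ⊆ ℝ`: the infimum of `∑ δ_i ^ γ` over all countable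
(finite or infinite) covers of `A` by open balls `B_i` of diameter `δ_i > 0`. The ball of centre
`c` and diameter `δ` is `Metric.ball c (δ / 2)`. -/
noncomputable def unlimitedHausdorffContent (γ : ℝ) (A : Set ℝ) : ℝ≥0∞ :=
  ⨅ (ι : Type) (_ : Countable ι) (c : ι → ℝ) (δ : ι → ℝ) (_ : ∀ i, 0 < δ i)
    (_ : A ⊆ ⋃ i, Metric.ball (c i) (δ i / 2)), ∑' i, ENNReal.ofReal (δ i ^ γ)

/-! ### Digit codes and their growth rate -/

namespace Furstenberg

/-! The `r`-adic tree of X and the `s`-adic tree of Y are compared at common scales ρ^k. Invariance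
makes the number of codes submultiplicative, so it grows like r^(An)
(`IsShiftInvariant.exists_growth`), and no node has more descendants than the root has. A tree with
that many leaves and no excess branching contains a weighted subtree that splits almost maximally,
into parts of equal mass, at most levels of every branch (`exists_splitting_weight`). At such a
level the weight is Frostman with exponent A (`IsShiftInvariant.regular_of_splits`).

For a product of two such weights, an averaging argument of Marstrand type inside a single level
(`sum_mass_close_le`) shows that in most directions the map (x, y) ↦ x + cty spreads a node into
about ρ^(-γ₂) parts. Averaging over levels too gives one t for which this happens at most levels
(`exists_direction`). A maximal inequality then finds a node in which, for half of the mass, bad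
levels are rare in every initial segment (`exists_good_start`). Multiplying the gains level by
level, the projection of this half is Frostman with exponent γ down to any prescribed depth, for all
directions near t (`mass_projection_le`, `exists_frostman_pairs`).

The direction t cannot be prescribed, and this is where multiplicative independence enters. On a
cell the iterates T_r^i and T_s^j are affine, so λX + ηY contains similar copies of the projections
of X × Y ∩ cell in direction ηs^j/(λr^i). The quotients r^p/s^q are dense in (0, ∞), and by
compactness bounded p, q suffice to bring this direction within the tolerance around t
(`exists_powers_ratio_near`). A cover of λX + ηY then pulls back to a cover of the good half by
strips, and the Frostman bound gives a lower bound that depends neither on the cover nor on λ, η ∈ I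
(`exists_cover_sum_ge`).

Positive content bounds the Hausdorff dimension from below and counting codes bounds it from above.
Taking {0} as one of the summands, the same two bounds identify dim X with A and dim Y with B. -/

/-- The index of the `r`-adic interval of level `i` that contains `x`. -/
noncomputable def code (r i : ℕ) (x : ℝ) : ℤ := ⌊(r : ℝ) ^ i * x⌋

/-- A subset of `[0,1)` stable under all iterates of `x ↦ r x (mod 1)`. -/
structure IsShiftInvariant (r : ℕ) (X : Set ℝ) : Prop where
  subset_Ico : X ⊆ Set.Ico 0 1
  fract_mem : ∀ x ∈ X, ∀ i : ℕ, Int.fract ((r : ℝ) ^ i * x) ∈ X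

/-- The number of `r`-adic intervals of level `i` that meet `X`. -/
noncomputable def numCodes (r : ℕ) (X : Set ℝ) (i : ℕ) : ℕ := (code r i '' X).ncard

/-- Split r^i x into integer and fractional part: the digits of x after the i-th are the digits of
its i-th iterate. All uses of invariance in the counting go through this identity. -/
theorem code_add (r i j : ℕ) (x : ℝ) :
    code r (i + j) x = (r : ℤ) ^ j * code r i x + code r j (Int.fract ((r : ℝ) ^ i * x)) := by
  unfold code
  rw [← Int.floor_intCast_add]
  congr 1
  have := Int.floor_add_fract ((r : ℝ) ^ i * x)
  push_cast
  rw [pow_add]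
  linear_combination (-(r : ℝ) ^ j) * this

theorem code_nonneg {r j : ℕ} {x : ℝ} (hx : 0 ≤ x) : 0 ≤ code r j x :=
  Int.floor_nonneg.mpr (by positivity)

theorem code_lt {r j : ℕ} (hr : 2 ≤ r) {x : ℝ} (hx : x < 1) : code r j x < (r : ℤ) ^ j := by
  unfold code
  rw [Int.floor_lt]
  push_cast
  have : (0 : ℝ) < (r : ℝ) ^ j := by positivity
  nlinarith

theorem code_zero_eq {r : ℕ} {x : ℝ} (hx : x ∈ Set.Ico (0 : ℝ) 1) : code r 0 x = 0 := by
  unfold code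
  rw [pow_zero, one_mul, Int.floor_eq_zero_iff]
  exact hx

theorem code_eq_ediv {r : ℕ} (hr : 2 ≤ r) {i j : ℕ} (hij : i ≤ j) (x : ℝ) :
    code r i x = code r j x / (r : ℤ) ^ (j - i) := by
  obtain ⟨d, rfl⟩ := Nat.exists_eq_add_of_le hij
  have hpos : (0 : ℤ) < (r : ℤ) ^ d := by positivity
  rw [code_add, Nat.add_sub_cancel_left, Int.add_comm, Int.add_mul_ediv_left _ _ hpos.ne',
    Int.ediv_eq_zero_of_lt (code_nonneg (Int.fract_nonneg _)) (code_lt hr (Int.fract_lt_one _)),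
    zero_add]

theorem code_eq_of_le {r : ℕ} (hr : 2 ≤ r) {i j : ℕ} (hij : i ≤ j) {x y : ℝ}
    (h : code r j x = code r j y) : code r i x = code r i y := by
  rw [code_eq_ediv hr hij, code_eq_ediv hr hij, h]

theorem abs_sub_le_of_code_eq {r : ℕ} (hr : 2 ≤ r) {i : ℕ} {x y : ℝ}
    (h : code r i x = code r i y) : |x - y| ≤ ((r : ℝ) ^ i)⁻¹ := by
  have h1 := (Int.abs_sub_lt_one_of_floor_eq_floor h).le
  have hpos : (0 : ℝ) < (r : ℝ) ^ i := by positivity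
  rw [← mul_sub, abs_mul, abs_of_pos hpos] at h1
  rwa [← one_div, le_div_iff₀' hpos]

theorem finite_codes {r : ℕ} {X : Set ℝ} (hX : X ⊆ Set.Icc 0 1) (i : ℕ) :
    (code r i '' X).Finite := by
  refine (Set.finite_Icc (0 : ℤ) ((r : ℤ) ^ i)).subset ?_
  rintro _ ⟨x, hx, rfl⟩
  refine ⟨code_nonneg (hX hx).1, ?_⟩
  have h1 : (r : ℝ) ^ i * x ≤ (r : ℝ) ^ i := mul_le_of_le_one_right (by positivity) (hX hx).2
  have h2 : ((code r i x : ℤ) : ℝ) ≤ (r : ℝ) ^ i := (Int.floor_le _).trans h1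
  exact_mod_cast h2

theorem IsShiftInvariant.subset_Icc {r : ℕ} {X : Set ℝ} (hX : IsShiftInvariant r X) :
    X ⊆ Set.Icc 0 1 := hX.subset_Ico.trans Set.Ico_subset_Icc_self

/-- Subtracting r^d c turns the descendants of a cell into codes of i-th iterates, which lie in X
again. So the tree branches nowhere more than at its root. -/
theorem IsShiftInvariant.ncard_children_le {r : ℕ} {X : Set ℝ}
    (hX : IsShiftInvariant r X) (i d : ℕ) (c : ℤ) :
    (code r (i + d) '' {x ∈ X | code r i x = c}).ncard ≤ numCodes r X d := by
  refine Set.ncard_le_ncard_of_injOn (fun z => z - (r : ℤ) ^ d * c) ?_ ?_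
    (finite_codes hX.subset_Icc d)
  · rintro _ ⟨x, ⟨hx, rfl⟩, rfl⟩
    refine ⟨_, hX.fract_mem x hx i, ?_⟩
    rw [code_add]
    ring
  · intro a _ b _ hab
    simpa using hab

/-- Division with remainder by r^d sends a code to its first i digits and its last d digits; by
invariance both are codes of points of X. -/
theorem IsShiftInvariant.numCodes_add_le {r : ℕ} {X : Set ℝ} (hr : 2 ≤ r)
    (hX : IsShiftInvariant r X) (i d : ℕ) :
    numCodes r X (i + d) ≤ numCodes r X i * numCodes r X d := by
  unfold numCodes
  rw [← Set.ncard_prod]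
  refine Set.ncard_le_ncard_of_injOn
    (fun z => (z / (r : ℤ) ^ d, z - (r : ℤ) ^ d * (z / (r : ℤ) ^ d))) ?_ ?_
    ((finite_codes hX.subset_Icc i).prod (finite_codes hX.subset_Icc d))
  · rintro _ ⟨x, hx, rfl⟩
    have h1 := code_eq_ediv hr (Nat.le_add_right i d) x
    rw [Nat.add_sub_cancel_left] at h1
    simp only [← h1]
    refine ⟨⟨x, hx, rfl⟩, ⟨_, hX.fract_mem x hx i, ?_⟩⟩
    rw [code_add]
    ring
  · intro a _ b _ hab
    simp only [Prod.mk.injEq] at hab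
    rw [hab.1] at hab
    linarith [hab.2]

theorem numCodes_pos {r : ℕ} {X : Set ℝ} (hX : X ⊆ Set.Icc 0 1) (hne : X.Nonempty) (i : ℕ) :
    0 < numCodes r X i :=
  (Set.ncard_pos (finite_codes hX i)).mpr (hne.image _)

theorem numCodes_le {r : ℕ} {X : Set ℝ} (hr : 2 ≤ r) (hX : X ⊆ Set.Ico 0 1) (i : ℕ) :
    numCodes r X i ≤ r ^ i := by
  have : numCodes r X i ≤ (Set.Ico (0 : ℤ) ((r : ℤ) ^ i)).ncard := by
    refine Set.ncard_le_ncard ?_ (Set.finite_Ico _ _)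
    rintro _ ⟨x, hx, rfl⟩
    exact ⟨code_nonneg (hX hx).1, code_lt hr (hX hx).2⟩
  refine this.trans ?_
  rw [← Finset.coe_Ico, Set.ncard_coe_finset, Int.card_Ico, sub_zero]
  have : ((r : ℤ) ^ i).toNat = r ^ i := by
    rw [← Nat.cast_pow, Int.toNat_natCast]
  exact this.le

/-- The exponential growth rate of the number of codes (Fekete). -/
theorem IsShiftInvariant.exists_growth {r : ℕ} {X : Set ℝ} (hr : 2 ≤ r)
    (hX : IsShiftInvariant r X) (hne : X.Nonempty) :
    ∃ A : ℝ, 0 ≤ A ∧ A ≤ 1 ∧ (∀ n : ℕ, (r : ℝ) ^ (A * n) ≤ numCodes r X n) ∧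
      ∀ ε > 0, ∃ C : ℝ, 1 ≤ C ∧ ∀ n : ℕ, (numCodes r X n : ℝ) ≤ C * (r : ℝ) ^ ((A + ε) * n) := by
  have hr1 : (1 : ℝ) < r := by exact_mod_cast hr
  have hr0 : (0 : ℝ) < r := by linarith
  have hlog : 0 < Real.log r := Real.log_pos hr1
  have hN : ∀ n, (1 : ℝ) ≤ numCodes r X n := fun n => by
    exact_mod_cast numCodes_pos hX.subset_Icc hne n
  set u : ℕ → ℝ := fun n => Real.log (numCodes r X n) with hu
  have hunn : ∀ n, 0 ≤ u n := fun n => Real.log_nonneg (hN n)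
  have hsub : Subadditive u := by
    intro m n
    simp only [hu]
    rw [← Real.log_mul (by linarith [hN m]) (by linarith [hN n])]
    apply Real.log_le_log (by linarith [hN (m + n)])
    exact_mod_cast hX.numCodes_add_le hr m n
  have hbdd : BddBelow (Set.range fun n => u n / n) := by
    refine ⟨0, ?_⟩
    rintro _ ⟨n, rfl⟩
    exact div_nonneg (hunn n) (Nat.cast_nonneg n)
  have hlim := hsub.tendsto_lim hbdd
  have hlim0 : 0 ≤ hsub.lim :=
    ge_of_tendsto' hlim fun n => div_nonneg (hunn n) (Nat.cast_nonneg n)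
  have hrpow : ∀ y : ℝ, (r : ℝ) ^ y = Real.exp (Real.log r * y) := fun y =>
    Real.rpow_def_of_pos hr0 y
  have hexp : ∀ n, (numCodes r X n : ℝ) = Real.exp (u n) := fun n =>
    (Real.exp_log (by linarith [hN n])).symm
  refine ⟨hsub.lim / Real.log r, by positivity, ?_, ?_, ?_⟩
  · rw [div_le_one hlog]
    have h1 := hsub.lim_le_div hbdd (n := 1) one_ne_zero
    refine h1.trans ?_
    simp only [hu, Nat.cast_one, div_one]
    apply Real.log_le_log (by linarith [hN 1])
    exact_mod_cast (numCodes_le hr hX.subset_Ico 1).trans (by simp)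
  -- Fekete's limit is an infimum, so the lower bound needs no constant and no restriction on n.
  · intro n
    rw [hrpow, hexp, Real.exp_le_exp]
    rcases Nat.eq_zero_or_pos n with rfl | hn
    · simpa using hunn 0
    have h1 := hsub.lim_le_div hbdd (n := n) hn.ne'
    have hn' : (0 : ℝ) < n := by exact_mod_cast hn
    rw [le_div_iff₀ hn'] at h1
    calc Real.log r * (hsub.lim / Real.log r * n) = hsub.lim * n := by field_simp
      _ ≤ u n := h1
  · intro ε hε
    have hev : ∀ᶠ n : ℕ in Filter.atTop, u n / n < hsub.lim + ε * Real.log r :=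
      hlim.eventually_lt_const (by nlinarith)
    obtain ⟨n₀, hn₀⟩ := Filter.eventually_atTop.mp hev
    -- This constant absorbs the finitely many n up to n₀, for which the limit says nothing.
    refine ⟨Real.exp (∑ i ∈ Finset.range (n₀ + 1), u i),
      Real.one_le_exp (Finset.sum_nonneg fun i _ => hunn i), fun n => ?_⟩
    rw [hrpow, hexp, ← Real.exp_add, Real.exp_le_exp]
    have hs0 : 0 ≤ ∑ i ∈ Finset.range (n₀ + 1), u i := Finset.sum_nonneg fun i _ => hunn i
    have heq : Real.log r * ((hsub.lim / Real.log r + ε) * n)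
        = (hsub.lim + ε * Real.log r) * n := by field_simp
    rw [heq]
    rcases le_or_gt n n₀ with hn | hn
    · have h1 : u n ≤ ∑ i ∈ Finset.range (n₀ + 1), u i :=
        Finset.single_le_sum (f := u) (fun i _ => hunn i) (Finset.mem_range.mpr (by omega))
      have h2 : 0 ≤ (hsub.lim + ε * Real.log r) * n := by positivity
      linarith
    · have h1 := (hn₀ n hn.le).le
      have hn' : (0 : ℝ) < n := by exact_mod_cast (by omega : 0 < n)
      rw [div_le_iff₀ hn'] at h1
      linarith

/-! ### Weighted subtrees with equal splitting -/

section Mass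

variable {α β : Type*}

/-- The mass that the weight `w` on the finite set `F` gives to `S`. -/
noncomputable def mass (F : Finset α) (w : α → ℝ) (S : Set α) : ℝ := ∑ x ∈ F, S.indicator w x

theorem mass_nonneg {F : Finset α} {w : α → ℝ} (hw : ∀ x, 0 ≤ w x) (S : Set α) :
    0 ≤ mass F w S :=
  Finset.sum_nonneg fun _ _ => Set.indicator_nonneg (fun x _ => hw x) _

theorem mass_mono {F : Finset α} {w : α → ℝ} (hw : ∀ x, 0 ≤ w x) {S T : Set α}
    (h : ∀ x ∈ F, x ∈ S → x ∈ T) : mass F w S ≤ mass F w T := by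
  refine Finset.sum_le_sum fun x hx => ?_
  by_cases hS : x ∈ S
  · simp [hS, h x hx hS]
  · simpa [hS] using Set.indicator_nonneg (fun x _ => hw x) x

theorem mass_congr {F : Finset α} {w : α → ℝ} {S T : Set α}
    (h : ∀ x ∈ F, x ∈ S ↔ x ∈ T) : mass F w S = mass F w T := by
  refine Finset.sum_congr rfl fun x hx => ?_
  by_cases hS : x ∈ S
  · simp [hS, (h x hx).1 hS]
  · simp [hS, mt (h x hx).2 hS]

theorem mass_eq_zero {F : Finset α} {w : α → ℝ} {S : Set α} (h : ∀ x ∈ F, x ∉ S) :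
    mass F w S = 0 :=
  Finset.sum_eq_zero fun x hx => Set.indicator_of_notMem (h x hx) w

/-- The children of the node of `x` at level `k` all have comparable mass, and there are at least
`M₀` of them: the mass of a set is at most `1 / M₀` times the number of children that it meets. -/
def Splits (node : ℕ → α → β) (M₀ : ℝ) (F : Finset α) (w : α → ℝ) (k : ℕ) (x : α) : Prop :=
  ∀ S : Set α, mass F w {x' | node k x' = node k x ∧ x' ∈ S} * M₀ ≤
    (node (k + 1) '' {x' | x' ∈ F ∧ node k x' = node k x ∧ x' ∈ S}).ncard *
      mass F w {x' | node k x' = node k x}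

theorem node_eq_of_le {node : ℕ → α → β}
    (href : ∀ k x y, node (k + 1) x = node (k + 1) y → node k x = node k y)
    {i j : ℕ} (hij : i ≤ j) {x y : α} (h : node j x = node j y) : node i x = node i y := by
  induction j, hij using Nat.le_induction with
  | base => exact h
  | succ j _ ih => exact ih (href _ _ _ h)

open Classical in
/-- A combination of weights living on different children of one node. -/
theorem exists_combined_weight (node : ℕ → α → β)
    (href : ∀ k x y, node (k + 1) x = node (k + 1) y → node k x = node k y)
    {M₀ : ℝ} (hM₀ : 0 < M₀) {d k g : ℕ} {F : Finset α}
    (hF : ∀ x ∈ F, ∀ y ∈ F, node k x = node k y) (Big : Finset β) (hBig : M₀ ≤ Big.card)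
    (Fc : β → Finset α) (wc : β → α → ℝ)
    (hFc : ∀ c ∈ Big, Fc c ⊆ F ∧ (∀ x ∈ Fc c, node (k + 1) x = c) ∧ (Fc c).Nonempty ∧
      (∀ x, 0 ≤ wc c x) ∧ mass (Fc c) (wc c) Set.univ = 1 ∧
      ∀ x ∈ Fc c, g ≤ ((Finset.Ico (k + 1) (k + 1 + d)).filter
        (fun i => Splits node M₀ (Fc c) (wc c) i x)).card) :
    ∃ F' ⊆ F, F'.Nonempty ∧ ∃ w : α → ℝ, (∀ x, 0 ≤ w x) ∧ mass F' w Set.univ = 1 ∧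
      ∀ x ∈ F', g + 1 ≤ ((Finset.Ico k (k + (d + 1))).filter
        (fun i => Splits node M₀ F' w i x)).card := by
  have hb0 : (0 : ℝ) < Big.card := hM₀.trans_le hBig
  set F' := Big.biUnion Fc with hF'
  -- Every child in `Big` receives the same share 1/|Big|, and |Big| ≥ M₀, so level k splits as
  -- required.
  set w : α → ℝ := fun x => if node (k + 1) x ∈ Big then
    wc (node (k + 1) x) x / Big.card else 0 with hw
  have hdisj : (Big : Set β).PairwiseDisjoint Fc := by
    intro c hc c' hc' hne
    refine Finset.disjoint_left.mpr fun x hx hx' => hne ?_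
    rw [← (hFc c hc).2.1 x hx, ← (hFc c' hc').2.1 x hx']
  have hmass : ∀ S : Set α, mass F' w S = (∑ c ∈ Big, mass (Fc c) (wc c) S) / Big.card := by
    intro S
    rw [mass, hF', Finset.sum_biUnion hdisj, Finset.sum_div]
    refine Finset.sum_congr rfl fun c hc => ?_
    rw [mass, Finset.sum_div]
    refine Finset.sum_congr rfl fun x hx => ?_
    have hxc := (hFc c hc).2.1 x hx
    by_cases hS : x ∈ S
    · simp [hS, hw, hxc, hc]
    · simp [hS]
  have hsub : F' ⊆ F := Finset.biUnion_subset.mpr fun c hc => (hFc c hc).1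
  have hBne : Big.Nonempty := Finset.card_pos.mp (by exact_mod_cast hb0)
  refine ⟨F', hsub, ?_, w, ?_, ?_, ?_⟩
  · obtain ⟨c, hc⟩ := hBne
    obtain ⟨x, hx⟩ := (hFc c hc).2.2.1
    exact ⟨x, Finset.mem_biUnion.mpr ⟨c, hc, hx⟩⟩
  · intro x
    simp only [hw]
    split_ifs with h
    · exact div_nonneg ((hFc _ h).2.2.2.1 x) hb0.le
    · exact le_rfl
  · rw [hmass, Finset.sum_congr rfl fun c hc => (hFc c hc).2.2.2.2.1]
    simp [hb0.ne']
  intro x hx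
  obtain ⟨c, hc, hxc⟩ := Finset.mem_biUnion.mp hx
  -- below level `k` nothing changes
  have hlow : ∀ i ∈ Finset.Ico (k + 1) (k + 1 + d),
      Splits node M₀ (Fc c) (wc c) i x → Splits node M₀ F' w i x := by
    intro i hi hsp S
    have hi1 := (Finset.mem_Ico.mp hi).1
    -- A set inside a node of level i > k meets a single child, where w is a constant multiple of
    -- `wc c`; `Splits` is homogeneous in the weight.
    have hone : ∀ T : Set α, (∀ y ∈ T, node i y = node i x) →
        mass F' w T = mass (Fc c) (wc c) T / Big.card := by
      intro T hT
      rw [hmass, Finset.sum_eq_single_of_mem c hc]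
      intro c' hc' hne
      refine mass_eq_zero fun y hy hyT => hne ?_
      rw [← (hFc c' hc').2.1 y hy, ← (hFc c hc).2.1 x hxc]
      exact node_eq_of_le href hi1 (hT y hyT)
    rw [hone _ fun y hy => hy.1, hone {y | node i y = node i x} fun y hy => hy,
      div_mul_eq_mul_div, ← mul_div_assoc]
    refine div_le_div_of_nonneg_right ((hsp S).trans ?_) hb0.le
    refine mul_le_mul_of_nonneg_right ?_ (mass_nonneg (hFc c hc).2.2.2.1 _)
    have : (node (i + 1) '' {x' | x' ∈ Fc c ∧ node i x' = node i x ∧ x' ∈ S}).ncard ≤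
        (node (i + 1) '' {x' | x' ∈ F' ∧ node i x' = node i x ∧ x' ∈ S}).ncard := by
      refine Set.ncard_le_ncard (Set.image_mono fun y hy => ?_)
        (((Finset.finite_toSet F').subset fun y hy => hy.1).image _)
      exact ⟨Finset.mem_biUnion.mpr ⟨c, hc, hy.1⟩, hy.2⟩
    exact_mod_cast this
  have htop : Splits node M₀ F' w k x := by
    intro S
    have hall : mass F' w {x' | node k x' = node k x} = 1 := by
      rw [mass_congr (T := Set.univ), hmass,
        Finset.sum_congr rfl fun c hc => (hFc c hc).2.2.2.2.1]
      · simp [hb0.ne']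
      · intro y hy
        simp [hF y (hsub hy) x (hsub hx)]
    rw [hall, mul_one, hmass]
    set T := node (k + 1) '' {x' | x' ∈ F' ∧ node k x' = node k x ∧ x' ∈ S} with hT
    have hTfin : T.Finite := ((Finset.finite_toSet F').subset fun y hy => hy.1).image _
    have hsum : ∑ c ∈ Big, mass (Fc c) (wc c) {x' | node k x' = node k x ∧ x' ∈ S} ≤ T.ncard := by
      calc ∑ c ∈ Big, mass (Fc c) (wc c) {x' | node k x' = node k x ∧ x' ∈ S}
          ≤ ∑ c ∈ Big, if c ∈ T then (1 : ℝ) else 0 := by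
            refine Finset.sum_le_sum fun c' hc' => ?_
            split_ifs with h
            · rw [← (hFc c' hc').2.2.2.2.1]
              exact mass_mono (hFc c' hc').2.2.2.1 fun _ _ _ => Set.mem_univ _
            · refine (mass_eq_zero fun y hy hyS => h ?_).le
              exact ⟨y, ⟨Finset.mem_biUnion.mpr ⟨c', hc', hy⟩, hyS⟩, (hFc c' hc').2.1 y hy⟩
        _ = ((Big.filter (· ∈ T)).card : ℝ) := by rw [Finset.sum_ite]; simp
        _ ≤ T.ncard := by
            have : (Big.filter (· ∈ T)).card ≤ T.ncard := by
              rw [← Set.ncard_coe_finset]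
              exact Set.ncard_le_ncard (fun y hy => (Finset.mem_filter.mp hy).2) hTfin
            exact_mod_cast this
    rw [div_mul_eq_mul_div, div_le_iff₀ hb0]
    exact mul_le_mul hsum hBig hM₀.le (Nat.cast_nonneg _)
  calc g + 1 ≤ ((Finset.Ico (k + 1) (k + 1 + d)).filter
        (fun i => Splits node M₀ (Fc c) (wc c) i x)).card + 1 :=
        Nat.add_le_add_right ((hFc c hc).2.2.2.2.2 x hxc) 1
    _ = (insert k ((Finset.Ico (k + 1) (k + 1 + d)).filter
        (fun i => Splits node M₀ (Fc c) (wc c) i x))).card := by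
        rw [Finset.card_insert_of_notMem]; simp
    _ ≤ _ := by
        refine Finset.card_le_card fun i hi => ?_
        rcases Finset.mem_insert.mp hi with rfl | hi
        · exact Finset.mem_filter.mpr ⟨Finset.mem_Ico.mpr ⟨le_rfl, by omega⟩, htop⟩
        · obtain ⟨h1, h2⟩ := Finset.mem_filter.mp hi
          have h3 := Finset.mem_Ico.mp h1
          exact Finset.mem_filter.mpr ⟨Finset.mem_Ico.mpr ⟨by omega, by omega⟩, hlow i h1 h2⟩

open Classical in
/-- In a tree of height `d` with branching at most `M` and more than `(2M₀)^d (M/M₀)^g` leaves,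
there is a weighted subtree in which every branch splits into at least `M₀` parts of equal mass at
`g` levels or more. -/
theorem exists_splitting_weight (node : ℕ → α → β)
    (href : ∀ k x y, node (k + 1) x = node (k + 1) y → node k x = node k y)
    {M M₀ : ℝ} (hM₀ : 1 ≤ M₀) (hM : M₀ ≤ M) (d : ℕ) :
    ∀ (k g : ℕ) (F : Finset α), F.Nonempty → (∀ x ∈ F, ∀ y ∈ F, node k x = node k y) →
      Set.InjOn (node (k + d)) F →
      (∀ i, k ≤ i → i < k + d → ∀ x ∈ F,
        (((F.filter (fun y => node i y = node i x)).image (node (i + 1))).card : ℝ) ≤ M) →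
      (g = 0 ∨ (2 * M₀) ^ d * (M / M₀) ^ g < F.card) →
      ∃ F' ⊆ F, F'.Nonempty ∧ ∃ w : α → ℝ, (∀ x, 0 ≤ w x) ∧ mass F' w Set.univ = 1 ∧
        ∀ x ∈ F', g ≤ ((Finset.Ico k (k + d)).filter
          (fun i => Splits node M₀ F' w i x)).card := by
  have h0 : 0 < M₀ := by linarith
  have hone : 1 ≤ M / M₀ := (one_le_div h0).mpr hM
  have hzero : ∀ F : Finset α, F.Nonempty → ∃ F' ⊆ F, F'.Nonempty ∧
      ∃ w : α → ℝ, (∀ x, 0 ≤ w x) ∧ mass F' w Set.univ = 1 := by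
    rintro F ⟨x, hx⟩
    exact ⟨{x}, Finset.singleton_subset_iff.mpr hx, Finset.singleton_nonempty x, fun _ => 1,
      fun _ => zero_le_one, by simp [mass]⟩
  induction d with
  | zero =>
    intro k g F hne hF hinj _ hcard
    rcases hcard with rfl | hcard
    · obtain ⟨F', h1, h2, w, h3, h4⟩ := hzero F hne
      exact ⟨F', h1, h2, w, h3, h4, fun x _ => Nat.zero_le _⟩
    · exfalso
      have h1 : F.card ≤ 1 :=
        Finset.card_le_one.mpr fun x hx y hy => hinj hx hy (hF x hx y hy)
      have h2 : (F.card : ℝ) ≤ 1 := by exact_mod_cast h1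
      have h3 : 1 ≤ (M / M₀) ^ g := one_le_pow₀ hone
      simp only [pow_zero, one_mul] at hcard
      linarith
  | succ d ih =>
    intro k g F hne hF hinj hbr hcard
    rcases g with _ | g
    · obtain ⟨F', h1, h2, w, h3, h4⟩ := hzero F hne
      exact ⟨F', h1, h2, w, h3, h4, fun x _ => Nat.zero_le _⟩
    replace hcard := hcard.resolve_left (Nat.succ_ne_zero g)
    set Ch := F.image (node (k + 1)) with hCh
    set fib : β → Finset α := fun c => F.filter (fun y => node (k + 1) y = c) with hfib
    -- the induction hypothesis, applied to a child
    have hchild : ∀ c ∈ Ch, ∀ g', (g' = 0 ∨ (2 * M₀) ^ d * (M / M₀) ^ g' < (fib c).card) →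
        ∃ F' ⊆ fib c, F'.Nonempty ∧ ∃ w : α → ℝ, (∀ x, 0 ≤ w x) ∧ mass F' w Set.univ = 1 ∧
        ∀ x ∈ F', g' ≤ ((Finset.Ico (k + 1) (k + 1 + d)).filter
          (fun i => Splits node M₀ F' w i x)).card := by
      intro c hc g' hg'
      obtain ⟨x, hx, hxc⟩ := Finset.mem_image.mp hc
      refine ih (k + 1) g' (fib c) ⟨x, Finset.mem_filter.mpr ⟨hx, hxc⟩⟩ ?_ ?_ ?_ hg'
      · intro y hy z hz
        rw [(Finset.mem_filter.mp hy).2, (Finset.mem_filter.mp hz).2]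
      · rw [show k + 1 + d = k + (d + 1) by omega]
        exact hinj.mono fun y hy => (Finset.mem_filter.mp hy).1
      · intro i hi1 hi2 y hy
        refine le_trans ?_ (hbr i (by omega) (by omega) y (Finset.mem_filter.mp hy).1)
        have : ((fib c).filter (fun z => node i z = node i y)).image (node (i + 1)) ⊆
            (F.filter (fun z => node i z = node i y)).image (node (i + 1)) :=
          Finset.image_subset_image (Finset.filter_subset_filter _ (Finset.filter_subset _ _))
        exact_mod_cast Finset.card_le_card this
    -- The big children have enough leaves for g splits in the d remaining levels. With M₀ of them
    -- the tree splits here. Otherwise a single child that can afford g + 1 splits is kept and the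
    -- others are discarded. If neither is possible, there are too few leaves.
    set Big := Ch.filter (fun c => g = 0 ∨ (2 * M₀) ^ d * (M / M₀) ^ g < (fib c).card) with hBig
    by_cases hbig : M₀ ≤ Big.card
    · have hex : ∀ c, ∃ F' : Finset α, ∃ w : α → ℝ, c ∈ Big → F' ⊆ fib c ∧ F'.Nonempty ∧
          (∀ x, 0 ≤ w x) ∧ mass F' w Set.univ = 1 ∧
          ∀ x ∈ F', g ≤ ((Finset.Ico (k + 1) (k + 1 + d)).filter
            (fun i => Splits node M₀ F' w i x)).card := by
        intro c
        by_cases hc : c ∈ Big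
        · obtain ⟨F', h1, h2, w, h3⟩ :=
            hchild c (Finset.mem_filter.mp hc).1 g (Finset.mem_filter.mp hc).2
          exact ⟨F', w, fun _ => ⟨h1, h2, h3⟩⟩
        · exact ⟨∅, 0, fun h => absurd h hc⟩
      choose Fc wc hFc using hex
      refine exists_combined_weight node href h0 hF Big hbig Fc wc fun c hc => ?_
      obtain ⟨h1, h2, h3⟩ := hFc c hc
      exact ⟨h1.trans (Finset.filter_subset _ _),
        fun x hx => (Finset.mem_filter.mp (h1 hx)).2, h2, h3⟩
    by_cases hone' : ∃ c ∈ Ch, (2 * M₀) ^ d * (M / M₀) ^ (g + 1) < (fib c).card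
    · obtain ⟨c, hc, hlt⟩ := hone'
      obtain ⟨F', h1, h2, w, h3, h4, h5⟩ := hchild c hc (g + 1) (Or.inr hlt)
      refine ⟨F', h1.trans (Finset.filter_subset _ _), h2, w, h3, h4, fun x hx =>
        (h5 x hx).trans (Finset.card_le_card (Finset.filter_subset_filter _ ?_))⟩
      exact Finset.Ico_subset_Ico (by omega) (by omega)
    -- With q = M/M₀, fewer than M₀ big children carry at most (2M₀)^d q^(g+1) leaves each. Beyond
    -- these, (2M₀)^d q^g leaves for each of at most M children account for the rest. As M = M₀q,
    -- both contributions are at most M₀(2M₀)^d q^(g+1), whence the 2 in 2M₀.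
    · exfalso
      push Not at hbig hone'
      obtain ⟨x₀, hx₀⟩ := hne
      have hChM : (Ch.card : ℝ) ≤ M := by
        refine le_trans ?_ (hbr k le_rfl (by omega) x₀ hx₀)
        have : F.filter (fun y => node k y = node k x₀) = F :=
          Finset.filter_true_of_mem fun y hy => hF y hy x₀ hx₀
        rw [this]
      have hFcard : F.card = ∑ c ∈ Ch, (fib c).card :=
        Finset.card_eq_sum_card_image (node (k + 1)) F
      have hP : 0 < (2 * M₀) ^ d * (M / M₀) ^ g := by positivity
      have hle : ∀ c ∈ Ch, ((fib c).card : ℝ) ≤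
          (if c ∈ Big then (2 * M₀) ^ d * (M / M₀) ^ (g + 1) else 0) +
            (2 * M₀) ^ d * (M / M₀) ^ g := by
        intro c hc
        split_ifs with h
        · linarith [hone' c hc]
        · have h' : ¬ (g = 0 ∨ (2 * M₀) ^ d * (M / M₀) ^ g < (fib c).card) := fun h' =>
            h (Finset.mem_filter.mpr ⟨hc, h'⟩)
          push Not at h'
          linarith [h'.2]
      have : (F.card : ℝ) ≤ (2 * M₀) ^ (d + 1) * (M / M₀) ^ (g + 1) := by
        calc (F.card : ℝ) = ∑ c ∈ Ch, ((fib c).card : ℝ) := by rw [hFcard]; push_cast; rfl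
          _ ≤ ∑ c ∈ Ch, ((if c ∈ Big then (2 * M₀) ^ d * (M / M₀) ^ (g + 1) else 0) +
            (2 * M₀) ^ d * (M / M₀) ^ g) := Finset.sum_le_sum hle
          _ = Big.card * ((2 * M₀) ^ d * (M / M₀) ^ (g + 1)) +
              Ch.card * ((2 * M₀) ^ d * (M / M₀) ^ g) := by
            rw [Finset.sum_add_distrib, ← Finset.sum_filter, Finset.sum_const, Finset.sum_const,
              nsmul_eq_mul, nsmul_eq_mul]
            congr 4
            ext c
            simp only [Finset.mem_filter, hBig]
            tauto
          _ ≤ M₀ * ((2 * M₀) ^ d * (M / M₀) ^ (g + 1)) + M * ((2 * M₀) ^ d * (M / M₀) ^ g) := by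
            gcongr
          _ = (2 * M₀) ^ (d + 1) * (M / M₀) ^ (g + 1) := by
            have : M = M₀ * (M / M₀) := by field_simp
            set q := M / M₀
            rw [this]
            ring
      linarith

end Mass

/-! ### Frostman regularity at most levels -/

/-- The weight `w` restricted to the node of `x` at level `ℓ k` satisfies a Frostman condition with
exponent `A` and constant `B` at all scales coarser than those of level `ℓ (k + 1)`. -/
def Regular (r : ℕ) (ℓ : ℕ → ℕ) (A B : ℝ) (F : Finset ℝ) (w : ℝ → ℝ) (k : ℕ) (x : ℝ) : Prop :=
  ∀ z u : ℝ, ((r : ℝ) ^ ℓ (k + 1))⁻¹ ≤ u →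
    mass F w {x' | code r (ℓ k) x' = code r (ℓ k) x ∧ x' ∈ Metric.closedBall z u} ≤
      B * (u * (r : ℝ) ^ ℓ k) ^ A * mass F w {x' | code r (ℓ k) x' = code r (ℓ k) x}

theorem regular_of_one_le {r : ℕ} {ℓ : ℕ → ℕ} {A B : ℝ} {F : Finset ℝ}
    {w : ℝ → ℝ} (hw : ∀ x, 0 ≤ w x) {k : ℕ} {x : ℝ} (z u : ℝ)
    (h : 1 ≤ B * (u * (r : ℝ) ^ ℓ k) ^ A) :
    mass F w {x' | code r (ℓ k) x' = code r (ℓ k) x ∧ x' ∈ Metric.closedBall z u} ≤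
      B * (u * (r : ℝ) ^ ℓ k) ^ A * mass F w {x' | code r (ℓ k) x' = code r (ℓ k) x} := by
  have h1 : mass F w {x' | code r (ℓ k) x' = code r (ℓ k) x ∧ x' ∈ Metric.closedBall z u} ≤
      mass F w {x' | code r (ℓ k) x' = code r (ℓ k) x} := mass_mono hw fun y _ hy => hy.1
  exact h1.trans (le_mul_of_one_le_left (mass_nonneg hw _) h)

/-- Lowering the exponent weakens the bound at scales below the cell, and above the cell the bound
is trivial. This allows exponents with sum at most 1 when the dimensions have a larger sum. -/
theorem Regular.mono_exponent {r : ℕ} {ℓ : ℕ → ℕ} (hr : 2 ≤ r) {a A B : ℝ} {F : Finset ℝ}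
    {w : ℝ → ℝ} {k : ℕ} {x : ℝ} (h : Regular r ℓ A B F w k x) (hw : ∀ x, 0 ≤ w x) (hB : 1 ≤ B)
    (ha : 0 ≤ a) (haA : a ≤ A) : Regular r ℓ a B F w k x := by
  intro z u hu
  have hu0 : 0 < u := lt_of_lt_of_le (by positivity) hu
  have hv : 0 < u * (r : ℝ) ^ ℓ k := by positivity
  rcases le_or_gt 1 (u * (r : ℝ) ^ ℓ k) with h1 | h1
  · refine regular_of_one_le hw z u ?_
    have := Real.one_le_rpow h1 ha
    nlinarith
  · refine (h z u hu).trans ?_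
    have := Real.rpow_le_rpow_of_exponent_ge hv h1.le haA
    have h2 := mass_nonneg (F := F) hw {x' | code r (ℓ k) x' = code r (ℓ k) x}
    gcongr

/-- An interval of length at most 2r^(-i) meets at most three consecutive cells of level i, and each
has at most `numCodes r X d` descendants d levels below. -/
theorem IsShiftInvariant.ncard_codes_closedBall_le {r : ℕ} {X : Set ℝ} (hr : 2 ≤ r)
    (hX : IsShiftInvariant r X) (i d : ℕ) (z u : ℝ) (hu : u * (r : ℝ) ^ i ≤ 1) :
    (code r (i + d) '' {x ∈ X | x ∈ Metric.closedBall z u}).ncard ≤ 3 * numCodes r X d := by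
  set c₀ : ℤ := ⌊(r : ℝ) ^ i * (z - u)⌋ with hc₀
  have hfin : ∀ c : ℤ, (code r (i + d) '' {x ∈ X | code r i x = c}).Finite := fun c =>
    (finite_codes hX.subset_Icc (i + d)).subset (Set.image_mono fun x hx => hx.1)
  have hsub : code r (i + d) '' {x ∈ X | x ∈ Metric.closedBall z u} ⊆
      (code r (i + d) '' {x ∈ X | code r i x = c₀} ∪
        code r (i + d) '' {x ∈ X | code r i x = c₀ + 1}) ∪
        code r (i + d) '' {x ∈ X | code r i x = c₀ + 2} := by
    rintro _ ⟨x, ⟨hx, hxb⟩, rfl⟩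
    rw [Metric.mem_closedBall, Real.dist_eq, abs_le] at hxb
    have hpos : (0 : ℝ) < (r : ℝ) ^ i := by positivity
    have h1 : c₀ ≤ code r i x := Int.floor_le_floor (by nlinarith)
    have h2 : code r i x ≤ c₀ + 2 := by
      have : code r i x < c₀ + 3 := by
        unfold code
        rw [Int.floor_lt]
        have := Int.lt_floor_add_one ((r : ℝ) ^ i * (z - u))
        push_cast
        rw [← hc₀] at this
        nlinarith
      omega
    have h3 : code r i x = c₀ ∨ code r i x = c₀ + 1 ∨ code r i x = c₀ + 2 := by omega
    rcases h3 with h3 | h3 | h3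
    · exact Or.inl (Or.inl ⟨x, ⟨hx, h3⟩, rfl⟩)
    · exact Or.inl (Or.inr ⟨x, ⟨hx, h3⟩, rfl⟩)
    · exact Or.inr ⟨x, ⟨hx, h3⟩, rfl⟩
  have h4 := Set.ncard_le_ncard hsub (((hfin _).union (hfin _)).union (hfin _))
  have h5 := Set.ncard_union_le (code r (i + d) '' {x ∈ X | code r i x = c₀} ∪
        code r (i + d) '' {x ∈ X | code r i x = c₀ + 1})
        (code r (i + d) '' {x ∈ X | code r i x = c₀ + 2})
  have h6 := Set.ncard_union_le (code r (i + d) '' {x ∈ X | code r i x = c₀})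
        (code r (i + d) '' {x ∈ X | code r i x = c₀ + 1})
  have h7 := hX.ncard_children_le i d c₀
  have h8 := hX.ncard_children_le i d (c₀ + 1)
  have h9 := hX.ncard_children_le i d (c₀ + 2)
  omega

/-- Equal splitting turns counts into masses: a ball of relative radius about r^(-j) meets at most
three times `numCodes` of the remaining depth many children, each worth at most 1/M₀. The hypothesis
on B says that this is a Frostman bound. -/
theorem IsShiftInvariant.regular_of_splits {r : ℕ} {X : Set ℝ} (hr : 2 ≤ r)
    (hX : IsShiftInvariant r X) {ℓ : ℕ → ℕ} (hℓ : Monotone ℓ) {A M₀ B : ℝ} (hA0 : 0 ≤ A)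
    (hA1 : A ≤ 1) (hM₀ : 0 < M₀) (hB1 : 1 ≤ B) {k : ℕ}
    (hB : ∀ j ≤ ℓ (k + 1) - ℓ k,
      3 * (numCodes r X (ℓ (k + 1) - ℓ k - j) : ℝ) ≤ B * (r : ℝ) ^ (-A * j) * M₀)
    {F : Finset ℝ} (hF : (F : Set ℝ) ⊆ X) {w : ℝ → ℝ} (hw : ∀ x, 0 ≤ w x) {x : ℝ}
    (hsp : Splits (fun k => code r (ℓ k)) M₀ F w k x) :
    Regular r ℓ A (r * B) F w k x := by
  have hr1 : (1 : ℝ) < r := by exact_mod_cast hr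
  have hr0 : (0 : ℝ) < r := by linarith
  intro z u hu
  have hu0 : 0 < u := lt_of_lt_of_le (by positivity) hu
  set v := u * (r : ℝ) ^ ℓ k with hv
  have hv0 : 0 < v := by positivity
  rcases le_or_gt 1 v with h1 | h1
  · refine regular_of_one_le hw z u ?_
    have := Real.one_le_rpow h1 hA0
    nlinarith [mul_le_mul hr1.le hB1 zero_le_one hr0.le]
  -- Rounding the relative radius v to a power of r costs the factor r in the constant r * B.
  obtain ⟨j, hj1, hj2⟩ := exists_nat_pow_near_of_lt_one hv0 h1.le (inv_pos.mpr hr0)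
    (inv_lt_one_of_one_lt₀ hr1)
  set Δ := ℓ (k + 1) - ℓ k with hΔ
  have hle := hℓ (Nat.le_succ k)
  have hsum : ℓ k + Δ = ℓ (k + 1) := by simp only [Nat.succ_eq_add_one] at hle; omega
  have hvΔ : ((r : ℝ)⁻¹) ^ Δ ≤ v := by
    rw [hv, ← div_le_iff₀ (by positivity)]
    refine le_of_eq_of_le ?_ hu
    rw [← hsum, pow_add, mul_inv, inv_pow]
    field_simp
  have hjΔ : j ≤ Δ := by
    by_contra hcon
    push Not at hcon
    have h2 : ((r : ℝ)⁻¹) ^ j < ((r : ℝ)⁻¹) ^ Δ :=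
      pow_lt_pow_right_of_lt_one₀ (inv_pos.mpr hr0) (inv_lt_one_of_one_lt₀ hr1) hcon
    linarith
  have hcount : ((fun k => code r (ℓ k)) (k + 1) '' {x' | x' ∈ F ∧
      (fun k => code r (ℓ k)) k x' = (fun k => code r (ℓ k)) k x ∧
        x' ∈ Metric.closedBall z u}).ncard ≤ 3 * numCodes r X (Δ - j) := by
    have h2 : u * (r : ℝ) ^ (ℓ k + j) ≤ 1 := by
      rw [pow_add, ← mul_assoc, ← hv]
      calc v * (r : ℝ) ^ j ≤ ((r : ℝ)⁻¹) ^ j * (r : ℝ) ^ j := by gcongr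
        _ = 1 := by rw [← mul_pow, inv_mul_cancel₀ hr0.ne', one_pow]
    refine le_trans (Set.ncard_le_ncard ?_ ?_)
      (hX.ncard_codes_closedBall_le hr (ℓ k + j) (Δ - j) z u h2)
    · rw [show ℓ k + j + (Δ - j) = ℓ (k + 1) by omega]
      exact Set.image_mono fun y hy => ⟨hF hy.1, hy.2.2⟩
    · exact (finite_codes hX.subset_Icc _).subset (Set.image_mono fun x hx => hx.1)
  have hcount' : (((fun k => code r (ℓ k)) (k + 1) '' {x' | x' ∈ F ∧
      (fun k => code r (ℓ k)) k x' = (fun k => code r (ℓ k)) k x ∧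
        x' ∈ Metric.closedBall z u}).ncard : ℝ) ≤ 3 * (numCodes r X (Δ - j) : ℝ) := by
    exact_mod_cast hcount
  have h3 := hsp (Metric.closedBall z u)
  have hm := mass_nonneg (F := F) hw {x' | code r (ℓ k) x' = code r (ℓ k) x}
  have h4 : mass F w {x' | code r (ℓ k) x' = code r (ℓ k) x ∧ x' ∈ Metric.closedBall z u} * M₀ ≤
      (B * (r : ℝ) ^ (-A * j) * M₀) * mass F w {x' | code r (ℓ k) x' = code r (ℓ k) x} :=
    h3.trans (mul_le_mul_of_nonneg_right (hcount'.trans (hB j hjΔ)) hm)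
  have h5 : mass F w {x' | code r (ℓ k) x' = code r (ℓ k) x ∧ x' ∈ Metric.closedBall z u} ≤
      B * (r : ℝ) ^ (-A * j) * mass F w {x' | code r (ℓ k) x' = code r (ℓ k) x} := by
    refine le_of_mul_le_mul_right (h4.trans_eq ?_) hM₀
    ring
  refine h5.trans (mul_le_mul_of_nonneg_right ?_ hm)
  have h6 : (r : ℝ) ^ (-A * j) ≤ r * v ^ A := by
    have h7 : ((r : ℝ)⁻¹) ^ j ≤ r * v := by
      rw [pow_succ] at hj1
      have := mul_lt_mul_of_pos_left hj1 hr0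
      rw [mul_left_comm, mul_inv_cancel₀ hr0.ne', mul_one] at this
      exact this.le
    calc (r : ℝ) ^ (-A * j) = (((r : ℝ)⁻¹) ^ j) ^ A := by
          rw [← Real.rpow_natCast, ← Real.rpow_mul (by positivity), Real.inv_rpow hr0.le,
            ← Real.rpow_neg hr0.le]
          ring_nf
      _ ≤ (r * v) ^ A := Real.rpow_le_rpow (by positivity) h7 hA0
      _ = (r : ℝ) ^ A * v ^ A := Real.mul_rpow hr0.le hv0.le
      _ ≤ r * v ^ A := by
          have : (r : ℝ) ^ A ≤ r := by
            simpa using Real.rpow_le_rpow_of_exponent_le hr1.le hA1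
          gcongr
  calc B * (r : ℝ) ^ (-A * j) ≤ B * (r * v ^ A) := by gcongr
    _ = r * B * v ^ A := by ring

-- One representative for each code of level ℓ K gives a tree with `numCodes r X (ℓ K)` leaves,
-- whose branching is at most M by invariance. The splitting lemma applies to it, and splitting
-- levels are regular.
open Classical in
theorem IsShiftInvariant.exists_regular_weight_of_counts {r : ℕ} {X : Set ℝ} (hr : 2 ≤ r)
    (hX : IsShiftInvariant r X) (hne : X.Nonempty) {ℓ : ℕ → ℕ} (hℓ : Monotone ℓ) (hℓ0 : ℓ 0 = 0)
    {A M M₀ B : ℝ} (hA0 : 0 ≤ A) (hA1 : A ≤ 1) (hM₀ : 1 ≤ M₀) (hM : M₀ ≤ M) (hB1 : 1 ≤ B)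
    {K g : ℕ} (hMk : ∀ k, (numCodes r X (ℓ (k + 1) - ℓ k) : ℝ) ≤ M)
    (hB : ∀ k, ∀ j ≤ ℓ (k + 1) - ℓ k,
      3 * (numCodes r X (ℓ (k + 1) - ℓ k - j) : ℝ) ≤ B * (r : ℝ) ^ (-A * j) * M₀)
    (hg : g = 0 ∨ (2 * M₀) ^ K * (M / M₀) ^ g < numCodes r X (ℓ K)) :
    ∃ F : Finset ℝ, (F : Set ℝ) ⊆ X ∧ ∃ w : ℝ → ℝ, (∀ x, 0 ≤ w x) ∧ mass F w Set.univ = 1 ∧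
      ∀ x ∈ F, ((Finset.range K).filter (fun k => ¬ Regular r ℓ A (r * B) F w k x)).card ≤
        K - g := by
  have hfin := finite_codes (r := r) hX.subset_Icc (ℓ K)
  have hrep : ∀ c, ∃ x, c ∈ code r (ℓ K) '' X → x ∈ X ∧ code r (ℓ K) x = c := by
    intro c
    by_cases hc : c ∈ code r (ℓ K) '' X
    · obtain ⟨x, hx⟩ := hc
      exact ⟨x, fun _ => hx⟩
    · exact ⟨0, fun h => absurd h hc⟩
  choose rep hrep using hrep
  set F₀ : Finset ℝ := hfin.toFinset.image rep with hF₀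
  have hF₀X : ∀ x ∈ F₀, x ∈ X := by
    intro x hx
    obtain ⟨c, hc, rfl⟩ := Finset.mem_image.mp hx
    exact (hrep c (hfin.mem_toFinset.mp hc)).1
  have hrepinj : Set.InjOn rep (hfin.toFinset : Set ℤ) := by
    intro c hc c' hc' h
    rw [Set.Finite.coe_toFinset] at hc hc'
    rw [← (hrep c hc).2, ← (hrep c' hc').2, h]
  have hcard : F₀.card = numCodes r X (ℓ K) := by
    rw [hF₀, Finset.card_image_of_injOn hrepinj, numCodes, Set.ncard_eq_toFinset_card _ hfin]
  have hF₀ne : F₀.Nonempty := by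
    rw [← Finset.card_pos, hcard]
    exact numCodes_pos hX.subset_Icc hne _
  have hex := exists_splitting_weight (fun k => code r (ℓ k))
      (fun k x y h => code_eq_of_le hr (hℓ (Nat.le_succ k)) h) hM₀ hM K 0 g F₀ hF₀ne ?_ ?_ ?_
      (by rw [hcard]; exact hg)
  · obtain ⟨F, hFF₀, -, w, hw, hmass, hsplit⟩ := hex
    have hFX : (F : Set ℝ) ⊆ X := fun x hx => hF₀X x (hFF₀ hx)
    refine ⟨F, hFX, w, hw, hmass, fun x hx => ?_⟩
    have h1 := hsplit x hx
    rw [zero_add, ← Finset.range_eq_Ico] at h1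
    have h2 := Finset.card_filter_add_card_filter_not (s := Finset.range K)
      (fun i => Splits (fun k => code r (ℓ k)) M₀ F w i x)
    rw [Finset.card_range] at h2
    have h3 : ((Finset.range K).filter (fun k => ¬ Regular r ℓ A (r * B) F w k x)).card ≤
        ((Finset.range K).filter
          (fun i => ¬ Splits (fun k => code r (ℓ k)) M₀ F w i x)).card := by
      refine Finset.card_le_card fun k hk => ?_
      rw [Finset.mem_filter] at hk ⊢
      exact ⟨hk.1, fun h => hk.2
        (hX.regular_of_splits hr hℓ hA0 hA1 (by linarith) hB1 (hB k) hFX hw h)⟩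
    omega
  · intro x hx y hy
    simp only [hℓ0]
    rw [code_zero_eq (hX.subset_Ico (hF₀X x hx)), code_zero_eq (hX.subset_Ico (hF₀X y hy))]
  · intro x hx y hy h
    obtain ⟨c, hc, rfl⟩ := Finset.mem_image.mp hx
    obtain ⟨c', hc', rfl⟩ := Finset.mem_image.mp hy
    simp only [zero_add] at h
    rw [(hrep c (hfin.mem_toFinset.mp hc)).2, (hrep c' (hfin.mem_toFinset.mp hc')).2] at h
    rw [h]
  · intro i _ _ x _
    refine le_trans ?_ (hMk i)
    have hle : ℓ i ≤ ℓ (i + 1) := hℓ (Nat.le_succ i)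
    have h1 := hX.ncard_children_le (ℓ i) (ℓ (i + 1) - ℓ i) (code r (ℓ i) x)
    rw [Nat.add_sub_cancel' hle] at h1
    refine le_trans ?_ (Nat.cast_le.mpr h1)
    rw [← Set.ncard_coe_finset]
    refine Nat.cast_le.mpr (Set.ncard_le_ncard ?_ ?_)
    · intro c hc
      simp only [Finset.mem_coe, Finset.mem_image, Finset.mem_filter] at hc
      obtain ⟨y, hy, rfl⟩ := hc
      exact ⟨y, ⟨hF₀X y hy.1, hy.2⟩, rfl⟩
    · exact (finite_codes hX.subset_Icc _).subset (Set.image_mono fun x hx => hx.1)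

set_option maxHeartbeats 1000000 in
open Classical in
/-- A weight on `X` that is Frostman regular with the box dimension of `X` as its exponent, at most
levels along every branch. -/
theorem IsShiftInvariant.exists_regular_weight {r : ℕ} {X : Set ℝ} (hr : 2 ≤ r)
    (hX : IsShiftInvariant r X) (hne : X.Nonempty) {A : ℝ} (hA0 : 0 ≤ A) (hA1 : A ≤ 1)
    (hlow : ∀ n : ℕ, (r : ℝ) ^ (A * n) ≤ numCodes r X n)
    (hup : ∀ ε > 0, ∃ C : ℝ, 1 ≤ C ∧
      ∀ n : ℕ, (numCodes r X n : ℝ) ≤ C * (r : ℝ) ^ ((A + ε) * n))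
    {e δ : ℝ} (he : 0 < e) (hδ0 : 0 < δ) (hδ1 : δ < 1) :
    ∃ C : ℝ, 1 ≤ C ∧ ∃ L₀ : ℕ, ∀ L ≥ L₀, ∀ ℓ : ℕ → ℕ, ℓ 0 = 0 →
      (∀ k, ℓ k + L ≤ ℓ (k + 1) ∧ ℓ (k + 1) ≤ ℓ k + L + 1) → ∀ K : ℕ,
      ∃ F : Finset ℝ, (F : Set ℝ) ⊆ X ∧ ∃ w : ℝ → ℝ, (∀ x, 0 ≤ w x) ∧ mass F w Set.univ = 1 ∧
        ∀ x ∈ F, (((Finset.range K).filter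
          (fun k => ¬ Regular r ℓ A (C * (r : ℝ) ^ (2 * e * L)) F w k x)).card : ℝ) ≤
            δ * K + 1 := by
  have hr1 : (1 : ℝ) < r := by exact_mod_cast hr
  have hr0 : (0 : ℝ) < r := by linarith
  rcases le_or_gt A e with hAe | hAe
  -- If A ≤ e a point mass will do: at the scales in question r^(2eL) outweighs (r^(-L-1))^A.
  · refine ⟨1, le_rfl, 1, fun L hL ℓ _ hstep K => ?_⟩
    obtain ⟨x₀, hx₀⟩ := hne
    refine ⟨{x₀}, by simpa using hx₀, fun _ => 1, fun _ => zero_le_one, by simp [mass],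
      fun x _ => ?_⟩
    rw [Finset.filter_false_of_mem]
    · simp only [Finset.card_empty, Nat.cast_zero]; positivity
    intro k _ hk
    refine hk fun z u hu => regular_of_one_le (fun _ => zero_le_one) z u ?_
    have hL' : (1 : ℝ) ≤ L := by exact_mod_cast hL
    have hv : (r : ℝ) ^ (-((L : ℝ) + 1)) ≤ u * (r : ℝ) ^ ℓ k := by
      rw [← div_le_iff₀ (by positivity)]
      refine le_trans ?_ hu
      rw [Real.rpow_neg hr0.le, ← Nat.cast_succ, Real.rpow_natCast, div_eq_mul_inv, ← mul_inv,
        ← pow_add]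
      refine inv_anti₀ (by positivity) (pow_le_pow_right₀ hr1.le ?_)
      have := (hstep k).2
      omega
    have h1 : (r : ℝ) ^ (-((L : ℝ) + 1) * A) ≤ (u * (r : ℝ) ^ ℓ k) ^ A := by
      rw [Real.rpow_mul hr0.le]
      exact Real.rpow_le_rpow (by positivity) hv hA0
    calc (1 : ℝ) ≤ (r : ℝ) ^ (2 * e * L + -((L : ℝ) + 1) * A) := by
          refine Real.one_le_rpow hr1.le ?_
          nlinarith
      _ = (r : ℝ) ^ (2 * e * L) * (r : ℝ) ^ (-((L : ℝ) + 1) * A) := Real.rpow_add hr0 _ _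
      _ ≤ 1 * (r : ℝ) ^ (2 * e * L) * (u * (r : ℝ) ^ ℓ k) ^ A := by rw [one_mul]; gcongr
  -- Per unit of L, the leaf count to be beaten has exponent ε + (A - e) + (ε + e)(1 - δ), the first
  -- ε paying for the factor 2D. This is A + 2ε - eδ - εδ, at most A because 2ε = eδ.
  set ε := e * δ / 2 with hε
  have hε0 : 0 < ε := by positivity
  have hεe : ε ≤ e := by rw [hε]; nlinarith
  obtain ⟨C₁, hC₁, hC₁up⟩ := hup ε hε0
  set D := C₁ * (r : ℝ) ^ (A + ε) with hD
  have hD1 : 1 ≤ D := by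
    have := Real.one_le_rpow hr1.le (by linarith : 0 ≤ A + ε)
    rw [hD]; nlinarith
  have hrε : 1 < (r : ℝ) ^ ε := Real.one_lt_rpow hr1 hε0
  obtain ⟨L₀, hL₀⟩ := pow_unbounded_of_one_lt (2 * D) hrε
  refine ⟨r * (3 * D), by nlinarith, L₀, fun L hL ℓ hℓ0 hstep K => ?_⟩
  have hLD : 2 * D < (r : ℝ) ^ (ε * L) := by
    rw [Real.rpow_mul hr0.le, Real.rpow_natCast]
    exact hL₀.trans_le (pow_le_pow_right₀ hrε.le hL)
  have hℓ : Monotone ℓ := monotone_nat_of_le_succ fun k => by have := (hstep k).1; omega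
  -- The required splitting M₀ falls short of the expected branching by r^(eL); M bounds the
  -- branching of every block, of length L or L + 1.
  set M₀ := (r : ℝ) ^ ((A - e) * L) with hM₀
  set M := D * (r : ℝ) ^ ((A + ε) * L) with hM
  have hM₀1 : 1 ≤ M₀ := Real.one_le_rpow hr1.le (by
    have : (0 : ℝ) ≤ L := Nat.cast_nonneg L
    have : 0 < A - e := by linarith
    positivity)
  have hMM₀ : M / M₀ = D * (r : ℝ) ^ ((ε + e) * L) := by
    rw [hM, hM₀, mul_div_assoc, ← Real.rpow_sub hr0]
    congr 2
    ring
  have hpow1 : 1 ≤ (r : ℝ) ^ ((ε + e) * L) := Real.one_le_rpow hr1.le (by positivity)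
  have hq1 : 1 ≤ M / M₀ := by rw [hMM₀]; nlinarith
  have hM₀M : M₀ ≤ M := (one_le_div (by linarith)).mp hq1
  have hupL : ∀ n : ℕ, n ≤ L + 1 → (numCodes r X n : ℝ) ≤ M := by
    intro n hn
    refine (hC₁up n).trans ?_
    have hn' : (n : ℝ) ≤ L + 1 := by exact_mod_cast hn
    calc C₁ * (r : ℝ) ^ ((A + ε) * n) ≤ C₁ * (r : ℝ) ^ ((A + ε) + (A + ε) * L) := by
          gcongr
          · exact hr1.le
          · nlinarith
      _ = M := by rw [hM, hD, Real.rpow_add hr0]; ring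
  set B := 3 * D * (r : ℝ) ^ (2 * e * L) with hB
  have hB1 : 1 ≤ B := by
    have : 1 ≤ (r : ℝ) ^ (2 * e * L) := Real.one_le_rpow hr1.le (by positivity)
    rw [hB]; nlinarith
  have hex := hX.exists_regular_weight_of_counts hr hne hℓ hℓ0 hA0 hA1
    hM₀1 hM₀M hB1 (K := K) (g := ⌊(1 - δ) * K⌋₊)
    (fun k => hupL _ (by have := (hstep k).2; omega)) (fun k j hj => ?_) ?_
  · obtain ⟨F, hF, w, hw, hmass, hreg⟩ := hex
    refine ⟨F, hF, w, hw, hmass, fun x hx => ?_⟩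
    have h1 := hreg x hx
    rw [show (r : ℝ) * B = r * (3 * D) * (r : ℝ) ^ (2 * e * L) by rw [hB]; ring] at h1
    refine (Nat.cast_le.mpr h1).trans ?_
    have h2 := Nat.lt_floor_add_one ((1 - δ) * (K : ℝ))
    have h3 : ⌊(1 - δ) * (K : ℝ)⌋₊ ≤ K := by
      refine Nat.floor_le_of_le ?_
      have : (0 : ℝ) ≤ K := Nat.cast_nonneg K
      nlinarith
    rw [Nat.cast_sub h3]
    linarith
  · set Δ := ℓ (k + 1) - ℓ k with hΔ
    have hΔL : Δ ≤ L + 1 := by have := (hstep k).2; omega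
    have h1 : ((Δ - j : ℕ) : ℝ) ≤ L + 1 - j := by
      rw [Nat.cast_sub hj]
      have : (Δ : ℝ) ≤ L + 1 := by exact_mod_cast hΔL
      linarith
    have h2 : (0 : ℝ) ≤ j := Nat.cast_nonneg j
    have h3 : (0 : ℝ) ≤ L := Nat.cast_nonneg L
    calc 3 * (numCodes r X (Δ - j) : ℝ) ≤ 3 * (C₁ * (r : ℝ) ^ ((A + ε) * (Δ - j : ℕ))) := by
          gcongr
          exact hC₁up _
      _ ≤ 3 * (C₁ * (r : ℝ) ^ ((A + ε) + 2 * e * L + -A * j + (A - e) * L)) := by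
          gcongr
          · exact hr1.le
          · have : (A + ε) * ((Δ - j : ℕ) : ℝ) ≤ (A + ε) * (L + 1 - j) := by gcongr
            nlinarith [mul_nonneg hε0.le h2, mul_nonneg (sub_nonneg.mpr hεe) h3]
      _ = B * (r : ℝ) ^ (-A * j) * M₀ := by
          rw [hB, hD, hM₀, Real.rpow_add hr0, Real.rpow_add hr0, Real.rpow_add hr0]
          ring
  · rcases Nat.eq_zero_or_pos K with rfl | hK
    · left; simp
    right
    have hK0 : (0 : ℝ) < K := by exact_mod_cast hK
    have hq0 : 0 < M / M₀ := by linarith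
    have hbase : 2 * M₀ * (M / M₀) ^ (1 - δ) < (r : ℝ) ^ (A * L) := by
      have h1 : (M / M₀) ^ (1 - δ) ≤ D * (r : ℝ) ^ ((ε + e) * L * (1 - δ)) := by
        rw [hMM₀, Real.mul_rpow (by linarith) (by positivity), ← Real.rpow_mul hr0.le]
        gcongr
        simpa using Real.rpow_le_rpow_of_exponent_le hD1 (by linarith : 1 - δ ≤ 1)
      have h3 : (0 : ℝ) ≤ L := Nat.cast_nonneg L
      calc 2 * M₀ * (M / M₀) ^ (1 - δ)
          ≤ 2 * M₀ * (D * (r : ℝ) ^ ((ε + e) * L * (1 - δ))) := by gcongr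
        _ = 2 * D * (r : ℝ) ^ ((A - e) * L + (ε + e) * L * (1 - δ)) := by
          rw [Real.rpow_add hr0, hM₀]; ring
        _ < (r : ℝ) ^ (ε * L) * (r : ℝ) ^ ((A - e) * L + (ε + e) * L * (1 - δ)) := by
          gcongr
        _ = (r : ℝ) ^ (ε * L + ((A - e) * L + (ε + e) * L * (1 - δ))) :=
          (Real.rpow_add hr0 _ _).symm
        _ ≤ (r : ℝ) ^ (A * L) := by
          refine Real.rpow_le_rpow_of_exponent_le hr1.le ?_
          have : ε * L + ((A - e) * L + (ε + e) * L * (1 - δ)) =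
            A * L + (2 * ε - e * δ - ε * δ) * L := by ring
          rw [this]
          have h4 : 2 * ε - e * δ - ε * δ ≤ 0 := by
            have : 2 * ε = e * δ := by rw [hε]; ring
            have : 0 ≤ ε * δ := by positivity
            linarith
          nlinarith
    have h1 : (M / M₀) ^ ⌊(1 - δ) * (K : ℝ)⌋₊ ≤ ((M / M₀) ^ (1 - δ)) ^ K := by
      rw [← Real.rpow_natCast, ← Real.rpow_natCast, ← Real.rpow_mul hq0.le]
      refine Real.rpow_le_rpow_of_exponent_le hq1 (Nat.floor_le ?_)
      have : 0 < 1 - δ := by linarith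
      positivity
    have hKL : (K : ℝ) * L ≤ ℓ K := by
      have : ∀ k, k * L ≤ ℓ k := by
        intro k
        induction k with
        | zero => simp
        | succ k ih =>
          have := (hstep k).1
          rw [Nat.succ_mul]
          omega
      exact_mod_cast this K
    calc (2 * M₀) ^ K * (M / M₀) ^ ⌊(1 - δ) * (K : ℝ)⌋₊
        ≤ (2 * M₀) ^ K * ((M / M₀) ^ (1 - δ)) ^ K := by gcongr
      _ = (2 * M₀ * (M / M₀) ^ (1 - δ)) ^ K := (mul_pow _ _ _).symm
      _ < ((r : ℝ) ^ (A * L)) ^ K := pow_lt_pow_left₀ hbase (by positivity) hK.ne'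
      _ = (r : ℝ) ^ (A * (K * L)) := by
        rw [← Real.rpow_natCast, ← Real.rpow_mul hr0.le]
        ring_nf
      _ ≤ (r : ℝ) ^ (A * ℓ K) := by
        gcongr
        exact hr1.le
      _ ≤ numCodes r X (ℓ K) := hlow _

/-! ### Rare bad levels and multiplied gains -/

open Classical in
/-- The maximal inequality on an interval of integers. -/
theorem card_bad_starts_le (b : ℕ → Prop) {δ : ℝ} (hδ : 0 ≤ δ) (K : ℕ) :
    δ * ((Finset.range K).filter (fun l => ∃ q, l + q ≤ K ∧
      δ * q < ((Finset.Ico l (l + q)).filter b).card)).card ≤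
      ((Finset.range K).filter b).card := by
  set bad : ℕ → Prop := fun l => ∃ q, l + q ≤ K ∧
      δ * q < ((Finset.Ico l (l + q)).filter b).card with hbad
  suffices h : ∀ n a, K - a = n → a ≤ K → δ * ((Finset.Ico a K).filter bad).card ≤
      ((Finset.Ico a K).filter b).card by
    have := h (K - 0) 0 rfl (Nat.zero_le K)
    rwa [← Finset.range_eq_Ico] at this
  intro n
  induction n using Nat.strong_induction_on with
  | _ n ih =>
    intro a hn haK
    rcases haK.eq_or_lt with rfl | haK
    · simp
    -- From a bad start, skip its whole interval: it contains at most q bad starts but more than δq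
    -- elements satisfying b.
    by_cases ha : bad a
    · obtain ⟨q, hq, hlt⟩ := ha
      have hq0 : 0 < q := by
        rcases Nat.eq_zero_or_pos q with rfl | h
        · simp at hlt
        · exact h
      have hsplit : ∀ c : ℕ → Prop, ((Finset.Ico a K).filter c).card =
          ((Finset.Ico a (a + q)).filter c).card + ((Finset.Ico (a + q) K).filter c).card := by
        intro c
        rw [← Finset.Ico_union_Ico_eq_Ico (Nat.le_add_right a q) hq, Finset.filter_union,
          Finset.card_union_of_disjoint]
        exact Finset.disjoint_filter_filter (Finset.Ico_disjoint_Ico_consecutive _ _ _)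
      rw [hsplit bad, hsplit b]
      have h1 := ih (K - (a + q)) (by omega) (a + q) rfl hq
      have h2 : (((Finset.Ico a (a + q)).filter bad).card : ℝ) ≤ q := by
        have := Finset.card_filter_le (Finset.Ico a (a + q)) bad
        rw [Nat.card_Ico, Nat.add_sub_cancel_left] at this
        exact_mod_cast this
      push_cast
      nlinarith
    · have h1 := ih (K - (a + 1)) (by omega) (a + 1) rfl haK
      have h2 : Finset.Ico a K = insert a (Finset.Ico (a + 1) K) :=
        (Finset.insert_Ico_add_one_left_eq_Ico haK).symm
      rw [h2, Finset.filter_insert, if_neg ha]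
      refine h1.trans (Nat.cast_le.mpr (Finset.card_le_card ?_))
      exact Finset.filter_subset_filter _ (Finset.subset_insert _ _)

open Classical in
/-- If at every good level a set `S` only meets a proportion `1 / P` of the mass of a node, then
the part of `S` with many good levels has small mass. -/
theorem sum_pow_good_le {α β : Type*} (node : ℕ → α → β)
    (href : ∀ k x y, node (k + 1) x = node (k + 1) y → node k x = node k y)
    {F : Finset α} {w : α → ℝ} (hw : ∀ x, 0 ≤ w x) {P : ℝ} (hP : 1 ≤ P) (Good : ℕ → α → Prop)
    (S : Set α) (l k : ℕ)
    (hyp : ∀ j, l ≤ j → j < k → ∀ p ∈ F, p ∈ S → Good j p →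
      P * mass F w {q | node j q = node j p ∧
        ∃ q' ∈ F, q' ∈ S ∧ node (j + 1) q' = node (j + 1) q} ≤
        mass F w {q | node j q = node j p}) (d : ℕ) :
    ∀ j, l ≤ j → j + d = k → ∀ c : β,
      ∑ p ∈ F.filter (fun p => node j p = c ∧ p ∈ S),
        w p * P ^ ((Finset.Ico j k).filter (fun i => Good i p)).card ≤
        mass F w {q | node j q = c} := by
  have hP0 : 0 < P := by linarith
  induction d with
  | zero =>
    intro j _ hjk c
    rw [add_zero] at hjk
    subst hjk
    simp only [Finset.Ico_self, Finset.filter_empty, Finset.card_empty, pow_zero, mul_one]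
    rw [mass, Finset.sum_filter]
    refine Finset.sum_le_sum fun p _ => ?_
    split_ifs with h
    · simp [h.1]
    · exact Set.indicator_nonneg (fun x _ => hw x) p
  | succ d ih =>
    intro j hlj hjk c
    set Φ := F.filter (fun p => node j p = c ∧ p ∈ S) with hΦ
    have hΦm : ∀ p, p ∈ Φ ↔ p ∈ F ∧ node j p = c ∧ p ∈ S := fun p => Finset.mem_filter
    -- The sum without the factor for level j. By induction it is at most the mass of those children
    -- that S meets.
    set T := ∑ p ∈ Φ, w p * P ^ ((Finset.Ico (j + 1) k).filter (fun i => Good i p)).card with hT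
    have hTle : T ≤ mass F w {q | node j q = c ∧
        ∃ q' ∈ F, q' ∈ S ∧ node (j + 1) q' = node (j + 1) q} := by
      have h1 : ∀ c' ∈ Φ.image (node (j + 1)), ∑ p ∈ Φ with node (j + 1) p = c',
          w p * P ^ ((Finset.Ico (j + 1) k).filter (fun i => Good i p)).card ≤
          mass F w {q | node (j + 1) q = c'} := by
        intro c' _
        refine le_trans (Finset.sum_le_sum_of_subset_of_nonneg ?_ ?_)
          (ih (j + 1) (by omega) (by omega) c')
        · intro p hp
          rw [Finset.mem_filter, hΦm] at hp
          exact Finset.mem_filter.mpr ⟨hp.1.1, hp.2, hp.1.2.2⟩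
        · intro p _ _
          have := hw p
          positivity
      calc T = ∑ c' ∈ Φ.image (node (j + 1)), ∑ p ∈ Φ with node (j + 1) p = c',
          w p * P ^ ((Finset.Ico (j + 1) k).filter (fun i => Good i p)).card :=
            (Finset.sum_fiberwise_of_maps_to
              (fun p hp => Finset.mem_image_of_mem _ hp) _).symm
        _ ≤ ∑ c' ∈ Φ.image (node (j + 1)), mass F w {q | node (j + 1) q = c'} :=
            Finset.sum_le_sum h1
        _ = ∑ q ∈ F, ∑ c' ∈ Φ.image (node (j + 1)), {q | node (j + 1) q = c'}.indicator w q :=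
            Finset.sum_comm
        _ ≤ _ := by
            refine Finset.sum_le_sum fun q hq => ?_
            have h2 : ∑ c' ∈ Φ.image (node (j + 1)), {q | node (j + 1) q = c'}.indicator w q =
                if node (j + 1) q ∈ Φ.image (node (j + 1)) then w q else 0 := by
              rw [← Finset.sum_ite_eq (Φ.image (node (j + 1))) (node (j + 1) q) (fun _ => w q)]
              refine Finset.sum_congr rfl fun c' _ => ?_
              by_cases h : node (j + 1) q = c' <;> simp [h]
            rw [h2]
            split_ifs with h
            · obtain ⟨q', hq', hqq⟩ := Finset.mem_image.mp h
              rw [hΦm] at hq'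
              have hmem : q ∈ {q | node j q = c ∧
                  ∃ q' ∈ F, q' ∈ S ∧ node (j + 1) q' = node (j + 1) q} :=
                ⟨(href _ _ _ hqq).symm.trans hq'.2.1, q', hq'.1, hq'.2.2, hqq⟩
              rw [Set.indicator_of_mem hmem]
            · exact Set.indicator_nonneg (fun x _ => hw x) q
    have hIco : Finset.Ico j k = insert j (Finset.Ico (j + 1) k) :=
      (Finset.insert_Ico_add_one_left_eq_Ico (by omega)).symm
    have hcnt : ∀ p, ((Finset.Ico j k).filter (fun i => Good i p)).card ≤
        ((Finset.Ico (j + 1) k).filter (fun i => Good i p)).card + 1 := by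
      intro p
      rw [hIco, Finset.filter_insert]
      split_ifs
      · exact Finset.card_insert_le _ _
      · omega
    -- One good point is enough: the hypothesis then bounds the mass of all children of the node
    -- that meet S, so every term can afford the extra factor P.
    by_cases hex : ∃ p ∈ Φ, Good j p
    · obtain ⟨p, hp, hgood⟩ := hex
      rw [hΦm] at hp
      have h1 := hyp j hlj (by omega) p hp.1 hp.2.2 hgood
      rw [hp.2.1] at h1
      calc ∑ p ∈ Φ, w p * P ^ ((Finset.Ico j k).filter (fun i => Good i p)).card
          ≤ ∑ p ∈ Φ, P * (w p *
              P ^ ((Finset.Ico (j + 1) k).filter (fun i => Good i p)).card) := by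
            refine Finset.sum_le_sum fun p _ => ?_
            rw [mul_left_comm, ← pow_succ']
            exact mul_le_mul_of_nonneg_left (pow_le_pow_right₀ hP (hcnt p)) (hw p)
        _ = P * T := by rw [hT, Finset.mul_sum]
        _ ≤ _ := (mul_le_mul_of_nonneg_left hTle hP0.le).trans h1
    · push Not at hex
      calc ∑ p ∈ Φ, w p * P ^ ((Finset.Ico j k).filter (fun i => Good i p)).card = T := by
            refine Finset.sum_congr rfl fun p hp => ?_
            rw [hIco, Finset.filter_insert, if_neg (hex p hp)]
        _ ≤ _ := hTle.trans (mass_mono hw fun q _ hq => hq.1)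

/-! ### A discretised projection theorem -/

theorem mass_prod {α β : Type*} (F : Finset α) (G : Finset β) (w : α → ℝ) (v : β → ℝ)
    (S : Set α) (T : Set β) :
    mass (F ×ˢ G) (fun p => w p.1 * v p.2) {p | p.1 ∈ S ∧ p.2 ∈ T} = mass F w S * mass G v T := by
  rw [mass, mass, mass, Finset.sum_mul_sum, Finset.sum_product]
  refine Finset.sum_congr rfl fun x _ => Finset.sum_congr rfl fun y _ => ?_
  by_cases hx : x ∈ S <;> by_cases hy : y ∈ T <;> simp [hx, hy]

open Classical in
/-- Two lines through points at distance `d` from each other are close for a small proportion of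
the directions `1 + j / Q`. -/
theorem card_close_directions_le {Q : ℕ} (hQ : 0 < Q) {c dx dy η : ℝ} (hc : |c| = 1)
    (hdy : dy ≠ 0) (hη : 0 ≤ η) :
    (((Finset.range Q).filter
      (fun j : ℕ => |dx + c * (1 + j / Q) * dy| ≤ η)).card : ℝ) ≤ 1 + 2 * η * Q / |dy| := by
  set J := (Finset.range Q).filter (fun j : ℕ => |dx + c * (1 + j / Q) * dy| ≤ η) with hJ
  have hQ' : (0 : ℝ) < Q := by exact_mod_cast hQ
  have hdy' : 0 < |dy| := abs_pos.mpr hdy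
  have hnn : 0 ≤ 2 * η * Q / |dy| := by positivity
  rcases J.eq_empty_or_nonempty with h | h
  · rw [h]; simp only [Finset.card_empty, Nat.cast_zero]; linarith
  have hsub : J ⊆ Finset.Icc (J.min' h) (J.max' h) := fun j hj =>
    Finset.mem_Icc.mpr ⟨J.min'_le j hj, J.le_max' j hj⟩
  have hcard := Finset.card_le_card hsub
  rw [Nat.card_Icc] at hcard
  have hle : J.min' h ≤ J.max' h := J.min'_le _ (J.max'_mem h)
  have h1 := (Finset.mem_filter.mp (J.min'_mem h)).2
  have h2 := (Finset.mem_filter.mp (J.max'_mem h)).2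
  set m := J.min' h
  set M := J.max' h
  have h3 : |c * ((M - m : ℝ) / Q) * dy| ≤ 2 * η := by
    have : c * ((M - m : ℝ) / Q) * dy =
        (dx + c * (1 + M / Q) * dy) - (dx + c * (1 + m / Q) * dy) := by ring
    rw [this]
    exact (abs_sub _ _).trans (by linarith)
  have hMm : (m : ℝ) ≤ M := by exact_mod_cast hle
  rw [abs_mul, abs_mul, hc, one_mul, abs_of_nonneg (div_nonneg (sub_nonneg.mpr hMm) hQ'.le)] at h3
  have h4 : (M - m : ℝ) ≤ 2 * η * Q / |dy| := by
    rw [le_div_iff₀ hdy']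
    rw [div_mul_eq_mul_div, div_le_iff₀ hQ'] at h3
    exact h3
  have h5 : (J.card : ℝ) ≤ M + 1 - m := by
    have : J.card + m ≤ M + 1 := by omega
    have : ((J.card + m : ℕ) : ℝ) ≤ ((M + 1 : ℕ) : ℝ) := by exact_mod_cast this
    push_cast at this
    linarith
  linarith

-- If one direction brings the points close, then |dx| is controlled by |dy|, and the proportion of
-- such directions decays like the inverse of |dy|. Decomposing dyadically in |dy| leaves only
-- conditions on dx and dy separately, so that product masses and the two Frostman bounds apply. The
-- lower bound on Q absorbs the rounding term 1 at every scale.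
open Classical in
theorem card_close_directions_le_sum {Q I : ℕ} (hQ : 2 ^ I ≤ Q) {c dx dy R h τ : ℝ}
    (hc : |c| = 1) (hR : 1 ≤ R) (hh : 1 ≤ h) (hτ : 0 < τ) (hdy : |dy| ≤ 2 ^ I * (h * τ)) :
    (((Finset.range Q).filter
      (fun j : ℕ => |dx + c * (1 + j / Q) * dy| ≤ R * τ)).card : ℝ) ≤
    ∑ i ∈ Finset.range (I + 1), if |dx| ≤ (R + 2 * h) * (2 ^ i * τ) ∧ |dy| ≤ 2 ^ i * (h * τ)
      then Q * (4 * R + 1) / 2 ^ i else 0 := by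
  have hQ0 : 0 < Q := lt_of_lt_of_le (by positivity) hQ
  have hQ' : (0 : ℝ) < Q := by exact_mod_cast hQ0
  set J := (Finset.range Q).filter (fun j : ℕ => |dx + c * (1 + j / Q) * dy| ≤ R * τ) with hJ
  have hterm : ∀ i : ℕ, 0 ≤ (if |dx| ≤ (R + 2 * h) * (2 ^ i * τ) ∧ |dy| ≤ 2 ^ i * (h * τ)
      then Q * (4 * R + 1) / 2 ^ i else 0 : ℝ) := by
    intro i
    split_ifs
    · positivity
    · exact le_rfl
  rcases J.eq_empty_or_nonempty with hemp | ⟨j, hj⟩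
  · rw [hemp]
    simp only [Finset.card_empty, Nat.cast_zero]
    exact Finset.sum_nonneg fun i _ => hterm i
  have hex : ∃ i : ℕ, |dy| ≤ 2 ^ i * (h * τ) := ⟨I, hdy⟩
  -- The least dyadic scale containing dy. For i > 0 minimality gives 2^i τ ≤ 2|dy|, while i = 0
  -- needs only the trivial count Q.
  set i := Nat.find hex with hi
  have hi1 : |dy| ≤ 2 ^ i * (h * τ) := Nat.find_spec hex
  have hiI : i ≤ I := Nat.find_min' hex hdy
  refine le_trans ?_ (Finset.single_le_sum (fun i _ => hterm i)
    (Finset.mem_range.mpr (Nat.lt_succ_of_le hiI)))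
  have h2i : (1 : ℝ) ≤ 2 ^ i := one_le_pow₀ one_le_two
  have hdx : |dx| ≤ (R + 2 * h) * (2 ^ i * τ) := by
    obtain ⟨hjQ, hj⟩ := Finset.mem_filter.mp hj
    have hjQ' : (j : ℝ) < Q := by exact_mod_cast Finset.mem_range.mp hjQ
    have h1 : |c * (1 + j / Q) * dy| ≤ 2 * |dy| := by
      have h3 : (j : ℝ) / Q ≤ 1 := (div_le_one hQ').mpr hjQ'.le
      have h4 : 0 ≤ (j : ℝ) / Q := by positivity
      rw [abs_mul, abs_mul, hc, one_mul, abs_of_nonneg (by linarith)]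
      gcongr
      linarith
    have h2 : |dx| ≤ R * τ + 2 * |dy| := by
      have : dx = (dx + c * (1 + j / Q) * dy) - c * (1 + j / Q) * dy := by ring
      rw [this]
      exact (abs_sub _ _).trans (by linarith)
    calc |dx| ≤ R * τ * 1 + 2 * (2 ^ i * (h * τ)) := by linarith
      _ ≤ R * τ * 2 ^ i + 2 * (2 ^ i * (h * τ)) := by gcongr
      _ = _ := by ring
  rw [if_pos ⟨hdx, hi1⟩]
  rcases Nat.eq_zero_or_pos i with h0 | hpos
  · rw [h0, pow_zero, div_one]
    have : (J.card : ℝ) ≤ Q := by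
      have := Finset.card_filter_le (Finset.range Q)
        (fun j : ℕ => |dx + c * (1 + j / Q) * dy| ≤ R * τ)
      rw [Finset.card_range] at this
      exact_mod_cast this
    nlinarith
  · have hlt : 2 ^ (i - 1) * (h * τ) < |dy| := by
      have := Nat.find_min hex (m := i - 1) (by omega)
      push Not at this
      exact this
    have h2 : (2 : ℝ) ^ i = 2 * 2 ^ (i - 1) := by
      rw [← pow_succ', Nat.sub_add_cancel hpos]
    have hτdy : 2 ^ i * τ ≤ 2 * |dy| := by
      have : (2 : ℝ) ^ (i - 1) * (1 * τ) ≤ 2 ^ (i - 1) * (h * τ) := by gcongr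
      rw [h2]
      linarith
    have hdy0 : 0 < |dy| := lt_of_le_of_lt (by positivity) hlt
    have h3 := card_close_directions_le hQ0 (dx := dx) hc (abs_pos.mp hdy0)
      (by positivity : 0 ≤ R * τ)
    refine h3.trans ?_
    have h4 : 2 * (R * τ) * Q / |dy| ≤ 4 * R * Q / 2 ^ i := by
      rw [div_le_div_iff₀ hdy0 (by positivity)]
      have : R * Q * (2 ^ i * τ) ≤ R * Q * (2 * |dy|) := by gcongr
      linarith
    have h5 : 1 ≤ (Q : ℝ) / 2 ^ i := by
      rw [le_div_iff₀ (by positivity), one_mul]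
      calc (2 : ℝ) ^ i ≤ 2 ^ I := pow_le_pow_right₀ one_le_two hiI
        _ ≤ Q := by exact_mod_cast hQ
    calc 1 + 2 * (R * τ) * Q / |dy| ≤ Q / 2 ^ i + 4 * R * Q / 2 ^ i := add_le_add h5 h4
      _ = Q * (4 * R + 1) / 2 ^ i := by ring

/-- A discrete projection theorem: the product of two weights that are Frostman regular at a point
projects well there for most directions. -/
theorem sum_mass_close_le {F G : Finset ℝ} {w v : ℝ → ℝ} (hw : ∀ x, 0 ≤ w x) (hv : ∀ x, 0 ≤ v x)
    {S T : Set ℝ} {x₀ y₀ a b Bx By θ σ h R c : ℝ} (ha : 0 ≤ a) (hb : 0 ≤ b) (hab : a + b ≤ 1)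
    (hBx : 0 ≤ Bx) (hBy : 0 ≤ By) (hθ : 0 < θ) (hσ : 0 < σ) (hh : 1 ≤ h) (hR : 1 ≤ R)
    (hc : |c| = 1) {I Q : ℕ} (hI : 1 ≤ 2 ^ I * θ) (hQ : 2 ^ I ≤ Q)
    (hx : ∀ u, θ * σ ≤ u →
      mass F w {x | x ∈ S ∧ x ∈ Metric.closedBall x₀ u} ≤ Bx * (u / σ) ^ a * mass F w S)
    (hy : ∀ u, h * (θ * σ) ≤ u →
      mass G v {y | y ∈ T ∧ y ∈ Metric.closedBall y₀ u} ≤ By * (u / σ) ^ b * mass G v T)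
    (hT : ∀ y ∈ T, |y - y₀| ≤ h * σ) :
    ∑ j ∈ Finset.range Q, mass (F ×ˢ G) (fun p => w p.1 * v p.2)
      {q | (q.1 ∈ S ∧ q.2 ∈ T) ∧ |(q.1 - x₀) + c * (1 + j / Q) * (q.2 - y₀)| ≤ R * (θ * σ)} ≤
    Q * ((4 * R + 1) * (R + 2 * h) * h * (Bx * By) * (I + 1) * θ ^ (a + b)) *
      (mass F w S * mass G v T) := by
  classical
  set τ := θ * σ with hτ
  have hτ0 : 0 < τ := by positivity
  set m : ℝ × ℝ → ℝ := fun p => w p.1 * v p.2 with hm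
  have hm0 : ∀ p, 0 ≤ m p := fun p => mul_nonneg (hw _) (hv _)
  set V : ℕ → Set (ℝ × ℝ) := fun i =>
    {q | q.1 ∈ {x | x ∈ S ∧ x ∈ Metric.closedBall x₀ ((R + 2 * h) * (2 ^ i * τ))} ∧
      q.2 ∈ {y | y ∈ T ∧ y ∈ Metric.closedBall y₀ (2 ^ i * (h * τ))}} with hV
  have hpt : ∀ q : ℝ × ℝ, ∑ j ∈ Finset.range Q,
      {q : ℝ × ℝ | (q.1 ∈ S ∧ q.2 ∈ T) ∧
        |(q.1 - x₀) + c * (1 + j / Q) * (q.2 - y₀)| ≤ R * τ}.indicator m q ≤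
      ∑ i ∈ Finset.range (I + 1), (Q * (4 * R + 1) / 2 ^ i) * (V i).indicator m q := by
    intro q
    by_cases hq : q.1 ∈ S ∧ q.2 ∈ T
    · have hdy : |q.2 - y₀| ≤ 2 ^ I * (h * τ) := by
        refine (hT _ hq.2).trans ?_
        have : h * σ * 1 ≤ h * σ * (2 ^ I * θ) := by gcongr
        rw [hτ]
        linarith
      have h1 := card_close_directions_le_sum hQ (dx := q.1 - x₀) hc hR hh hτ0 hdy
      calc _ = (((Finset.range Q).filter (fun j : ℕ =>
            |(q.1 - x₀) + c * (1 + j / Q) * (q.2 - y₀)| ≤ R * τ)).card : ℝ) * m q := by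
            rw [← nsmul_eq_mul, ← Finset.sum_const, Finset.sum_filter]
            refine Finset.sum_congr rfl fun j _ => ?_
            simp only [Set.indicator_apply, Set.mem_ofPred_eq, hq, true_and, and_self]
        _ ≤ _ := mul_le_mul_of_nonneg_right h1 (hm0 q)
        _ = _ := by
            rw [Finset.sum_mul]
            refine Finset.sum_congr rfl fun i _ => ?_
            simp only [Set.indicator_apply, hV, Set.mem_ofPred_eq, hq, true_and,
              Metric.mem_closedBall, Real.dist_eq]
            split_ifs <;> simp
    · refine le_of_eq_of_le (Finset.sum_eq_zero fun j _ => ?_) (Finset.sum_nonneg fun i _ => ?_)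
      · exact Set.indicator_of_notMem (fun h => hq h.1) _
      · exact mul_nonneg (by positivity) (Set.indicator_nonneg (fun p _ => hm0 p) _)
  have hS0 := mass_nonneg (F := F) hw S
  have hT0 := mass_nonneg (F := G) hv T
  have hVle : ∀ i ∈ Finset.range (I + 1), (Q * (4 * R + 1) / 2 ^ i) * mass (F ×ˢ G) m (V i) ≤
      Q * ((4 * R + 1) * (R + 2 * h) * h * (Bx * By) * θ ^ (a + b)) *
        (mass F w S * mass G v T) := by
    intro i _
    have h2i : (1 : ℝ) ≤ 2 ^ i := one_le_pow₀ one_le_two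
    rw [hV, mass_prod]
    have h1 := hx ((R + 2 * h) * (2 ^ i * τ)) (by
      have : 1 ≤ (R + 2 * h) * 2 ^ i := one_le_mul_of_one_le_of_one_le (by linarith) h2i
      nlinarith)
    have h2 := hy (2 ^ i * (h * τ)) (by
      have : 0 < h * τ := by positivity
      nlinarith)
    have e1 : ((R + 2 * h) * (2 ^ i * τ) / σ) ^ a ≤ (R + 2 * h) * (2 ^ i * θ) ^ a := by
      have : (R + 2 * h) * (2 ^ i * τ) / σ = (R + 2 * h) * (2 ^ i * θ) := by
        rw [hτ]; field_simp
      rw [this, Real.mul_rpow (by linarith) (by positivity)]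
      gcongr
      simpa using Real.rpow_le_rpow_of_exponent_le (by linarith : 1 ≤ R + 2 * h)
        (by linarith : a ≤ 1)
    have e2 : (2 ^ i * (h * τ) / σ) ^ b ≤ h * (2 ^ i * θ) ^ b := by
      have : 2 ^ i * (h * τ) / σ = h * (2 ^ i * θ) := by
        rw [hτ]; field_simp
      rw [this, Real.mul_rpow (by linarith) (by positivity)]
      gcongr
      simpa using Real.rpow_le_rpow_of_exponent_le hh (by linarith : b ≤ 1)
    -- Here a + b ≤ 1 matters: the factor 2^i is cancelled exactly by the proportion 2^(-i) of
    -- directions. All I + 1 scales then obey the same bound, which explains the factor I + 1.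
    have e3 : (2 ^ i * θ) ^ a * (2 ^ i * θ) ^ b ≤ 2 ^ i * θ ^ (a + b) := by
      rw [← Real.rpow_add (by positivity), Real.mul_rpow (by positivity) hθ.le]
      gcongr
      simpa using Real.rpow_le_rpow_of_exponent_le h2i hab
    calc _ ≤ (Q * (4 * R + 1) / 2 ^ i) *
          ((Bx * ((R + 2 * h) * (2 ^ i * τ) / σ) ^ a * mass F w S) *
            (By * (2 ^ i * (h * τ) / σ) ^ b * mass G v T)) := by
          refine mul_le_mul_of_nonneg_left ?_ (by positivity)
          exact mul_le_mul h1 h2 (mass_nonneg hv _) (by positivity)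
      _ ≤ (Q * (4 * R + 1) / 2 ^ i) *
          ((Bx * ((R + 2 * h) * (2 ^ i * θ) ^ a) * mass F w S) *
            (By * (h * (2 ^ i * θ) ^ b) * mass G v T)) := by gcongr
      _ = (Q * (4 * R + 1) / 2 ^ i) * (R + 2 * h) * h * (Bx * By) * (mass F w S * mass G v T) *
            ((2 ^ i * θ) ^ a * (2 ^ i * θ) ^ b) := by ring
      _ ≤ (Q * (4 * R + 1) / 2 ^ i) * (R + 2 * h) * h * (Bx * By) * (mass F w S * mass G v T) *
            (2 ^ i * θ ^ (a + b)) := by gcongr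
      _ = _ := by field_simp
  calc _ = ∑ q ∈ F ×ˢ G, ∑ j ∈ Finset.range Q,
      {q : ℝ × ℝ | (q.1 ∈ S ∧ q.2 ∈ T) ∧
        |(q.1 - x₀) + c * (1 + j / Q) * (q.2 - y₀)| ≤ R * τ}.indicator m q := Finset.sum_comm
    _ ≤ ∑ q ∈ F ×ˢ G, ∑ i ∈ Finset.range (I + 1),
      (Q * (4 * R + 1) / 2 ^ i) * (V i).indicator m q := Finset.sum_le_sum fun q _ => hpt q
    _ = ∑ i ∈ Finset.range (I + 1), (Q * (4 * R + 1) / 2 ^ i) * mass (F ×ˢ G) m (V i) := by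
      rw [Finset.sum_comm]
      refine Finset.sum_congr rfl fun i _ => ?_
      rw [mass, Finset.mul_sum]
    _ ≤ ∑ i ∈ Finset.range (I + 1),
        Q * ((4 * R + 1) * (R + 2 * h) * h * (Bx * By) * θ ^ (a + b)) *
          (mass F w S * mass G v T) := Finset.sum_le_sum hVle
    _ = _ := by
      rw [Finset.sum_const, Finset.card_range, nsmul_eq_mul]
      push_cast
      ring

/-! ### From averages to one direction and one node -/

section Abstract

variable {α β : Type*}

theorem mass_union_le {F : Finset α} {w : α → ℝ} (hw : ∀ x, 0 ≤ w x) {S T U : Set α}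
    (h : ∀ x ∈ F, x ∈ S → x ∈ T ∨ x ∈ U) : mass F w S ≤ mass F w T + mass F w U := by
  rw [mass, mass, mass, ← Finset.sum_add_distrib]
  refine Finset.sum_le_sum fun x hx => ?_
  have hT : 0 ≤ T.indicator w x := Set.indicator_nonneg (fun x _ => hw x) x
  have hU : 0 ≤ U.indicator w x := Set.indicator_nonneg (fun x _ => hw x) x
  by_cases hS : x ∈ S
  · rw [Set.indicator_of_mem hS]
    rcases h x hx hS with h | h
    · rw [Set.indicator_of_mem h]; linarith
    · rw [Set.indicator_of_mem h]; linarith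
  · rw [Set.indicator_of_notMem hS]; linarith

open Classical in
theorem sum_mass_eq (F : Finset α) (w : α → ℝ) (K : Finset ℕ) (b : ℕ → α → Prop) :
    ∑ k ∈ K, mass F w {p | b k p} = ∑ p ∈ F, (K.filter (fun k => b k p)).card * w p := by
  unfold mass
  rw [Finset.sum_comm]
  refine Finset.sum_congr rfl fun p _ => ?_
  rw [← nsmul_eq_mul, ← Finset.sum_const, Finset.sum_filter]
  refine Finset.sum_congr rfl fun k _ => ?_
  simp only [Set.indicator_apply, Set.mem_ofPred_eq]

/-- The Markov inequality used to pass from averages over directions to single directions. -/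
theorem sum_mass_not_le {F : Finset α} {w : α → ℝ} (hw : ∀ x, 0 ≤ w x)
    (hmass : mass F w Set.univ = 1) {Q : ℕ} {P E : ℝ} (hP : 0 ≤ P) (hE : 0 ≤ E)
    (Reg : α → Prop) (f : ℕ → α → ℝ) (N : α → ℝ) (hf : ∀ j p, 0 ≤ f j p)
    (hfN : ∀ j p, f j p ≤ N p)
    (hsum : ∀ p ∈ F, Reg p → ∑ j ∈ Finset.range Q, f j p ≤ Q * E * N p) :
    ∑ j ∈ Finset.range Q, mass F w {p | Reg p ∧ ¬ P * f j p ≤ N p} ≤ Q * (P * E) := by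
  classical
  unfold mass
  rw [Finset.sum_comm]
  have hpt : ∀ p ∈ F, ∑ j ∈ Finset.range Q, {p | Reg p ∧ ¬ P * f j p ≤ N p}.indicator w p ≤
      Q * (P * E) * w p := by
    intro p hp
    have hN : 0 ≤ N p := (hf 0 p).trans (hfN 0 p)
    by_cases hR : Reg p
    · have h1 : ∀ j ∈ Finset.range Q, {p | Reg p ∧ ¬ P * f j p ≤ N p}.indicator w p ≤
          w p * P / N p * f j p := by
        intro j _
        have hnn : 0 ≤ w p * P / N p * f j p :=
          mul_nonneg (div_nonneg (mul_nonneg (hw p) hP) hN) (hf j p)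
        by_cases hlt : P * f j p ≤ N p
        · rwa [Set.indicator_of_notMem fun h => h.2 hlt]
        · rw [Set.indicator_of_mem (show p ∈ {p | Reg p ∧ ¬ P * f j p ≤ N p} from ⟨hR, hlt⟩)]
          push Not at hlt
          have hf0 : 0 < f j p := by
            rcases (hf j p).eq_or_lt with h | h
            · rw [← h, mul_zero] at hlt; linarith
            · exact h
          have hN0 : 0 < N p := hf0.trans_le (hfN j p)
          rw [div_mul_eq_mul_div, le_div_iff₀ hN0, mul_assoc]
          exact mul_le_mul_of_nonneg_left hlt.le (hw p)
      refine (Finset.sum_le_sum h1).trans ?_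
      rw [← Finset.mul_sum]
      have h2 : 0 ≤ w p * P / N p := div_nonneg (mul_nonneg (hw p) hP) hN
      refine (mul_le_mul_of_nonneg_left (hsum p hp hR) h2).trans ?_
      rcases hN.eq_or_lt with h | h
      · rw [← h]
        simp only [div_zero, zero_mul]
        exact mul_nonneg (by positivity) (hw p)
      · refine le_of_eq ?_
        field_simp
    · refine le_of_eq_of_le (Finset.sum_eq_zero fun j _ =>
        Set.indicator_of_notMem (fun h => hR h.1) _) (mul_nonneg (by positivity) (hw p))
  refine (Finset.sum_le_sum hpt).trans ?_
  rw [← Finset.mul_sum]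
  have : ∑ p ∈ F, w p = 1 := by
    rw [← hmass, mass]
    exact Finset.sum_congr rfl fun p _ => by simp
  rw [this, mul_one]

open Classical in
/-- If bad levels are rare on average, then there is a node from which most branches have few bad
levels in every initial segment. -/
theorem exists_good_start (node : ℕ → α → β) {F : Finset α} {w : α → ℝ} (hw : ∀ x, 0 ≤ w x)
    (hmass : mass F w Set.univ = 1) (bad : ℕ → α → Prop) {δ : ℝ} (hδ : 0 < δ) {D : ℕ} (hD : 0 < D)
    (hbad : ∑ k ∈ Finset.range (4 * D), mass F w {p | bad k p} ≤ δ * D / 2) :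
    ∃ l, D ≤ l ∧ l < 2 * D ∧ ∃ p₀ ∈ F, 0 < mass F w {q | node l q = node l p₀} ∧
      mass F w {q | node l q = node l p₀} / 2 ≤ mass F w {q | node l q = node l p₀ ∧
        ∀ k, l + k ≤ 4 * D →
          (((Finset.Ico l (l + k)).filter (fun i => bad i q)).card : ℝ) ≤ δ * k} := by
  set bs : ℕ → α → Prop := fun l p => ∃ q, l + q ≤ 4 * D ∧
      δ * q < ((Finset.Ico l (l + q)).filter (fun i => bad i p)).card with hbs
  have hD' : (0 : ℝ) < D := by exact_mod_cast hD
  have h1 : ∑ l ∈ Finset.range (4 * D), mass F w {p | bs l p} ≤ D / 2 := by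
    have h2 : δ * ∑ l ∈ Finset.range (4 * D), mass F w {p | bs l p} ≤
        ∑ k ∈ Finset.range (4 * D), mass F w {p | bad k p} := by
      rw [sum_mass_eq, sum_mass_eq, Finset.mul_sum]
      refine Finset.sum_le_sum fun p _ => ?_
      rw [← mul_assoc]
      exact mul_le_mul_of_nonneg_right (card_bad_starts_le (fun k => bad k p) hδ.le (4 * D)) (hw p)
    have h3 := h2.trans hbad
    rw [mul_div_assoc] at h3
    exact le_of_mul_le_mul_left h3 hδ
  -- Averaging over D ≤ l < 2D leaves at least D levels above l, room to undo a few digits later,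
  -- and more than 2D levels below it.
  obtain ⟨l, hl, hlm⟩ : ∃ l ∈ Finset.Ico D (2 * D), mass F w {p | bs l p} ≤ 1 / 2 := by
    refine Finset.exists_le_of_sum_le (Finset.nonempty_Ico.mpr (by omega)) ?_
    rw [Finset.sum_const, Nat.card_Ico, nsmul_eq_mul, show 2 * D - D = D by omega]
    refine le_trans (Finset.sum_le_sum_of_subset_of_nonneg (t := Finset.range (4 * D)) ?_
      fun i _ _ => mass_nonneg hw _) (h1.trans (le_of_eq (by ring)))
    intro i hi
    rw [Finset.mem_Ico] at hi
    exact Finset.mem_range.mpr (by omega)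
  rw [Finset.mem_Ico] at hl
  refine ⟨l, hl.1, hl.2, ?_⟩
  set g : Set α := {q | ∀ k, l + k ≤ 4 * D →
          (((Finset.Ico l (l + k)).filter (fun i => bad i q)).card : ℝ) ≤ δ * k} with hg
  have hgmass : 1 / 2 ≤ mass F w g := by
    have h2 : mass F w Set.univ ≤ mass F w g + mass F w {p | bs l p} := by
      refine mass_union_le hw fun p _ _ => ?_
      by_cases hp : bs l p
      · exact Or.inr hp
      · left
        intro k hk
        by_contra hcon
        push Not at hcon
        exact hp ⟨k, hk, hcon⟩
    linarith
  have hfib : ∀ S : Set α, mass F w S =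
      ∑ c ∈ F.image (node l), mass F w {q | node l q = c ∧ q ∈ S} := by
    intro S
    unfold mass
    rw [Finset.sum_comm]
    refine Finset.sum_congr rfl fun q hq => ?_
    rw [Finset.sum_eq_single_of_mem (node l q) (Finset.mem_image_of_mem _ hq)]
    · by_cases h : q ∈ S <;> simp [h]
    · intro c _ hc
      exact Set.indicator_of_notMem (fun h => hc h.1.symm) _
  by_contra hcon
  push Not at hcon
  have hpos : ∃ c ∈ F.image (node l), 0 < mass F w {q | node l q = c ∧ q ∈ Set.univ} := by
    by_contra h
    push Not at h
    have h2 := Finset.sum_nonpos h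
    rw [← hfib, hmass] at h2
    linarith
  have hlt : ∑ c ∈ F.image (node l), mass F w {q | node l q = c ∧ q ∈ g} <
      ∑ c ∈ F.image (node l), mass F w {q | node l q = c ∧ q ∈ Set.univ} / 2 := by
    have huniv : ∀ c, mass F w {q | node l q = c ∧ q ∈ Set.univ} = mass F w {q | node l q = c} :=
      fun c => mass_congr fun q _ => by simp
    refine Finset.sum_lt_sum (fun c hc => ?_) ?_
    · obtain ⟨p₀, hp₀, rfl⟩ := Finset.mem_image.mp hc
      rw [huniv]
      rcases (mass_nonneg hw {q | node l q = node l p₀} : 0 ≤ mass F w _).eq_or_lt with h | h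
      · rw [← h, zero_div, h]
        exact mass_mono hw fun q _ hq => hq.1
      · exact (hcon p₀ hp₀ h).le
    · obtain ⟨c, hc, hc0⟩ := hpos
      refine ⟨c, hc, ?_⟩
      obtain ⟨p₀, hp₀, rfl⟩ := Finset.mem_image.mp hc
      rw [huniv] at hc0 ⊢
      exact hcon p₀ hp₀ hc0
  rw [← hfib, ← Finset.sum_div, ← hfib, hmass] at hlt
  linarith

end Abstract

/-! ### Projections of the product tree -/

/-- The node of level `k` of a pair, in the product of the `r`-adic tree and the `s`-adic tree, with
the given sequences of levels. -/
noncomputable def pairNode (r s : ℕ) (ℓ ℓ' : ℕ → ℕ) (k : ℕ) (p : ℝ × ℝ) : ℤ × ℤ :=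
  (code r (ℓ k) p.1, code s (ℓ' k) p.2)

theorem pairNode_eq_iff {r s : ℕ} {ℓ ℓ' : ℕ → ℕ} {k : ℕ} {p q : ℝ × ℝ} :
    pairNode r s ℓ ℓ' k q = pairNode r s ℓ ℓ' k p ↔
      code r (ℓ k) q.1 = code r (ℓ k) p.1 ∧ code s (ℓ' k) q.2 = code s (ℓ' k) p.2 := by
  unfold pairNode
  rw [Prod.mk.injEq]

/-- At most the proportion `1 / P` of the node of `p` at level `k` has a projection in direction
`t` that is within `R ρ^(k+1)` of that of `p`. -/
def Spread (r s : ℕ) (ℓ ℓ' : ℕ → ℕ) (Ω : Finset (ℝ × ℝ)) (m : ℝ × ℝ → ℝ) (P R ρ t : ℝ) (k : ℕ)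
    (p : ℝ × ℝ) : Prop :=
  P * mass Ω m {q | pairNode r s ℓ ℓ' k q = pairNode r s ℓ ℓ' k p ∧
    |(q.1 - p.1) + t * (q.2 - p.2)| ≤ R * (ρ * ρ ^ k)} ≤
    mass Ω m {q | pairNode r s ℓ ℓ' k q = pairNode r s ℓ ℓ' k p}

-- Average over the directions 1 + j/Q. Levels irregular in one of the coordinates cost at most 2N₀
-- in total, whatever the direction. At a regular level the projection theorem and Markov's
-- inequality bound the non-spread mass by P times the projection error, on average over j. Some j
-- does no worse than the average of the sum over k.
open Classical in
theorem exists_direction {r s : ℕ} (hs : 2 ≤ s) {ℓ ℓ' : ℕ → ℕ} {ρ : ℝ} (hρ : 0 < ρ)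
    (hℓ : ∀ k, ((r : ℝ) ^ ℓ k)⁻¹ = ρ ^ k)
    (hℓ' : ∀ k, ρ ^ k ≤ ((s : ℝ) ^ ℓ' k)⁻¹ ∧ ((s : ℝ) ^ ℓ' k)⁻¹ ≤ s * ρ ^ k)
    {F G : Finset ℝ} {w v : ℝ → ℝ} (hw : ∀ x, 0 ≤ w x) (hv : ∀ x, 0 ≤ v x)
    (hFw : mass F w Set.univ = 1) (hGv : mass G v Set.univ = 1)
    {a b Bx By P R c N₀ : ℝ} (ha : 0 ≤ a) (hb : 0 ≤ b) (hab : a + b ≤ 1) (hBx : 0 ≤ Bx)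
    (hBy : 0 ≤ By) (hP : 0 ≤ P) (hR : 1 ≤ R) (hc : |c| = 1) {I : ℕ} (hI : 1 ≤ 2 ^ I * ρ) (K : ℕ)
    (hx : ∀ x ∈ F, (((Finset.range K).filter
      (fun k => ¬ Regular r ℓ a Bx F w k x)).card : ℝ) ≤ N₀)
    (hy : ∀ y ∈ G, (((Finset.range K).filter
      (fun k => ¬ Regular s ℓ' b By G v k y)).card : ℝ) ≤ N₀) :
    ∃ t ∈ Set.Icc (1 : ℝ) 2, ∑ k ∈ Finset.range K, mass (F ×ˢ G) (fun p => w p.1 * v p.2)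
      {p | ¬ Spread r s ℓ ℓ' (F ×ˢ G) (fun p => w p.1 * v p.2) P R ρ (c * t) k p} ≤
      2 * N₀ + K * (P * ((4 * R + 1) * (R + 2 * s) * s * (Bx * By) * (I + 1) * ρ ^ (a + b))) := by
  have hs1 : (1 : ℝ) ≤ s := by exact_mod_cast (by omega : 1 ≤ s)
  set Ω := F ×ˢ G with hΩ
  set m : ℝ × ℝ → ℝ := fun p => w p.1 * v p.2 with hm
  have hm0 : ∀ p, 0 ≤ m p := fun p => mul_nonneg (hw _) (hv _)
  have hmass : mass Ω m Set.univ = 1 := by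
    have := mass_prod F G w v Set.univ Set.univ
    rw [hFw, hGv, mul_one] at this
    rw [← this]
    exact mass_congr fun p _ => by simp
  set E := (4 * R + 1) * (R + 2 * s) * s * (Bx * By) * (I + 1) * ρ ^ (a + b) with hE
  have hE0 : 0 ≤ E := by positivity
  set Q : ℕ := 2 ^ I with hQ
  have hQ0 : 0 < Q := by positivity
  have hQ0' : (0 : ℝ) < Q := by exact_mod_cast hQ0
  set Reg : ℕ → ℝ × ℝ → Prop := fun k p =>
    Regular r ℓ a Bx F w k p.1 ∧ Regular s ℓ' b By G v k p.2 with hReg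
  have hnode : ∀ k, ∑ j ∈ Finset.range Q, mass Ω m {p | Reg k p ∧
      ¬ Spread r s ℓ ℓ' Ω m P R ρ (c * (1 + j / Q)) k p} ≤ Q * (P * E) := by
    intro k
    refine sum_mass_not_le hm0 hmass hP hE0 (Reg k)
      (fun j p => mass Ω m {q | pairNode r s ℓ ℓ' k q = pairNode r s ℓ ℓ' k p ∧
        |(q.1 - p.1) + c * (1 + j / Q) * (q.2 - p.2)| ≤ R * (ρ * ρ ^ k)})
      (fun p => mass Ω m {q | pairNode r s ℓ ℓ' k q = pairNode r s ℓ ℓ' k p})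
      (fun j p => mass_nonneg hm0 _) (fun j p => mass_mono hm0 fun q _ hq => hq.1) ?_
    intro p hp hpReg
    have hσ : 0 < ρ ^ k := by positivity
    have hmain := sum_mass_close_le (F := F) (G := G) hw hv
      (S := {x | code r (ℓ k) x = code r (ℓ k) p.1})
      (T := {y | code s (ℓ' k) y = code s (ℓ' k) p.2}) (x₀ := p.1) (y₀ := p.2) ha hb hab hBx hBy
      hρ hσ hs1 hR hc hI le_rfl
      (fun u hu => ?_) (fun u hu => ?_) (fun y hy => ?_)
    · convert hmain using 1
      · refine Finset.sum_congr rfl fun j _ => mass_congr fun q _ => ?_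
        simp only [Set.mem_ofPred_eq, pairNode_eq_iff, hQ]
      · rw [← mass_prod]
        congr 1
        refine mass_congr fun q _ => ?_
        simp only [Set.mem_ofPred_eq, pairNode_eq_iff]
    · have h1 := hpReg.1 p.1 u (by rw [hℓ, pow_succ']; exact hu)
      have h2 : u * (r : ℝ) ^ ℓ k = u / ρ ^ k := by rw [← hℓ, div_inv_eq_mul]
      rw [h2] at h1
      exact h1
    · have h1 := hpReg.2 p.2 u ((hℓ' (k + 1)).2.trans (by rw [pow_succ']; exact hu))
      refine h1.trans (mul_le_mul_of_nonneg_right ?_ (mass_nonneg hv _))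
      have hu0 : 0 ≤ u := le_trans (by positivity) hu
      have h2 : u * (s : ℝ) ^ ℓ' k ≤ u / ρ ^ k := by
        rw [div_eq_mul_inv]
        refine mul_le_mul_of_nonneg_left ?_ hu0
        rw [le_inv_comm₀ (by positivity) hσ]
        exact (hℓ' k).1
      exact mul_le_mul_of_nonneg_left (Real.rpow_le_rpow (by positivity) h2 hb) hBy
    · exact (abs_sub_le_of_code_eq hs hy).trans (hℓ' k).2
  have hirr : ∑ k ∈ Finset.range K, mass Ω m {p | ¬ Reg k p} ≤ 2 * N₀ := by
    rw [sum_mass_eq]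
    have h1 : ∀ p ∈ Ω, (((Finset.range K).filter (fun k => ¬ Reg k p)).card : ℝ) * m p ≤
        2 * N₀ * m p := by
      intro p hp
      refine mul_le_mul_of_nonneg_right ?_ (hm0 p)
      rw [hΩ, Finset.mem_product] at hp
      have hsub : (Finset.range K).filter (fun k => ¬ Reg k p) ⊆
          (Finset.range K).filter (fun k => ¬ Regular r ℓ a Bx F w k p.1) ∪
          (Finset.range K).filter (fun k => ¬ Regular s ℓ' b By G v k p.2) := by
        intro k hk
        rw [Finset.mem_filter, not_and_or] at hk
        rw [Finset.mem_union, Finset.mem_filter, Finset.mem_filter]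
        tauto
      have h2 := (Finset.card_le_card hsub).trans (Finset.card_union_le _ _)
      have h3 : (((Finset.range K).filter (fun k => ¬ Reg k p)).card : ℝ) ≤
          ((Finset.range K).filter (fun k => ¬ Regular r ℓ a Bx F w k p.1)).card +
          ((Finset.range K).filter (fun k => ¬ Regular s ℓ' b By G v k p.2)).card := by
        exact_mod_cast h2
      linarith [hx p.1 hp.1, hy p.2 hp.2]
    refine le_trans (le_of_eq (Finset.sum_congr rfl fun p _ => by congr))
      ((Finset.sum_le_sum h1).trans ?_)
    rw [← Finset.mul_sum]
    have : ∑ p ∈ Ω, m p = 1 := by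
      rw [← hmass, mass]
      exact Finset.sum_congr rfl fun p _ => by simp
    rw [this, mul_one]
  obtain ⟨j, hj, hjle⟩ : ∃ j ∈ Finset.range Q, ∑ k ∈ Finset.range K, mass Ω m
      {p | ¬ Spread r s ℓ ℓ' Ω m P R ρ (c * (1 + j / Q)) k p} ≤ 2 * N₀ + K * (P * E) := by
    refine Finset.exists_le_of_sum_le (Finset.nonempty_range_iff.mpr hQ0.ne') ?_
    have h1 : ∀ j ∈ Finset.range Q, ∑ k ∈ Finset.range K, mass Ω m
        {p | ¬ Spread r s ℓ ℓ' Ω m P R ρ (c * (1 + j / Q)) k p} ≤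
        2 * N₀ + ∑ k ∈ Finset.range K, mass Ω m {p | Reg k p ∧
          ¬ Spread r s ℓ ℓ' Ω m P R ρ (c * (1 + j / Q)) k p} := by
      intro j _
      refine le_trans ?_ (add_le_add_left hirr _)
      rw [← Finset.sum_add_distrib]
      refine Finset.sum_le_sum fun k _ => mass_union_le hm0 fun p _ hp => ?_
      by_cases h : Reg k p
      · exact Or.inr ⟨h, hp⟩
      · exact Or.inl h
    refine (Finset.sum_le_sum h1).trans ?_
    rw [Finset.sum_add_distrib, Finset.sum_comm, Finset.sum_const, Finset.card_range,
      nsmul_eq_mul, Finset.sum_const, Finset.card_range, nsmul_eq_mul]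
    have h2 := Finset.sum_le_sum fun k (_ : k ∈ Finset.range K) => hnode k
    rw [Finset.sum_const, Finset.card_range, nsmul_eq_mul] at h2
    linarith
  refine ⟨1 + j / Q, ⟨?_, ?_⟩, hjle⟩
  · have : 0 ≤ (j : ℝ) / Q := by positivity
    linarith
  · have : (j : ℝ) / Q ≤ 1 := by
      rw [div_le_one hQ0']
      exact_mod_cast (Finset.mem_range.mp hj).le
    linarith

open Classical in
/-- The part of a node that has few non-spread levels along every initial segment projects to a
Frostman measure, for all directions close to the given one. -/
theorem mass_projection_le {r s : ℕ} (hr : 2 ≤ r) (hs : 2 ≤ s) {ℓ ℓ' : ℕ → ℕ} (hℓm : Monotone ℓ)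
    (hℓm' : Monotone ℓ') {ρ : ℝ} (hρ : 0 < ρ) (hρ1 : ρ ≤ 1)
    (hℓ : ∀ k, ((r : ℝ) ^ ℓ k)⁻¹ = ρ ^ k)
    (hℓ' : ∀ k, ((s : ℝ) ^ ℓ' k)⁻¹ ≤ s * ρ ^ k)
    {Ω : Finset (ℝ × ℝ)} {m : ℝ × ℝ → ℝ} (hm : ∀ p, 0 ≤ m p) {P c t κ δ : ℝ} (hP : 1 ≤ P)
    (hc : |c| = 1) (ht : t ∈ Set.Icc (1 : ℝ) 2) (hκ : |κ - 1| ≤ ρ / (2 * s)) (p₀ : ℝ × ℝ)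
    (l k : ℕ) (z u : ℝ) (hu : u ≤ ρ ^ (l + k)) (U : Set (ℝ × ℝ))
    (hU : ∀ q ∈ U, pairNode r s ℓ ℓ' l q = pairNode r s ℓ ℓ' l p₀ ∧
      (((Finset.Ico l (l + k)).filter (fun i => ¬ Spread r s ℓ ℓ' Ω m P (4 * s + 4) ρ (c * t) i q)
        ).card : ℝ) ≤ δ * k) :
    mass Ω m {q | q ∈ U ∧ |q.1 + c * t * κ * q.2 - z| ≤ u} * P ^ ((1 - δ) * k) ≤
      mass Ω m {q | pairNode r s ℓ ℓ' l q = pairNode r s ℓ ℓ' l p₀} := by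
  have hs1 : (1 : ℝ) ≤ s := by exact_mod_cast (by omega : 1 ≤ s)
  have hP0 : 0 < P := by linarith
  set node := pairNode r s ℓ ℓ' with hnode
  have href : ∀ k x y, node (k + 1) x = node (k + 1) y → node k x = node k y := by
    intro k x y h
    rw [hnode, pairNode_eq_iff] at h ⊢
    exact ⟨code_eq_of_le hr (hℓm (Nat.le_succ k)) h.1, code_eq_of_le hs (hℓm' (Nat.le_succ k)) h.2⟩
  set S : Set (ℝ × ℝ) := {q | |q.1 + c * t * κ * q.2 - z| ≤ u} with hS
  set Good : ℕ → ℝ × ℝ → Prop := fun i q => Spread r s ℓ ℓ' Ω m P (4 * s + 4) ρ (c * t) i q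
  have hκ2 : |κ| ≤ 2 := by
    have h1 : ρ / (2 * s) ≤ 1 := by
      rw [div_le_one (by positivity)]; linarith
    have h2 : |κ| ≤ |κ - 1| + |(1 : ℝ)| := by
      have := abs_add_le (κ - 1) 1
      rwa [sub_add_cancel] at this
    rw [abs_one] at h2
    linarith
  have habs : |t| ≤ 2 := by rw [abs_of_nonneg (by linarith [ht.1])]; exact ht.2
  have hdiam : ∀ j p q, node j p = node j q → |p.1 - q.1| ≤ ρ ^ j ∧ |p.2 - q.2| ≤ s * ρ ^ j := by
    intro j p q h
    rw [hnode, pairNode_eq_iff] at h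
    exact ⟨(abs_sub_le_of_code_eq hr h.1).trans (hℓ j).le,
      (abs_sub_le_of_code_eq hs h.2).trans (hℓ' j)⟩
  have hmain := sum_pow_good_le (F := Ω) node href hm hP Good S l (l + k) ?_ k l le_rfl rfl (node l p₀)
  · refine le_trans ?_ hmain
    rw [mass, Finset.sum_mul, Finset.sum_filter]
    refine Finset.sum_le_sum fun q _ => ?_
    by_cases hq : q ∈ {q | q ∈ U ∧ |q.1 + c * t * κ * q.2 - z| ≤ u}
    · have hqU := hU q hq.1
      rw [Set.indicator_of_mem hq, if_pos ⟨hqU.1, hq.2⟩]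
      refine mul_le_mul_of_nonneg_left ?_ (hm q)
      rw [← Real.rpow_natCast]
      refine Real.rpow_le_rpow_of_exponent_le hP ?_
      have h2 := Finset.card_filter_add_card_filter_not (s := Finset.Ico l (l + k))
        (fun i => Good i q)
      rw [Nat.card_Ico, Nat.add_sub_cancel_left] at h2
      have h3 : (((Finset.Ico l (l + k)).filter (fun i => Good i q)).card : ℝ) +
        ((Finset.Ico l (l + k)).filter (fun i => ¬ Good i q)).card = k := by exact_mod_cast h2
      have h4 := hqU.2
      linarith
    · rw [Set.indicator_of_notMem hq, zero_mul]
      split_ifs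
      · have := hm q
        positivity
      · exact le_rfl
  · intro j hlj hjk p hp hpS hgood
    refine le_trans ?_ hgood
    refine mul_le_mul_of_nonneg_left (mass_mono hm ?_) hP0.le
    rintro q - ⟨hqp, q', hq', hq'S, hqq'⟩
    refine ⟨hqp, ?_⟩
    have d1 := hdiam j q p hqp
    have d2 := hdiam (j + 1) q q' hqq'.symm
    have hu' : u ≤ ρ ^ (j + 1) := hu.trans (pow_le_pow_of_le_one hρ.le hρ1 (by omega))
    rw [← pow_succ']
    -- The five terms contribute 1, 4s, 1, 1 and 1 times ρ^(j+1), whence the width 4s + 4. The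
    -- tolerance ρ/(2s) on κ makes the last term no larger than the next scale.
    have hident : (q.1 - p.1) + c * t * (q.2 - p.2) =
        (q.1 - q'.1) + c * t * κ * (q.2 - q'.2) + (q'.1 + c * t * κ * q'.2 - z) -
          (p.1 + c * t * κ * p.2 - z) - c * t * (κ - 1) * (q.2 - p.2) := by ring
    have b1 : |c * t * κ * (q.2 - q'.2)| ≤ 4 * (s * ρ ^ (j + 1)) := by
      rw [abs_mul, abs_mul, abs_mul, hc, one_mul]
      have := d2.2
      calc |t| * |κ| * |q.2 - q'.2| ≤ 2 * 2 * (s * ρ ^ (j + 1)) := by gcongr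
        _ = _ := by ring
    have b2 : |c * t * (κ - 1) * (q.2 - p.2)| ≤ ρ ^ (j + 1) := by
      rw [abs_mul, abs_mul, abs_mul, hc, one_mul]
      have := d1.2
      calc |t| * |κ - 1| * |q.2 - p.2| ≤ 2 * (ρ / (2 * s)) * (s * ρ ^ j) := by gcongr
        _ = ρ ^ (j + 1) := by rw [pow_succ]; field_simp
    have b3 : |q'.1 + c * t * κ * q'.2 - z| ≤ u := hq'S
    have b4 : |p.1 + c * t * κ * p.2 - z| ≤ u := hpS
    rw [hident]
    calc _ ≤ |(q.1 - q'.1) + c * t * κ * (q.2 - q'.2) + (q'.1 + c * t * κ * q'.2 - z) -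
          (p.1 + c * t * κ * p.2 - z)| + |c * t * (κ - 1) * (q.2 - p.2)| := abs_sub _ _
      _ ≤ |(q.1 - q'.1) + c * t * κ * (q.2 - q'.2) + (q'.1 + c * t * κ * q'.2 - z)| +
          |p.1 + c * t * κ * p.2 - z| + |c * t * (κ - 1) * (q.2 - p.2)| := by
          gcongr; exact abs_sub _ _
      _ ≤ |q.1 - q'.1| + |c * t * κ * (q.2 - q'.2)| + |q'.1 + c * t * κ * q'.2 - z| +
          |p.1 + c * t * κ * p.2 - z| + |c * t * (κ - 1) * (q.2 - p.2)| := by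
          gcongr; exact abs_add_three _ _ _
      _ ≤ (4 * s + 4) * ρ ^ (j + 1) := by linarith [d2.1]

/-! ### Matching scales and the Frostman pairs -/

/-- Powers of s cannot match powers of r exactly; rounding down makes consecutive s-levels differ by
L or L + 1. This is why the regular weights are built for both block lengths. -/
theorem log_mul_bounds {s m n : ℕ} (hs : 2 ≤ s) (hm : m ≠ 0) (hn : n ≠ 0) :
    Nat.log s m + Nat.log s n ≤ Nat.log s (m * n) ∧
      Nat.log s (m * n) ≤ Nat.log s m + Nat.log s n + 1 := by
  constructor
  · refine Nat.le_log_of_pow_le (by omega) ?_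
    rw [pow_add]
    exact Nat.mul_le_mul (Nat.pow_log_le_self s hm) (Nat.pow_log_le_self s hn)
  · refine Nat.lt_succ_iff.mp (Nat.log_lt_of_lt_pow (mul_ne_zero hm hn) ?_)
    calc m * n < s ^ (Nat.log s m).succ * s ^ (Nat.log s n).succ :=
          Nat.mul_lt_mul'' (Nat.lt_pow_succ_log_self (by omega) m)
            (Nat.lt_pow_succ_log_self (by omega) n)
      _ = s ^ (Nat.log s m + Nat.log s n + 1).succ := by
          rw [← pow_add]; congr 1; omega

theorem le_log_pow {r s n L : ℕ} (hr : 2 ≤ r) (hs : 2 ≤ s) (hn : s * L ≤ n) :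
    L ≤ Nat.log s (r ^ n) := by
  refine Nat.le_log_of_pow_le (by omega) ?_
  calc s ^ L ≤ (2 ^ s) ^ L := Nat.pow_le_pow_left Nat.lt_two_pow_self.le L
    _ = 2 ^ (s * L) := (pow_mul _ _ _).symm
    _ ≤ 2 ^ n := Nat.pow_le_pow_right (by omega) hn
    _ ≤ r ^ n := Nat.pow_le_pow_left hr n

/-- The number of dyadic scales is linear in the block length n and loses against the exponential
gain r^(-ηn). -/
theorem exists_block_length {r : ℕ} (hr : 2 ≤ r) (C : ℝ) {η τ : ℝ} (hη : 0 < η) (hτ : 0 < τ) :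
    ∃ n₀ : ℕ, ∀ n ≥ n₀, C * (((n * r : ℕ) : ℝ) + 1) * (r : ℝ) ^ (-η * n) ≤ τ := by
  have hr1 : (1 : ℝ) < r := by exact_mod_cast hr
  have hr0 : (0 : ℝ) < r := by linarith
  set q := (r : ℝ) ^ (-η) with hq
  have hq0 : 0 < q := by positivity
  have hq1 : q < 1 := Real.rpow_lt_one_of_one_lt_of_neg hr1 (by linarith)
  have h1 := tendsto_pow_const_mul_const_pow_of_abs_lt_one 1
    (by rwa [abs_of_pos hq0] : |q| < 1)
  have h2 := tendsto_pow_atTop_nhds_zero_of_lt_one hq0.le hq1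
  have h3 : Filter.Tendsto (fun n : ℕ => C * (r * ((n : ℝ) ^ 1 * q ^ n) + q ^ n)) Filter.atTop
      (nhds (C * (r * 0 + 0))) := ((h1.const_mul (r : ℝ)).add h2).const_mul C
  rw [mul_zero, add_zero, mul_zero] at h3
  obtain ⟨n₀, hn₀⟩ := Filter.eventually_atTop.mp (h3.eventually_le_const hτ)
  refine ⟨n₀, fun n hn => le_of_eq_of_le ?_ (hn₀ n hn)⟩
  rw [Real.rpow_mul hr0.le, Real.rpow_natCast, ← hq]
  push_cast
  ring

set_option maxHeartbeats 1000000 in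
/-- Pairs of points of `X × Y` that lie in a common cell and carry a measure whose projections are
Frostman with exponent `γ`, for all directions in a small interval. -/
theorem exists_frostman_pairs {r s : ℕ} (hr : 2 ≤ r) (hs : 2 ≤ s) {X Y : Set ℝ}
    (hX : IsShiftInvariant r X) (hY : IsShiftInvariant s Y) (hXne : X.Nonempty) (hYne : Y.Nonempty)
    {A B : ℝ} (hA0 : 0 ≤ A) (hA1 : A ≤ 1) (hB0 : 0 ≤ B) (hB1 : B ≤ 1)
    (hXlow : ∀ n : ℕ, (r : ℝ) ^ (A * n) ≤ numCodes r X n)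
    (hXup : ∀ ε > 0, ∃ C : ℝ, 1 ≤ C ∧
      ∀ n : ℕ, (numCodes r X n : ℝ) ≤ C * (r : ℝ) ^ ((A + ε) * n))
    (hYlow : ∀ n : ℕ, (s : ℝ) ^ (B * n) ≤ numCodes s Y n)
    (hYup : ∀ ε > 0, ∃ C : ℝ, 1 ≤ C ∧
      ∀ n : ℕ, (numCodes s Y n : ℝ) ≤ C * (s : ℝ) ^ ((B + ε) * n))
    {a b γ : ℝ} (ha0 : 0 ≤ a) (haA : a ≤ A) (hb0 : 0 ≤ b) (hbB : b ≤ B) (hab : a + b ≤ 1)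
    (hγ0 : 0 ≤ γ) (hγ : γ < a + b) :
    ∃ n₀ : ℕ, 0 < n₀ ∧ ∃ D₀ : ℕ, ∀ D ≥ D₀, ∀ c : ℝ, |c| = 1 →
      ∃ t ∈ Set.Icc (1 : ℝ) 2, ∃ l ≥ D, D ≤ Nat.log s (r ^ (n₀ * l)) ∧
      ∃ (Ω : Finset (ℝ × ℝ)) (m : ℝ × ℝ → ℝ) (U : Set (ℝ × ℝ)) (p₀ : ℝ × ℝ),
        (∀ p, 0 ≤ m p) ∧ (∀ p ∈ Ω, p.1 ∈ X ∧ p.2 ∈ Y) ∧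
        (∀ p ∈ U, code r (n₀ * l) p.1 = code r (n₀ * l) p₀.1 ∧
          code s (Nat.log s (r ^ (n₀ * l))) p.2 = code s (Nat.log s (r ^ (n₀ * l))) p₀.2) ∧
        0 < mass Ω m U ∧
        ∀ κ : ℝ, |κ - 1| ≤ ((r : ℝ) ^ n₀)⁻¹ / (2 * s) → ∀ k ≤ 2 * D, ∀ z u : ℝ,
          u ≤ (((r : ℝ) ^ n₀)⁻¹) ^ (l + k) →
          mass Ω m {q | q ∈ U ∧ |q.1 + c * t * κ * q.2 - z| ≤ u} ≤
            2 * ((((r : ℝ) ^ n₀)⁻¹) ^ k) ^ γ * mass Ω m U := by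
  classical
  have hr1 : (1 : ℝ) < r := by exact_mod_cast hr
  have hr0 : (0 : ℝ) < r := by linarith
  have hs1 : (1 : ℝ) < s := by exact_mod_cast hs
  have hs0 : (0 : ℝ) < s := by linarith
  -- γ₂ is the gain aimed at in each spread level. In Pρ^(a+b) = ρ^(8e), half of the gain pays for
  -- the losses r^(2en₀) of the two weights. The proportion δ of bad levels is such that P^((1-δ)k)
  -- = ρ^(-γk).
  set γ₂ := (γ + (a + b)) / 2 with hγ₂
  have hγγ₂ : γ < γ₂ := by rw [hγ₂]; linarith
  have hγ₂0 : 0 < γ₂ := by linarith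
  set e := (a + b - γ₂) / 8 with he
  have he0 : 0 < e := by rw [he, hγ₂]; linarith
  set δ := 1 - γ / γ₂ with hδ
  have hδ0 : 0 < δ := by
    rw [hδ, sub_pos, div_lt_one hγ₂0]; exact hγγ₂
  have hδ1 : δ ≤ 1 := by
    have : 0 ≤ γ / γ₂ := by positivity
    linarith
  obtain ⟨Cx, hCx, Lx, hLx⟩ := hX.exists_regular_weight hr hXne hA0 hA1 hXlow hXup he0
    (by positivity : 0 < δ / 64) (by linarith)
  obtain ⟨Cy, hCy, Ly, hLy⟩ := hY.exists_regular_weight hs hYne hB0 hB1 hYlow hYup he0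
    (by positivity : 0 < δ / 64) (by linarith)
  set R : ℝ := 4 * s + 4 with hR
  obtain ⟨n₁, hn₁⟩ := exists_block_length hr ((4 * R + 1) * (R + 2 * s) * s * (Cx * Cy))
    (by linarith : 0 < 4 * e) (by positivity : 0 < δ / 16)
  set n₀ := max n₁ (max Lx (s * (Ly + 1))) with hn₀
  have hn₀1 : n₁ ≤ n₀ := le_max_left _ _
  have hn₀x : Lx ≤ n₀ := (le_max_left _ _).trans (le_max_right _ _)
  have hn₀y : s * (Ly + 1) ≤ n₀ := (le_max_right _ _).trans (le_max_right _ _)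
  have hn₀0 : 0 < n₀ := lt_of_lt_of_le (by positivity) hn₀y
  set L := Nat.log s (r ^ n₀) with hL
  have hLy' : Ly + 1 ≤ L := le_log_pow hr hs hn₀y
  set ρ : ℝ := ((r : ℝ) ^ n₀)⁻¹ with hρ
  have hρ0 : 0 < ρ := by positivity
  have hρ1 : ρ ≤ 1 := inv_le_one_of_one_le₀ (one_le_pow₀ hr1.le)
  have hρpow : ∀ y : ℝ, ρ ^ y = (r : ℝ) ^ (-(n₀ : ℝ) * y) := by
    intro y
    rw [hρ, Real.inv_rpow (by positivity), ← Real.rpow_natCast, ← Real.rpow_mul hr0.le,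
      ← Real.rpow_neg hr0.le, neg_mul]
  set ℓ : ℕ → ℕ := fun k => n₀ * k with hℓ
  set ℓ' : ℕ → ℕ := fun k => Nat.log s (r ^ (n₀ * k)) with hℓ'
  have hrne : ∀ k : ℕ, r ^ k ≠ 0 := fun k => pow_ne_zero k (by omega)
  have hstep' : ∀ k, ℓ' k + L ≤ ℓ' (k + 1) ∧ ℓ' (k + 1) ≤ ℓ' k + L + 1 := by
    intro k
    have := log_mul_bounds hs (hrne (n₀ * k)) (hrne n₀)
    rw [← pow_add, ← Nat.mul_succ] at this
    exact this
  have hℓinv : ∀ k, ((r : ℝ) ^ ℓ k)⁻¹ = ρ ^ k := fun k => by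
    simp only [hℓ, hρ]; rw [pow_mul, inv_pow]
  have hℓ'inv : ∀ k, ρ ^ k ≤ ((s : ℝ) ^ ℓ' k)⁻¹ ∧ ((s : ℝ) ^ ℓ' k)⁻¹ ≤ s * ρ ^ k := by
    intro k
    have h1 : ((s ^ ℓ' k : ℕ) : ℝ) ≤ ((r ^ (n₀ * k) : ℕ) : ℝ) :=
      Nat.cast_le.mpr (Nat.pow_log_le_self s (hrne _))
    have h2 : ((r ^ (n₀ * k) : ℕ) : ℝ) ≤ ((s ^ (ℓ' k + 1) : ℕ) : ℝ) :=
      Nat.cast_le.mpr (Nat.lt_pow_succ_log_self (by omega) _).le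
    push_cast at h1 h2
    rw [← hℓinv]
    constructor
    · exact inv_anti₀ (by positivity) h1
    · rw [pow_succ] at h2
      rw [← div_eq_mul_inv, le_div_iff₀ (by positivity), inv_mul_le_iff₀ (by positivity)]
      exact h2
  have hℓm : Monotone ℓ := fun i j h => Nat.mul_le_mul_left _ h
  have hℓm' : Monotone ℓ' := monotone_nat_of_le_succ fun k => by have := (hstep' k).1; omega
  set P : ℝ := ρ ^ (-γ₂) with hP
  have hP1 : 1 ≤ P := Real.one_le_rpow_of_pos_of_le_one_of_nonpos hρ0 hρ1 (by linarith)
  set Bx := Cx * (r : ℝ) ^ (2 * e * n₀) with hBx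
  set By := Cy * (s : ℝ) ^ (2 * e * L) with hBy
  have hBx1 : 1 ≤ Bx := one_le_mul_of_one_le_of_one_le hCx
    (Real.one_le_rpow hr1.le (by positivity))
  have hBy1 : 1 ≤ By := one_le_mul_of_one_le_of_one_le hCy
    (Real.one_le_rpow hs1.le (by positivity))
  have hByle : By ≤ Cy * (r : ℝ) ^ (2 * e * n₀) := by
    rw [hBy]
    gcongr
    have h1 : (s : ℝ) ^ (L : ℕ) ≤ (r : ℝ) ^ (n₀ : ℕ) := by
      exact_mod_cast Nat.pow_log_le_self s (hrne n₀)
    rw [mul_comm (2 * e) (L : ℝ), mul_comm (2 * e) (n₀ : ℝ), Real.rpow_mul hs0.le,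
      Real.rpow_mul hr0.le, Real.rpow_natCast, Real.rpow_natCast]
    exact Real.rpow_le_rpow (by positivity) h1 (by linarith)
  -- As r ≤ 2^r, this makes 2^I at least r^n₀ = 1/ρ.
  set I := n₀ * r with hI
  have hI1 : 1 ≤ 2 ^ I * ρ := by
    rw [hρ, ← div_eq_mul_inv, le_div_iff₀ (by positivity), one_mul, hI, mul_comm n₀ r, pow_mul]
    gcongr
    exact_mod_cast Nat.lt_two_pow_self.le
  set E := (4 * R + 1) * (R + 2 * s) * s * (Bx * By) * (I + 1) * ρ ^ (a + b) with hE
  have hPE : P * E ≤ δ / 16 := by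
    refine le_trans ?_ (hn₁ n₀ hn₀1)
    have h1 : P * ρ ^ (a + b) * ((r : ℝ) ^ (2 * e * n₀) * (r : ℝ) ^ (2 * e * n₀)) =
        (r : ℝ) ^ (-(4 * e) * n₀) := by
      rw [hP, hρpow, hρpow, ← Real.rpow_add hr0, ← Real.rpow_add hr0, ← Real.rpow_add hr0]
      congr 1
      have : a + b = γ₂ + 8 * e := by rw [he]; ring
      rw [this]
      ring
    calc P * E = (4 * R + 1) * (R + 2 * s) * s * (I + 1) * (P * ρ ^ (a + b)) * (Bx * By) := by
          rw [hE]; ring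
      _ ≤ (4 * R + 1) * (R + 2 * s) * s * (I + 1) * (P * ρ ^ (a + b)) *
          (Bx * (Cy * (r : ℝ) ^ (2 * e * n₀))) := by gcongr
      _ = (4 * R + 1) * (R + 2 * s) * s * (Cx * Cy) * (I + 1) *
          (P * ρ ^ (a + b) * ((r : ℝ) ^ (2 * e * n₀) * (r : ℝ) ^ (2 * e * n₀))) := by
          rw [hBx]; ring
      _ = _ := by rw [h1]
  -- The allowance is δD/2. Irregular levels cost 2(δ/64 · 4D + 1) and non-spread ones 4D · δ/16, in
  -- all 3δD/8 + 2, which fits once δD ≥ 16.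
  obtain ⟨D₁, hD₁⟩ := exists_nat_ge (16 / δ)
  refine ⟨n₀, hn₀0, D₁ + 1, fun D hD c hc => ?_⟩
  have hD0 : 0 < D := by omega
  have hDδ : 16 ≤ δ * D := by
    have h1 : (16 : ℝ) / δ ≤ D := hD₁.trans (by exact_mod_cast (by omega : D₁ ≤ D))
    rwa [div_le_iff₀' hδ0] at h1
  obtain ⟨F, hFX, w, hw, hFw, hFreg⟩ := hLx n₀ hn₀x ℓ (by simp [hℓ])
    (fun k => by simp only [hℓ]; constructor <;> rw [Nat.mul_succ]; omega) (4 * D)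
  obtain ⟨G, hGY, v, hv, hGv, hGreg⟩ := hLy L (by omega) ℓ' (by simp [hℓ']) hstep' (4 * D)
  have hx : ∀ x ∈ F, (((Finset.range (4 * D)).filter
      (fun k => ¬ Regular r ℓ a Bx F w k x)).card : ℝ) ≤ δ / 64 * (4 * D : ℕ) + 1 := by
    intro x hx
    refine le_trans (Nat.cast_le.mpr (Finset.card_le_card fun k hk => ?_)) (hFreg x hx)
    rw [Finset.mem_filter] at hk ⊢
    exact ⟨hk.1, fun h => hk.2 (h.mono_exponent hr hw hBx1 ha0 haA)⟩
  have hy : ∀ y ∈ G, (((Finset.range (4 * D)).filter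
      (fun k => ¬ Regular s ℓ' b By G v k y)).card : ℝ) ≤ δ / 64 * (4 * D : ℕ) + 1 := by
    intro y hy
    refine le_trans (Nat.cast_le.mpr (Finset.card_le_card fun k hk => ?_)) (hGreg y hy)
    rw [Finset.mem_filter] at hk ⊢
    exact ⟨hk.1, fun h => hk.2 (h.mono_exponent hs hv hBy1 hb0 hbB)⟩
  obtain ⟨t, ht, htsum⟩ := exists_direction hs hρ0 hℓinv hℓ'inv hw hv hFw hGv ha0 hb0 hab
    (by linarith) (by linarith) (by linarith : 0 ≤ P) (by rw [hR]; linarith : 1 ≤ R) hc hI1 (4 * D)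
    hx hy
  set Ω := F ×ˢ G with hΩ
  set m : ℝ × ℝ → ℝ := fun p => w p.1 * v p.2 with hm
  have hm0 : ∀ p, 0 ≤ m p := fun p => mul_nonneg (hw _) (hv _)
  have hmass : mass Ω m Set.univ = 1 := by
    have := mass_prod F G w v Set.univ Set.univ
    rw [hFw, hGv, mul_one] at this
    rw [← this]
    exact mass_congr fun p _ => by simp
  obtain ⟨l, hDl, hl2, p₀, hp₀, hpos, hhalf⟩ := exists_good_start (pairNode r s ℓ ℓ') hm0 hmass
    (fun k p => ¬ Spread r s ℓ ℓ' Ω m P R ρ (c * t) k p) hδ0 hD0 (htsum.trans (by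
      push_cast
      have h1 : (4 * (D : ℝ)) * (P * E) ≤ 4 * D * (δ / 16) := by gcongr
      nlinarith))
  set U : Set (ℝ × ℝ) := {q | pairNode r s ℓ ℓ' l q = pairNode r s ℓ ℓ' l p₀ ∧
        ∀ k, l + k ≤ 4 * D → (((Finset.Ico l (l + k)).filter
          (fun i => ¬ Spread r s ℓ ℓ' Ω m P R ρ (c * t) i q)).card : ℝ) ≤ δ * k} with hU
  have hhalfU : mass Ω m {q | pairNode r s ℓ ℓ' l q = pairNode r s ℓ ℓ' l p₀} / 2 ≤
      mass Ω m U := by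
    refine hhalf.trans (mass_mono hm0 fun q _ hq => ⟨hq.1, fun k hk => ?_⟩)
    convert hq.2 k hk
  refine ⟨t, ht, l, hDl, ?_, Ω, m, U, p₀, hm0, ?_, ?_, by linarith, ?_⟩
  · have : ∀ k, k ≤ ℓ' k := by
      intro k
      induction k with
      | zero => omega
      | succ k ih => have := (hstep' k).1; omega
    exact hDl.trans (this l)
  · intro p hp
    rw [hΩ, Finset.mem_product] at hp
    exact ⟨hFX hp.1, hGY hp.2⟩
  · intro p hp
    exact pairNode_eq_iff.mp hp.1
  -- Since l < 2D and k ≤ 2D, the control up to level 4D suffices. The factor 2 appears because U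
  -- has at least half of the mass of its node.
  · intro κ hκ k hk z u hu
    have h1 := mass_projection_le hr hs hℓm hℓm' hρ0 hρ1 hℓinv (fun k => (hℓ'inv k).2) hm0 hP1 hc ht
      hκ p₀ l k z u hu U (fun q hq => ⟨hq.1, hq.2 k (by omega)⟩)
    have h2 : P ^ ((1 - δ) * (k : ℝ)) = ((ρ ^ k) ^ γ)⁻¹ := by
      rw [hP, ← Real.rpow_mul hρ0.le, ← Real.rpow_natCast, ← Real.rpow_mul hρ0.le,
        ← Real.rpow_neg hρ0.le]
      congr 1
      rw [hδ]
      field_simp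
      ring
    rw [h2, ← div_eq_mul_inv, div_le_iff₀ (by positivity)] at h1
    refine h1.trans ?_
    have h3 := mul_le_mul_of_nonneg_right hhalfU (by positivity : 0 ≤ (ρ ^ k) ^ γ)
    linarith

/-! ### Multiplicative independence and renormalisation -/

/-- Differences of natural multiples of two incommensurable positive numbers are dense. -/
theorem exists_nat_combination_near {α β : ℝ} (hα : 0 < α) (hβ : 0 < β) (hirr : Irrational (α / β))
    (y : ℝ) {ε : ℝ} (hε : 0 < ε) : ∃ p q : ℕ, |p * α - q * β - y| < ε := by
  have hdense := dense_addSubgroupClosure_pair_iff.mpr hirr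
  -- A positive combination below both α and β has coefficients of opposite signs. Its multiples,
  -- shifted by a multiple of β or α to reach targets of either sign, are then of the required form.
  set ε' := min ε (min α β) with hε'
  have hε'0 : 0 < ε' := lt_min hε (lt_min hα hβ)
  obtain ⟨z, hz, hzmem⟩ := hdense.inter_open_nonempty (Set.Ioo 0 ε') isOpen_Ioo
    ⟨ε' / 2, by constructor <;> linarith⟩
  obtain ⟨i, j, hij⟩ := AddSubgroup.mem_closure_pair.mp hzmem
  simp only [zsmul_eq_mul] at hij
  have hz0 : 0 < z := hz.1
  have hzε : z < ε := hz.2.trans_le (min_le_left _ _)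
  have hzα : z < α := hz.2.trans_le ((min_le_right _ _).trans (min_le_left _ _))
  rcases le_or_gt 1 i with hi | hi
  · have hi' : (1 : ℝ) ≤ i := by exact_mod_cast hi
    have hj : j ≤ 0 := by
      by_contra hcon
      push Not at hcon
      have hj' : (0 : ℝ) < j := by exact_mod_cast hcon
      nlinarith [mul_pos hj' hβ]
    obtain ⟨p, rfl⟩ := Int.eq_ofNat_of_zero_le (by omega : 0 ≤ i)
    obtain ⟨q, hq⟩ := Int.eq_ofNat_of_zero_le (by omega : 0 ≤ -j)
    have hjq : (j : ℝ) = -(q : ℝ) := by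
      have : j = -(q : ℤ) := by omega
      rw [this]; push_cast; ring
    rw [hjq] at hij
    push_cast at hij
    obtain ⟨M, hM⟩ := exists_nat_gt (-y / β)
    rw [div_lt_iff₀ hβ] at hM
    set n := ⌊(y + M * β) / z⌋₊ with hn
    have hnn : 0 ≤ (y + M * β) / z := div_nonneg (by linarith) hz0.le
    have h1 := Nat.floor_le hnn
    have h2 := Nat.lt_floor_add_one ((y + M * β) / z)
    rw [← hn, le_div_iff₀ hz0] at h1
    rw [← hn, div_lt_iff₀ hz0] at h2
    refine ⟨n * p, n * q + M, ?_⟩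
    have : ((n * p : ℕ) : ℝ) * α - ((n * q + M : ℕ) : ℝ) * β - y = n * z - (y + M * β) := by
      rw [← hij]; push_cast; ring
    rw [this, abs_lt]
    constructor <;> nlinarith
  · have hi' : (i : ℝ) ≤ 0 := by exact_mod_cast (by omega : i ≤ 0)
    have hj : 0 ≤ j := by
      by_contra hcon
      push Not at hcon
      have hj' : (j : ℝ) < 0 := by exact_mod_cast hcon
      nlinarith
    obtain ⟨q, rfl⟩ := Int.eq_ofNat_of_zero_le hj
    obtain ⟨p, hp⟩ := Int.eq_ofNat_of_zero_le (by omega : 0 ≤ -i)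
    have hip : (i : ℝ) = -(p : ℝ) := by
      have : i = -(p : ℤ) := by omega
      rw [this]; push_cast; ring
    rw [hip] at hij
    push_cast at hij
    obtain ⟨M, hM⟩ := exists_nat_gt (y / α)
    rw [div_lt_iff₀ hα] at hM
    set n := ⌊(M * α - y) / z⌋₊ with hn
    have hnn : 0 ≤ (M * α - y) / z := div_nonneg (by linarith) hz0.le
    have h1 := Nat.floor_le hnn
    have h2 := Nat.lt_floor_add_one ((M * α - y) / z)
    rw [← hn, le_div_iff₀ hz0] at h1
    rw [← hn, div_lt_iff₀ hz0] at h2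
    refine ⟨n * p + M, n * q, ?_⟩
    have : ((n * p + M : ℕ) : ℝ) * α - ((n * q : ℕ) : ℝ) * β - y = (M * α - y) - n * z := by
      rw [← hij]; push_cast; ring
    rw [this, abs_lt]
    constructor <;> nlinarith

/-- Approximate -log G by p log r - q log s and exponentiate; compactness of the interval bounds p
and q. The uniform bound is essential: the direction varies with the depth, while r^p enters the
final constant. -/
theorem exists_powers_ratio_near {r s : ℕ} (hr : 2 ≤ r) (hs : 2 ≤ s)
    (hirr : Irrational (Real.log r / Real.log s)) {G₀ G₁ ξ : ℝ} (hG₀ : 0 < G₀) (hξ : 0 < ξ) :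
    ∃ D : ℕ, ∀ G ∈ Set.Icc G₀ G₁, ∃ p ≤ D, ∃ q ≤ D,
      |(r : ℝ) ^ p / (s : ℝ) ^ q * G - 1| ≤ ξ := by
  have hr1 : (1 : ℝ) < r := by exact_mod_cast hr
  have hs1 : (1 : ℝ) < s := by exact_mod_cast hs
  have hr0 : (0 : ℝ) < r := by linarith
  have hs0 : (0 : ℝ) < s := by linarith
  obtain ⟨T, hT⟩ := (isCompact_Icc (a := G₀) (b := G₁)).elim_finite_subcover
    (fun pq : ℕ × ℕ => {G : ℝ | |(r : ℝ) ^ pq.1 / (s : ℝ) ^ pq.2 * G - 1| < ξ})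
    (fun pq => isOpen_lt (by fun_prop) continuous_const) (by
      intro G hG
      have hG0 : 0 < G := hG₀.trans_le hG.1
      obtain ⟨ε, hε, hexp⟩ := Metric.continuousAt_iff.mp
        (Real.continuous_exp.continuousAt (x := (0 : ℝ))) ξ hξ
      obtain ⟨p, q, hpq⟩ := exists_nat_combination_near (Real.log_pos hr1) (Real.log_pos hs1) hirr
        (-Real.log G) hε
      refine Set.mem_iUnion.mpr ⟨(p, q), ?_⟩
      have h1 := hexp (x := p * Real.log r - q * Real.log s + Real.log G) (by
        rw [Real.dist_eq, sub_zero]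
        rwa [sub_neg_eq_add] at hpq)
      rw [Real.dist_eq, Real.exp_zero, Real.exp_add, Real.exp_sub, Real.exp_log hG0,
        mul_comm (p : ℝ), mul_comm (q : ℝ), Real.exp_mul, Real.exp_mul, Real.exp_log hr0,
        Real.exp_log hs0, Real.rpow_natCast, Real.rpow_natCast] at h1
      exact h1)
  refine ⟨T.sup (fun pq => max pq.1 pq.2), fun G hG => ?_⟩
  obtain ⟨pq, hpq, hlt⟩ := Set.mem_iUnion₂.mp (hT hG)
  have hle := Finset.le_sup (f := fun pq : ℕ × ℕ => max pq.1 pq.2) hpq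
  exact ⟨pq.1, (le_max_left _ _).trans hle, pq.2, (le_max_right _ _).trans hle, le_of_lt hlt⟩

theorem mass_le_sum {α ι : Type*} {F : Finset α} {w : α → ℝ} (hw : ∀ x, 0 ≤ w x) {U : Set α}
    (T : Finset ι) (V : ι → Set α) (h : ∀ x ∈ F, x ∈ U → ∃ i ∈ T, x ∈ V i) :
    mass F w U ≤ ∑ i ∈ T, mass F w (V i) := by
  unfold mass
  rw [Finset.sum_comm]
  refine Finset.sum_le_sum fun x hx => ?_
  have hnn : ∀ i ∈ T, 0 ≤ (V i).indicator w x := fun i _ =>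
    Set.indicator_nonneg (fun x _ => hw x) x
  by_cases hU : x ∈ U
  · obtain ⟨i, hi, hxi⟩ := h x hx hU
    rw [Set.indicator_of_mem hU, ← Set.indicator_of_mem hxi w]
    exact Finset.single_le_sum hnn hi
  · rw [Set.indicator_of_notMem hU]
    exact Finset.sum_nonneg hnn

set_option maxHeartbeats 1000000 in
/-- A uniform lower bound for the sums over finite covers of `λX + ηY`. -/
theorem exists_cover_sum_ge {r s : ℕ} (hr : 2 ≤ r) (hs : 2 ≤ s)
    (hirr : Irrational (Real.log r / Real.log s)) {X Y : Set ℝ}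
    (hX : IsShiftInvariant r X) (hY : IsShiftInvariant s Y) (hXne : X.Nonempty) (hYne : Y.Nonempty)
    {A B : ℝ} (hA0 : 0 ≤ A) (hA1 : A ≤ 1) (hB0 : 0 ≤ B) (hB1 : B ≤ 1)
    (hXlow : ∀ n : ℕ, (r : ℝ) ^ (A * n) ≤ numCodes r X n)
    (hXup : ∀ ε > 0, ∃ C : ℝ, 1 ≤ C ∧
      ∀ n : ℕ, (numCodes r X n : ℝ) ≤ C * (r : ℝ) ^ ((A + ε) * n))
    (hYlow : ∀ n : ℕ, (s : ℝ) ^ (B * n) ≤ numCodes s Y n)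
    (hYup : ∀ ε > 0, ∃ C : ℝ, 1 ≤ C ∧
      ∀ n : ℕ, (numCodes s Y n : ℝ) ≤ C * (s : ℝ) ^ ((B + ε) * n))
    {γ : ℝ} (hγ0 : 0 ≤ γ) (hγAB : γ < A + B) (hγ1 : γ < 1) {lo hi : ℝ} (hlo : 0 < lo) :
    ∃ c₀ : ℝ, 0 < c₀ ∧ ∀ lam η : ℝ, lo ≤ |lam| → |lam| ≤ hi → lo ≤ |η| → |η| ≤ hi →
      ∀ (ι : Type) (T : Finset ι) (ctr δ : ι → ℝ), (∀ i ∈ T, 0 < δ i) →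
        (∀ x ∈ X, ∀ y ∈ Y, ∃ i ∈ T, lam * x + η * y ∈ Metric.ball (ctr i) (δ i / 2)) →
        c₀ ≤ ∑ i ∈ T, δ i ^ γ := by
  have hr1 : (1 : ℝ) < r := by exact_mod_cast hr
  have hs1 : (1 : ℝ) < s := by exact_mod_cast hs
  have hr0 : (0 : ℝ) < r := by linarith
  have hs0 : (0 : ℝ) < s := by linarith
  -- The exponents are chosen with a + b = min(A + B, 1), since the projection theorem requires a +
  -- b ≤ 1.
  obtain ⟨a, b, ha0, haA, hb0, hbB, hab, hγab⟩ : ∃ a b : ℝ, 0 ≤ a ∧ a ≤ A ∧ 0 ≤ b ∧ b ≤ B ∧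
      a + b ≤ 1 ∧ γ < a + b := by
    rcases le_or_gt (A + B) 1 with h | h
    · exact ⟨A, B, hA0, le_rfl, hB0, le_rfl, h, hγAB⟩
    · exact ⟨A, 1 - A, hA0, le_rfl, by linarith, by linarith, by linarith, by linarith⟩
  obtain ⟨n₀, hn₀, D₀, hD₀⟩ := exists_frostman_pairs hr hs hX hY hXne hYne hA0 hA1 hB0 hB1 hXlow
    hXup hYlow hYup ha0 haA hb0 hbB hab hγ0 hγab
  set ρ : ℝ := ((r : ℝ) ^ n₀)⁻¹ with hρ
  have hρ0 : 0 < ρ := by positivity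
  have hρ1 : ρ < 1 := inv_lt_one_of_one_lt₀ (one_lt_pow₀ hr1 hn₀.ne')
  rcases lt_or_ge hi lo with hlohi | hlohi
  · exact ⟨1, one_pos, fun lam η h1 h2 => by linarith⟩
  have hhi : 0 < hi := hlo.trans_le hlohi
  obtain ⟨D₁, hD₁⟩ := exists_powers_ratio_near hr hs hirr (G₀ := lo / hi / s / 2)
    (G₁ := hi / lo) (by positivity) (by positivity : 0 < ρ / (2 * s))
  -- A lower bound for the width ρ^l of the cell after magnification by |λ|r^(n₀l - p), as |λ| ≥ lo
  -- and p ≤ D₁. It does not involve the depth D, so neither does the final constant.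
  set a₀ := lo / (r : ℝ) ^ D₁ with ha₀
  have ha₀0 : 0 < a₀ := by positivity
  refine ⟨(a₀ * ρ) ^ γ / 2, by positivity, ?_⟩
  intro lam η hlam1 hlam2 hη1 hη2 ι T ctr δ hδ hcov
  have hlam0 : lam ≠ 0 := abs_pos.mp (hlo.trans_le hlam1)
  have hη0 : η ≠ 0 := abs_pos.mp (hlo.trans_le hη1)
  -- a depth beyond all scales of the cover
  obtain ⟨D₂, hD₂⟩ : ∃ D₂ : ℕ, ∀ i ∈ T, a₀ * ρ ^ D₂ < δ i := by
    have : ∀ i ∈ T, ∀ᶠ n : ℕ in Filter.atTop, a₀ * ρ ^ n < δ i := by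
      intro i hi
      have h1 := (tendsto_pow_atTop_nhds_zero_of_lt_one hρ0.le hρ1).const_mul a₀
      rw [mul_zero] at h1
      exact h1.eventually_lt_const (hδ i hi)
    exact ((Filter.eventually_all_finset T).mpr this).exists
  set D := max D₀ (max D₁ D₂) with hD
  have hDD₀ : D₀ ≤ D := le_max_left _ _
  have hDD₁ : D₁ ≤ D := (le_max_left _ _).trans (le_max_right _ _)
  have hDD₂ : D₂ ≤ D := (le_max_right _ _).trans (le_max_right _ _)
  set c : ℝ := (η / lam) / |η / lam| with hc
  have hratio : 0 < |η / lam| := abs_pos.mpr (div_ne_zero hη0 hlam0)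
  have hc1 : |c| = 1 := by rw [hc, abs_div, abs_abs, div_self hratio.ne']
  obtain ⟨t, ht, l, hDl, hDL, Ω, m, U, p₀, hm0, hΩ, hU, hpos, hfrost⟩ := hD₀ D hDD₀ c hc1
  set L := Nat.log s (r ^ (n₀ * l)) with hL
  have ht0 : 0 < t := by linarith [ht.1]
  have hsL1 : (s : ℝ) ^ L / (r : ℝ) ^ (n₀ * l) ≤ 1 := by
    rw [div_le_one (by positivity)]
    exact_mod_cast Nat.pow_log_le_self s (pow_ne_zero _ (by omega))
  have hsL2 : 1 / (s : ℝ) ≤ (s : ℝ) ^ L / (r : ℝ) ^ (n₀ * l) := by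
    rw [div_le_div_iff₀ hs0 (by positivity), one_mul, ← pow_succ]
    exact_mod_cast (Nat.lt_pow_succ_log_self (by omega : 1 < s) (r ^ (n₀ * l))).le
  -- The ratio of the direction obtained from the full shifts n₀l and L to the desired t. It stays
  -- in a fixed interval because the two scales agree up to a factor s and 1 ≤ t ≤ 2. Undoing p and
  -- q shifts multiplies it by r^p/s^q.
  set G := |η / lam| * ((s : ℝ) ^ L / (r : ℝ) ^ (n₀ * l)) / t with hG
  have hGmem : G ∈ Set.Icc (lo / hi / s / 2) (hi / lo) := by
    have h1 : lo / hi ≤ |η / lam| := by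
      rw [abs_div]
      exact div_le_div₀ (abs_nonneg _) hη1 (abs_pos.mpr hlam0) hlam2
    have h2 : |η / lam| ≤ hi / lo := by
      rw [abs_div]
      exact div_le_div₀ hhi.le hη2 hlo hlam1
    constructor
    · rw [hG]
      refine div_le_div₀ (by positivity) ?_ ht0 ht.2
      calc lo / hi / s = lo / hi * (1 / s) := by ring
        _ ≤ _ := by gcongr
    · rw [hG, div_le_iff₀ ht0]
      calc |η / lam| * ((s : ℝ) ^ L / (r : ℝ) ^ (n₀ * l)) ≤ hi / lo * 1 := by gcongr
        _ ≤ hi / lo * t := by gcongr; exact ht.1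
  obtain ⟨p, hp, q, hq, hpq⟩ := hD₁ G hGmem
  set κ := (r : ℝ) ^ p / (s : ℝ) ^ q * G with hκ
  have hln : l ≤ n₀ * l := Nat.le_mul_of_pos_left l hn₀
  obtain ⟨i₁, hi₁⟩ : ∃ i₁, i₁ + p = n₀ * l := ⟨n₀ * l - p, by omega⟩
  obtain ⟨i₂, hi₂⟩ : ∃ i₂, i₂ + q = L := ⟨L - q, by omega⟩
  -- On the cell the two iterates subtract constant integers, so this identity makes λT_r^(i₁)x +
  -- ηT_s^(i₂)y equal to W(x + ctκy) minus the constant C. The iterates lie in X and Y, so the given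
  -- cover applies to this value.
  have hkey : lam * (r : ℝ) ^ i₁ * (c * t * κ) = η * (s : ℝ) ^ i₂ := by
    rw [hκ, hG, hc, ← hi₁, ← hi₂, pow_add, pow_add]
    have := hratio.ne'
    field_simp
  set C := lam * code r i₁ p₀.1 + η * code s i₂ p₀.2 with hC
  set W := lam * (r : ℝ) ^ i₁ with hW
  have hW0 : W ≠ 0 := mul_ne_zero hlam0 (by positivity)
  have hWabs : |W| = |lam| * (r : ℝ) ^ i₁ := by
    rw [hW, abs_mul, abs_of_pos (by positivity : (0 : ℝ) < (r : ℝ) ^ i₁)]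
  have hWpos : 0 < |W| := abs_pos.mpr hW0
  set V : ι → Set (ℝ × ℝ) := fun i =>
    {x | x ∈ U ∧ |x.1 + c * t * κ * x.2 - (ctr i + C) / W| ≤ δ i / 2 / |W|} with hV
  have hcovU : mass Ω m U ≤ ∑ i ∈ T, mass Ω m (V i) := by
    refine mass_le_sum hm0 T V fun x hx hxU => ?_
    obtain ⟨hx1, hx2⟩ := hΩ x hx
    obtain ⟨i, hi, hball⟩ := hcov _ (hX.fract_mem _ hx1 i₁) _ (hY.fract_mem _ hx2 i₂)
    refine ⟨i, hi, hxU, ?_⟩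
    rw [Metric.mem_ball, Real.dist_eq] at hball
    have e1 : code r i₁ x.1 = code r i₁ p₀.1 := code_eq_of_le hr (by omega) (hU x hxU).1
    have e2 : code s i₂ x.2 = code s i₂ p₀.2 := code_eq_of_le hs (by omega) (hU x hxU).2
    have e3 : lam * Int.fract ((r : ℝ) ^ i₁ * x.1) + η * Int.fract ((s : ℝ) ^ i₂ * x.2) - ctr i =
        W * (x.1 + c * t * κ * x.2 - (ctr i + C) / W) := by
      have e4 : W * (x.1 + c * t * κ * x.2 - (ctr i + C) / W) =
          W * x.1 + W * (c * t * κ) * x.2 - (ctr i + C) := by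
        field_simp
      rw [e4, hkey, ← Int.self_sub_floor, ← Int.self_sub_floor, hC, ← e1, ← e2, hW]
      unfold code
      ring
    rw [e3, abs_mul] at hball
    rw [le_div_iff₀ hWpos, mul_comm]
    exact hball.le
  have hterm : ∀ i ∈ T, mass Ω m (V i) ≤ 2 * (δ i / (a₀ * ρ)) ^ γ * mass Ω m U := by
    intro i hi
    have hδi := hδ i hi
    rcases le_or_gt (δ i) a₀ with hsmall | hlarge
    · obtain ⟨k, hk1, hk2⟩ := exists_nat_pow_near_of_lt_one (div_pos hδi ha₀0)
        ((div_le_one ha₀0).mpr hsmall) hρ0 hρ1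
      rw [lt_div_iff₀ ha₀0] at hk1
      rw [div_le_iff₀ ha₀0] at hk2
      -- D ≥ D₂, and D₂ was chosen so that no ball of the finite cover is smaller than a₀ρ^D₂.
      have hk2D : k ≤ 2 * D := by
        by_contra hcon
        push Not at hcon
        have h1 : ρ ^ k ≤ ρ ^ D₂ := pow_le_pow_of_le_one hρ0.le hρ1.le (by omega)
        have h2 := hD₂ i hi
        nlinarith
      have hu : δ i / 2 / |W| ≤ ρ ^ (l + k) := by
        have h1 : a₀ ≤ |W| * ρ ^ l := by
          have h2 : ρ ^ l = ((r : ℝ) ^ i₁ * (r : ℝ) ^ p)⁻¹ := by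
            rw [hρ, inv_pow, ← pow_mul, ← hi₁, pow_add]
          rw [hWabs, h2, ha₀, mul_inv, mul_assoc, mul_inv_cancel_left₀ (by positivity),
            div_eq_mul_inv]
          refine mul_le_mul hlam1 ?_ (by positivity) (abs_nonneg _)
          exact inv_anti₀ (by positivity) (pow_le_pow_right₀ hr1.le hp)
        rw [div_le_iff₀ hWpos, pow_add]
        have h3 : ρ ^ k * a₀ ≤ ρ ^ k * (|W| * ρ ^ l) := by gcongr
        linarith
      refine (hfrost κ hpq k hk2D _ _ hu).trans ?_
      have h1 : ρ ^ k ≤ δ i / (a₀ * ρ) := by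
        rw [le_div_iff₀ (by positivity)]
        rw [pow_succ] at hk1
        linarith
      have h2 := Real.rpow_le_rpow (by positivity) h1 hγ0
      gcongr
    · have h1 : mass Ω m (V i) ≤ mass Ω m U := mass_mono hm0 fun x _ hx => hx.1
      have h2 : 1 ≤ (δ i / (a₀ * ρ)) ^ γ := by
        refine Real.one_le_rpow ?_ hγ0
        rw [one_le_div (by positivity)]
        nlinarith
      nlinarith
  have hfinal := hcovU.trans (Finset.sum_le_sum hterm)
  rw [← Finset.sum_mul, ← Finset.mul_sum] at hfinal
  have h1 : 1 ≤ 2 * ∑ i ∈ T, (δ i / (a₀ * ρ)) ^ γ := by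
    by_contra hcon
    push Not at hcon
    nlinarith
  have h2 : ∑ i ∈ T, (δ i / (a₀ * ρ)) ^ γ = (∑ i ∈ T, δ i ^ γ) / (a₀ * ρ) ^ γ := by
    rw [Finset.sum_div]
    exact Finset.sum_congr rfl fun i hi => Real.div_rpow (hδ i hi).le (by positivity) γ
  rw [h2, ← mul_div_assoc, le_div_iff₀ (by positivity), one_mul] at h1
  linarith

/-! ### Invariant sets, content and Hausdorff dimension -/

open MeasureTheory

theorem timesMap_fract (r i : ℕ) (x : ℝ) :
    timesMap r (Int.fract ((r : ℝ) ^ i * x)) = Int.fract ((r : ℝ) ^ (i + 1) * x) := by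
  unfold timesMap
  rw [Int.fract_eq_fract]
  refine ⟨-(r * ⌊(r : ℝ) ^ i * x⌋), ?_⟩
  rw [← Int.self_sub_floor, pow_succ]
  push_cast
  ring

/-- Fractional parts never equal 1, so removing that point keeps the set stable. Closedness may be
lost, but the tree arguments do not use it. -/
theorem isShiftInvariant_inter {r : ℕ} {X : Set ℝ} (hX : IsTimesInvariant r X) :
    IsShiftInvariant r (X ∩ Set.Ico 0 1) := by
  refine ⟨Set.inter_subset_right, fun x hx i => ⟨?_, Int.fract_nonneg _, Int.fract_lt_one _⟩⟩
  induction i with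
  | zero => rw [pow_zero, one_mul, Int.fract_eq_self.mpr hx.2]; exact hx.1
  | succ i ih => rw [← timesMap_fract]; exact hX.image_subset ⟨_, ih, rfl⟩

theorem inter_Ico_nonempty {r : ℕ} {X : Set ℝ} (hX : IsTimesInvariant r X) (hne : X.Nonempty) :
    (X ∩ Set.Ico 0 1).Nonempty := by
  obtain ⟨x, hx⟩ := hne
  exact ⟨timesMap r x, hX.image_subset ⟨x, hx, rfl⟩, Int.fract_nonneg _, Int.fract_lt_one _⟩

theorem numCodes_le_two_mul {r : ℕ} {X : Set ℝ} (hX : X ⊆ Set.Icc 0 1)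
    (hne : (X ∩ Set.Ico 0 1).Nonempty) (n : ℕ) :
    numCodes r X n ≤ 2 * numCodes r (X ∩ Set.Ico 0 1) n := by
  have hsub : code r n '' X ⊆ code r n '' (X ∩ Set.Ico 0 1) ∪ {code r n 1} := by
    rintro _ ⟨x, hx, rfl⟩
    rcases (hX hx).2.eq_or_lt with h | h
    · right; rw [h]; rfl
    · exact Or.inl ⟨x, ⟨hx, (hX hx).1, h⟩, rfl⟩
  have hfin := finite_codes (r := r) (Set.inter_subset_left.trans hX : X ∩ Set.Ico 0 1 ⊆ _) n
  have h1 := Set.ncard_le_ncard hsub (hfin.union (Set.finite_singleton _))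
  have h2 := Set.ncard_union_le (code r n '' (X ∩ Set.Ico 0 1)) {code r n 1}
  rw [Set.ncard_singleton] at h2
  have h3 := numCodes_pos (r := r) (Set.inter_subset_left.trans hX : X ∩ Set.Ico 0 1 ⊆ _) hne n
  unfold numCodes at h3 ⊢
  omega

theorem content_le_tsum {S : Set ℝ} {γ : ℝ} {ι : Type} [hι : Countable ι] (c δ : ι → ℝ)
    (hδ : ∀ i, 0 < δ i) (hS : S ⊆ ⋃ i, Metric.ball (c i) (δ i / 2)) :
    unlimitedHausdorffContent γ S ≤ ∑' i, ENNReal.ofReal (δ i ^ γ) :=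
  iInf_le_of_le ι <| iInf_le_of_le hι <| iInf_le_of_le c <| iInf_le_of_le δ <|
    iInf_le_of_le hδ <| iInf_le_of_le hS le_rfl

/-- Positive unlimited content bounds the Hausdorff dimension from below. -/
theorem le_dimH_of_content_pos {S : Set ℝ} {γ : ℝ} (hγ : 0 ≤ γ)
    (h : 0 < unlimitedHausdorffContent γ S) : ENNReal.ofReal γ ≤ dimH S := by
  rcases hγ.eq_or_lt with rfl | hγ0
  · simp
  by_contra hcon
  push Not at hcon
  have hzero : μH[γ] S = 0 := by
    have := hausdorffMeasure_of_dimH_lt (s := S) (d := γ.toNNReal) hcon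
    rwa [Real.coe_toNNReal γ hγ] at this
  have hcov : ∀ ε : ℝ≥0∞, ε ≠ 0 → ∃ t : ℕ → Set ℝ, S ⊆ ⋃ n, t n ∧
      (∀ n, Metric.ediam (t n) ≤ 1) ∧ ∑' n, Metric.ediam (t n) ^ γ < ε := by
    intro ε hε
    rw [Measure.hausdorffMeasure_apply] at hzero
    have h1 := ENNReal.iSup_eq_zero.mp (ENNReal.iSup_eq_zero.mp hzero 1) one_pos
    have h2 : _ < ε := lt_of_eq_of_lt h1 (pos_iff_ne_zero.mpr hε)
    simp only [iInf_lt_iff] at h2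
    obtain ⟨t, ht1, ht2, ht3⟩ := h2
    refine ⟨t, ht1, ht2, lt_of_eq_of_lt (tsum_congr fun n => ?_) ht3⟩
    rcases (t n).eq_empty_or_nonempty with he | hne
    · simp [he, hγ0]
    · simp [hne]
  have hle : ∀ ε : ℝ≥0∞, ε ≠ 0 →
      unlimitedHausdorffContent γ S ≤ ENNReal.ofReal (4 ^ γ) * (ε + ε) := by
    intro ε hε
    obtain ⟨t, ht1, ht2, ht3⟩ := hcov ε hε
    -- Pieces of a Hausdorff cover may have diameter 0, whereas balls need positive diameter. A
    -- summable positive term added to the γ-th powers of the diameters repairs this at total cost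
    -- below ε.
    obtain ⟨e, he0, hesum⟩ := ENNReal.exists_pos_sum_of_countable hε ℕ
    set d : ℕ → ℝ := fun n => (Metric.ediam (t n)).toReal with hd
    have hfin : ∀ n, Metric.ediam (t n) ≠ ∞ := fun n =>
      ((ht2 n).trans_lt ENNReal.one_lt_top).ne
    have hd0 : ∀ n, 0 ≤ d n := fun n => ENNReal.toReal_nonneg
    set V : ℕ → ℝ := fun n => d n ^ γ + e n with hV
    have hV0 : ∀ n, 0 < V n := fun n =>
      add_pos_of_nonneg_of_pos (Real.rpow_nonneg (hd0 n) γ) (by exact_mod_cast he0 n)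
    have hdV : ∀ n, d n ≤ V n ^ γ⁻¹ := fun n => by
      rw [Real.le_rpow_inv_iff_of_pos (hd0 n) (hV0 n).le hγ0]
      exact le_add_of_nonneg_right (e n).coe_nonneg
    have hpick : ∀ n, ∃ x : ℝ, t n ⊆ Metric.closedBall x (d n) := by
      intro n
      rcases (t n).eq_empty_or_nonempty with he | ⟨x, hx⟩
      · exact ⟨0, by simp [he]⟩
      · refine ⟨x, fun y hy => ?_⟩
        rw [Metric.mem_closedBall, dist_edist]
        exact ENNReal.toReal_mono (hfin n) (Metric.edist_le_ediam_of_mem hy hx)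
    choose x hx using hpick
    have hpos : ∀ n, 0 < 4 * V n ^ γ⁻¹ := fun n => by
      have := Real.rpow_pos_of_pos (hV0 n) γ⁻¹
      positivity
    refine (content_le_tsum x (fun n => 4 * V n ^ γ⁻¹) hpos ?_).trans ?_
    · refine ht1.trans (Set.iUnion_mono fun n => (hx n).trans ?_)
      refine Metric.closedBall_subset_ball ?_
      have := Real.rpow_pos_of_pos (hV0 n) γ⁻¹
      linarith [hdV n]
    · have hterm : ∀ n, ENNReal.ofReal ((4 * V n ^ γ⁻¹) ^ γ) =
          ENNReal.ofReal (4 ^ γ) * (Metric.ediam (t n) ^ γ + e n) := by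
        intro n
        rw [Real.mul_rpow (by norm_num) (Real.rpow_nonneg (hV0 n).le _),
          Real.rpow_inv_rpow (hV0 n).le hγ0.ne', ENNReal.ofReal_mul (by positivity)]
        congr 1
        rw [ENNReal.ofReal_add (Real.rpow_nonneg (hd0 n) γ) (e n).coe_nonneg,
          ENNReal.ofReal_coe_nnreal, ← ENNReal.ofReal_rpow_of_nonneg (hd0 n) hγ,
          ENNReal.ofReal_toReal (hfin n)]
      rw [tsum_congr hterm, ENNReal.tsum_mul_left, ENNReal.tsum_add]
      gcongr
  have hz : unlimitedHausdorffContent γ S ≤ 0 := by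
    have hlim : Filter.Tendsto (fun ε : ℝ≥0∞ => ENNReal.ofReal (4 ^ γ) * (ε + ε))
        (nhdsWithin 0 (Set.Ioi 0)) (nhds 0) := by
      have h1 : Filter.Tendsto (fun ε : ℝ≥0∞ => ENNReal.ofReal (4 ^ γ) * (ε + ε))
          (nhds 0) (nhds (ENNReal.ofReal (4 ^ γ) * (0 + 0))) :=
        ENNReal.Tendsto.const_mul (Filter.tendsto_id.add Filter.tendsto_id)
          (Or.inr ENNReal.ofReal_ne_top)
      rw [add_zero, mul_zero] at h1
      exact h1.mono_left nhdsWithin_le_nhds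
    refine ge_of_tendsto hlim ?_
    filter_upwards [self_mem_nhdsWithin] with ε hε
    exact hle ε (ne_of_gt hε)
  exact absurd hz (not_le.mpr h)

/-- The Hausdorff dimension of a sumset is at most the sum of the box dimensions. -/
theorem dimH_add_le {r s : ℕ} (hr : 2 ≤ r) (hs : 2 ≤ s) {X Y : Set ℝ} (hX : X ⊆ Set.Icc 0 1)
    (hY : Y ⊆ Set.Icc 0 1) {A B : ℝ} (hA0 : 0 ≤ A) (hB0 : 0 ≤ B)
    (hXup : ∀ ε > 0, ∃ C : ℝ, 1 ≤ C ∧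
      ∀ n : ℕ, (numCodes r X n : ℝ) ≤ C * (r : ℝ) ^ ((A + ε) * n))
    (hYup : ∀ ε > 0, ∃ C : ℝ, 1 ≤ C ∧
      ∀ n : ℕ, (numCodes s Y n : ℝ) ≤ C * (s : ℝ) ^ ((B + ε) * n)) :
    dimH (X + Y) ≤ ENNReal.ofReal (A + B) := by
  have hr1 : (1 : ℝ) < r := by exact_mod_cast hr
  have hs1 : (1 : ℝ) < s := by exact_mod_cast hs
  have hr0 : (0 : ℝ) < r := by linarith
  have hs0 : (0 : ℝ) < s := by linarith
  have hmain : ∀ ε > 0, dimH (X + Y) ≤ ENNReal.ofReal (A + B + 2 * ε) := by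
    intro ε hε
    -- With this exponent the powers of r in the number of pairs of cells and in the d-th power of
    -- their diameter cancel exactly.
    set d := A + B + 2 * ε with hd
    have hd0 : 0 ≤ d := by positivity
    obtain ⟨Cx, hCx, hCx'⟩ := hXup ε hε
    obtain ⟨Cy, hCy, hCy'⟩ := hYup ε hε
    set lev : ℕ → ℕ := fun n => Nat.log s (r ^ n) with hlev
    have hlev1 : ∀ n, (s : ℝ) ^ lev n ≤ (r : ℝ) ^ n := fun n => by
      exact_mod_cast Nat.pow_log_le_self s (pow_ne_zero n (by omega : r ≠ 0))
    have hlev2 : ∀ n, ((s : ℝ) ^ lev n)⁻¹ ≤ s * ((r : ℝ) ^ n)⁻¹ := fun n => by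
      have h1 : (r : ℝ) ^ n ≤ (s : ℝ) ^ lev n * s := by
        rw [← pow_succ]
        exact_mod_cast (Nat.lt_pow_succ_log_self (by omega : 1 < s) (r ^ n)).le
      rw [← div_eq_mul_inv, le_div_iff₀ (by positivity), inv_mul_le_iff₀ (by positivity)]
      exact h1
    have hfx : ∀ n, Fintype (code r n '' X) := fun n => (finite_codes hX n).fintype
    have hfy : ∀ n, Fintype (code s (lev n) '' Y) := fun n => (finite_codes hY _).fintype
    set cov : (n : ℕ) → (code r n '' X) × (code s (lev n) '' Y) → Set ℝ := fun n c =>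
      {x ∈ X | code r n x = c.1} + {y ∈ Y | code s (lev n) y = c.2} with hcov
    set rad : ℕ → ℝ := fun n => (1 + s) * ((r : ℝ) ^ n)⁻¹ with hrad
    have hdiam : ∀ n c, Metric.ediam (cov n c) ≤ ENNReal.ofReal (rad n) := by
      intro n c
      refine Metric.ediam_le ?_
      rintro _ ⟨x, hx, y, hy, rfl⟩ _ ⟨x', hx', y', hy', rfl⟩
      rw [edist_dist]
      refine ENNReal.ofReal_le_ofReal ?_
      simp only [Real.dist_eq]
      have h1 := abs_sub_le_of_code_eq hr (hx.2.trans hx'.2.symm)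
      have h2 := (abs_sub_le_of_code_eq hs (hy.2.trans hy'.2.symm)).trans (hlev2 n)
      calc |x + y - (x' + y')| = |(x - x') + (y - y')| := by congr 1; ring
        _ ≤ |x - x'| + |y - y'| := abs_add_le _ _
        _ ≤ rad n := by rw [hrad]; simp only; linarith
    have hradlim : Filter.Tendsto (fun n => ENNReal.ofReal (rad n)) Filter.atTop (nhds 0) := by
      have h1 := (tendsto_pow_atTop_nhds_zero_of_lt_one (inv_nonneg.mpr hr0.le)
        (inv_lt_one_of_one_lt₀ hr1)).const_mul (1 + (s : ℝ))
      rw [mul_zero] at h1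
      have h2 := ENNReal.tendsto_ofReal h1
      rw [ENNReal.ofReal_zero] at h2
      refine h2.congr fun n => ?_
      rw [hrad, inv_pow]
    have hμ := Measure.hausdorffMeasure_le_liminf_sum d (X + Y) (l := Filter.atTop)
      (fun n => ENNReal.ofReal (rad n)) hradlim cov (Filter.Eventually.of_forall hdiam)
      (Filter.Eventually.of_forall fun n => by
        rintro _ ⟨x, hx, y, hy, rfl⟩
        exact Set.mem_iUnion.mpr ⟨(⟨_, x, hx, rfl⟩, ⟨_, y, hy, rfl⟩),
          Set.add_mem_add ⟨hx, rfl⟩ ⟨hy, rfl⟩⟩)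
    have hbound : ∀ n, ∑ c, Metric.ediam (cov n c) ^ d ≤
        ENNReal.ofReal (Cx * Cy * (1 + s) ^ d) := by
      intro n
      have hrn : (0 : ℝ) < (r : ℝ) ^ n := by positivity
      calc ∑ c, Metric.ediam (cov n c) ^ d ≤
            ∑ _c : (code r n '' X) × (code s (lev n) '' Y), ENNReal.ofReal (rad n ^ d) := by
            refine Finset.sum_le_sum fun c _ => ?_
            rw [← ENNReal.ofReal_rpow_of_nonneg (by rw [hrad]; positivity) hd0]
            exact ENNReal.rpow_le_rpow (hdiam n c) hd0
        _ = ENNReal.ofReal ((numCodes r X n : ℝ) * numCodes s Y (lev n) * rad n ^ d) := by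
            rw [Finset.sum_const, Finset.card_univ, Fintype.card_prod, nsmul_eq_mul,
              ← Nat.card_eq_fintype_card, ← Nat.card_eq_fintype_card, Nat.card_coe_set_eq,
              Nat.card_coe_set_eq, ENNReal.ofReal_mul (by positivity), ← Nat.cast_mul,
              ENNReal.ofReal_natCast]
            rfl
        _ ≤ _ := by
            refine ENNReal.ofReal_le_ofReal ?_
            have h1 : (s : ℝ) ^ ((B + ε) * lev n) ≤ (r : ℝ) ^ ((B + ε) * n) := by
              rw [mul_comm (B + ε) (lev n : ℝ), mul_comm (B + ε) (n : ℝ), Real.rpow_mul hs0.le,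
                Real.rpow_mul hr0.le, Real.rpow_natCast, Real.rpow_natCast]
              exact Real.rpow_le_rpow (by positivity) (hlev1 n) (by positivity)
            have h2 : rad n ^ d = (1 + s) ^ d * (r : ℝ) ^ (-(d * n)) := by
              rw [hrad, Real.mul_rpow (by positivity) (by positivity), Real.inv_rpow hrn.le,
                ← Real.rpow_natCast, ← Real.rpow_mul hr0.le, ← Real.rpow_neg hr0.le,
                mul_comm (n : ℝ) d]
            have h3 : (r : ℝ) ^ ((A + ε) * n) * (r : ℝ) ^ ((B + ε) * n) * (r : ℝ) ^ (-(d * n)) =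
                1 := by
              rw [← Real.rpow_add hr0, ← Real.rpow_add hr0]
              have : (A + ε) * n + (B + ε) * n + -(d * n) = 0 := by rw [hd]; ring
              rw [this, Real.rpow_zero]
            calc (numCodes r X n : ℝ) * numCodes s Y (lev n) * rad n ^ d
                ≤ (Cx * (r : ℝ) ^ ((A + ε) * n)) * (Cy * (r : ℝ) ^ ((B + ε) * n)) * rad n ^ d := by
                  have h4 : (numCodes s Y (lev n) : ℝ) ≤ Cy * (r : ℝ) ^ ((B + ε) * n) :=
                    (hCy' (lev n)).trans (by gcongr)
                  have h5 := hCx' n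
                  have h6 : 0 ≤ rad n := by rw [hrad]; positivity
                  gcongr
              _ = Cx * Cy * (1 + s) ^ d * ((r : ℝ) ^ ((A + ε) * n) * (r : ℝ) ^ ((B + ε) * n) *
                  (r : ℝ) ^ (-(d * n))) := by rw [h2]; ring
              _ = Cx * Cy * (1 + s) ^ d := by rw [h3, mul_one]
    have hfin : μH[d] (X + Y) ≠ ∞ := by
      refine ne_top_of_le_ne_top ENNReal.ofReal_ne_top (hμ.trans
        (Filter.liminf_le_of_frequently_le' (Filter.Frequently.of_forall hbound)))
    have := dimH_le_of_hausdorffMeasure_ne_top (s := X + Y) (d := d.toNNReal)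
      (by rwa [Real.coe_toNNReal d hd0])
    exact this
  have hlim : Filter.Tendsto (fun ε : ℝ => ENNReal.ofReal (A + B + 2 * ε))
      (nhdsWithin 0 (Set.Ioi 0)) (nhds (ENNReal.ofReal (A + B))) := by
    have h1 : Filter.Tendsto (fun ε : ℝ => A + B + 2 * ε) (nhds 0) (nhds (A + B + 2 * 0)) := by
      have : Continuous fun ε : ℝ => A + B + 2 * ε := by fun_prop
      exact this.tendsto 0
    rw [mul_zero, add_zero] at h1
    exact (ENNReal.tendsto_ofReal h1).mono_left nhdsWithin_le_nhds
  refine ge_of_tendsto hlim ?_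
  filter_upwards [self_mem_nhdsWithin] with ε hε
  exact hmain ε hε

/-! ### Assembling the theorem -/

/-- The box dimension of a `×r`-invariant set, with the bounds for the number of codes. -/
def HasGrowth (r : ℕ) (X : Set ℝ) (A : ℝ) : Prop :=
  0 ≤ A ∧ A ≤ 1 ∧ (∀ n : ℕ, (r : ℝ) ^ (A * n) ≤ numCodes r (X ∩ Set.Ico 0 1) n) ∧
    ∀ ε > 0, ∃ C : ℝ, 1 ≤ C ∧
      ∀ n : ℕ, (numCodes r (X ∩ Set.Ico 0 1) n : ℝ) ≤ C * (r : ℝ) ^ ((A + ε) * n)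

theorem HasGrowth.numCodes_le {r : ℕ} {X : Set ℝ} (hX : IsTimesInvariant r X)
    (hne : X.Nonempty) {A : ℝ} (hA : HasGrowth r X A) :
    ∀ ε > 0, ∃ C : ℝ, 1 ≤ C ∧
      ∀ n : ℕ, (numCodes r X n : ℝ) ≤ C * (r : ℝ) ^ ((A + ε) * n) := by
  intro ε hε
  obtain ⟨C, hC, hCn⟩ := hA.2.2.2 ε hε
  refine ⟨2 * C, by linarith, fun n => ?_⟩
  have h1 : (numCodes r X n : ℝ) ≤ 2 * (numCodes r (X ∩ Set.Ico 0 1) n : ℝ) := by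
    exact_mod_cast numCodes_le_two_mul hX.subset_Icc (inter_Ico_nonempty hX hne) n
  linarith [hCn n]

/-- {0} is invariant for every base and has growth exponent 0. As a summand it turns the statements
on sumsets into statements on a single set. -/
theorem isTimesInvariant_zero (r : ℕ) : IsTimesInvariant r {0} := by
  refine ⟨by simp, isClosed_singleton, ?_⟩
  rintro _ ⟨x, hx, rfl⟩
  rw [Set.mem_singleton_iff] at hx ⊢
  rw [hx, timesMap, mul_zero, Int.fract_zero]

theorem hasGrowth_zero {r : ℕ} (hr : 2 ≤ r) : HasGrowth r {0} 0 := by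
  have h0 : ({0} : Set ℝ) ∩ Set.Ico 0 1 = {0} := by
    rw [Set.inter_eq_left, Set.singleton_subset_iff]
    exact ⟨le_rfl, one_pos⟩
  have h1 : ∀ n, numCodes r ({0} ∩ Set.Ico 0 1) n = 1 := fun n => by
    rw [h0, numCodes, Set.image_singleton, Set.ncard_singleton]
  refine ⟨le_rfl, zero_le_one, fun n => by rw [h1]; simp, fun ε hε => ⟨1, le_rfl, fun n => ?_⟩⟩
  rw [h1, zero_add, one_mul, Nat.cast_one]
  exact Real.one_le_rpow (by exact_mod_cast (by omega : 1 ≤ r)) (by positivity)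

/-- λX + ηY is compact and the balls are open, so a finite subcover reduces to the finite bound.
Compactness of I away from 0 supplies the two bounds on |λ| and |η|. -/
theorem exists_content_ge {r s : ℕ} (hr : 2 ≤ r) (hs : 2 ≤ s)
    (hirr : Irrational (Real.log r / Real.log s)) {X Y : Set ℝ} (hX : IsTimesInvariant r X)
    (hY : IsTimesInvariant s Y) (hXne : X.Nonempty) (hYne : Y.Nonempty) {A B : ℝ}
    (hA : HasGrowth r X A) (hB : HasGrowth s Y B) {γ : ℝ} (hγ0 : 0 ≤ γ) (hγAB : γ < A + B)
    (hγ1 : γ < 1) {I : Set ℝ} (hI : IsCompact I) (hI0 : I ⊆ {0}ᶜ) :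
    ∃ c₀ : ℝ≥0∞, 0 < c₀ ∧ ∀ l ∈ I, ∀ η ∈ I,
      c₀ ≤ unlimitedHausdorffContent γ (l • X + η • Y) := by
  obtain ⟨lo, hlo, hlo'⟩ : ∃ lo : ℝ, 0 < lo ∧ ∀ l ∈ I, lo ≤ |l| := by
    rcases I.eq_empty_or_nonempty with rfl | hne
    · exact ⟨1, one_pos, by simp⟩
    · obtain ⟨l₀, hl₀, hmin⟩ := hI.exists_isMinOn hne continuous_abs.continuousOn
      exact ⟨|l₀|, abs_pos.mpr (hI0 hl₀), fun l hl => hmin hl⟩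
  obtain ⟨hi, hhi⟩ : ∃ hi : ℝ, ∀ l ∈ I, |l| ≤ hi := by
    obtain ⟨hi, hhi⟩ := hI.isBounded.exists_norm_le
    exact ⟨hi, fun l hl => hhi l hl⟩
  obtain ⟨c₀, hc₀, hcov⟩ := exists_cover_sum_ge hr hs hirr (isShiftInvariant_inter hX)
    (isShiftInvariant_inter hY) (inter_Ico_nonempty hX hXne) (inter_Ico_nonempty hY hYne)
    hA.1 hA.2.1 hB.1 hB.2.1 hA.2.2.1 hA.2.2.2 hB.2.2.1 hB.2.2.2 hγ0 hγAB hγ1 (hi := hi) hlo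
  refine ⟨ENNReal.ofReal c₀, ENNReal.ofReal_pos.mpr hc₀, fun l hl η hη => ?_⟩
  have hXc : IsCompact X := isCompact_Icc.of_isClosed_subset hX.isClosed hX.subset_Icc
  have hYc : IsCompact Y := isCompact_Icc.of_isClosed_subset hY.isClosed hY.subset_Icc
  have hcomp : IsCompact (l • X + η • Y) := (hXc.smul l).add (hYc.smul η)
  refine le_iInf fun ι => le_iInf fun _ => le_iInf fun ctr => le_iInf fun δ => le_iInf fun hδ =>
    le_iInf fun hsub => ?_
  obtain ⟨T, hT⟩ := hcomp.elim_finite_subcover _ (fun i => Metric.isOpen_ball) hsub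
  have h1 := hcov l η (hlo' l hl) (hhi l hl) (hlo' η hη) (hhi η hη) ι T ctr δ (fun i _ => hδ i)
    (fun x hx y hy => by
      have hmem : l * x + η * y ∈ l • X + η • Y :=
        Set.add_mem_add (Set.smul_mem_smul_set hx.1) (Set.smul_mem_smul_set hy.1)
      obtain ⟨i, hi, hxi⟩ := Set.mem_iUnion₂.mp (hT hmem)
      exact ⟨i, hi, hxi⟩)
  calc ENNReal.ofReal c₀ ≤ ENNReal.ofReal (∑ i ∈ T, δ i ^ γ) := ENNReal.ofReal_le_ofReal h1
    _ = ∑ i ∈ T, ENNReal.ofReal (δ i ^ γ) :=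
        ENNReal.ofReal_sum_of_nonneg fun i _ => Real.rpow_nonneg (hδ i).le γ
    _ ≤ _ := ENNReal.sum_le_tsum T

theorem le_dimH_add {r s : ℕ} (hr : 2 ≤ r) (hs : 2 ≤ s)
    (hirr : Irrational (Real.log r / Real.log s)) {X Y : Set ℝ} (hX : IsTimesInvariant r X)
    (hY : IsTimesInvariant s Y) (hXne : X.Nonempty) (hYne : Y.Nonempty) {A B : ℝ}
    (hA : HasGrowth r X A) (hB : HasGrowth s Y B) :
    min 1 (ENNReal.ofReal (A + B)) ≤ dimH (X + Y) := by
  refine le_of_forall_lt_imp_le_of_dense fun c hc => ?_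
  obtain ⟨hc1, hcAB⟩ := lt_min_iff.mp hc
  have hctop : c ≠ ∞ := (hc1.trans ENNReal.one_lt_top).ne
  rw [← ENNReal.ofReal_toReal hctop]
  obtain ⟨c₀, hc₀, hcont⟩ := exists_content_ge hr hs hirr hX hY hXne hYne hA hB
    (γ := c.toReal) ENNReal.toReal_nonneg
    ((ENNReal.lt_ofReal_iff_toReal_lt hctop).mp hcAB)
    (by
      have h := ENNReal.toReal_strict_mono ENNReal.one_ne_top hc1
      rwa [ENNReal.toReal_one] at h)
    (I := {1}) isCompact_singleton (by simp)
  refine le_dimH_of_content_pos ENNReal.toReal_nonneg ?_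
  have h := hcont 1 rfl 1 rfl
  rw [one_smul, one_smul] at h
  exact hc₀.trans_le h

end Furstenberg

open Furstenberg in
theorem theoremA (r s : ℕ) (hr : 0 < r) (hs : 0 < s)
    (hrs : Irrational (Real.log r / Real.log s))
    (X Y : Set ℝ) (hX : IsTimesInvariant r X) (hY : IsTimesInvariant s Y)
    (hXne : X.Nonempty) (hYne : Y.Nonempty) :
    (∀ I : Set ℝ, IsCompact I → I ⊆ {0}ᶜ →
      ∀ γ : ℝ, 0 ≤ γ → ENNReal.ofReal γ < min (dimH X + dimH Y) 1 →
        0 < ⨅ (l ∈ I) (η ∈ I), unlimitedHausdorffContent γ (l • X + η • Y)) ∧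
    dimH (X + Y) = min 1 (dimH X + dimH Y) := by
  -- For r = 1 the quotient of logarithms is 0; for s = 1 it is a division by zero, which is 0 by
  -- convention. Both are rational.
  have hr2 : 2 ≤ r := by
    by_contra h
    have : r = 1 := by omega
    subst this
    simp at hrs
  have hs2 : 2 ≤ s := by
    by_contra h
    have : s = 1 := by omega
    subst this
    simp at hrs
  obtain ⟨A, hA⟩ : ∃ A, HasGrowth r X A :=
    (isShiftInvariant_inter hX).exists_growth hr2 (inter_Ico_nonempty hX hXne)
  obtain ⟨B, hB⟩ : ∃ B, HasGrowth s Y B :=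
    (isShiftInvariant_inter hY).exists_growth hs2 (inter_Ico_nonempty hY hYne)
  have hzr := hasGrowth_zero hr2
  have hzs := hasGrowth_zero hs2
  have hne0 : ({0} : Set ℝ).Nonempty := Set.singleton_nonempty 0
  -- The sumset bounds with Y = {0} show that the Hausdorff dimension equals the growth exponent of
  -- the codes.
  have hdimX : dimH X = ENNReal.ofReal A := by
    refine le_antisymm ?_ ?_
    · have h := dimH_add_le hr2 hs2 hX.subset_Icc (isTimesInvariant_zero s).subset_Icc hA.1 hzs.1
        (hA.numCodes_le hX hXne) (hzs.numCodes_le (isTimesInvariant_zero s) hne0)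
      rwa [Set.singleton_zero, add_zero, add_zero] at h
    · have h := le_dimH_add hr2 hs2 hrs hX (isTimesInvariant_zero s) hXne hne0 hA hzs
      rwa [Set.singleton_zero, add_zero, add_zero,
        min_eq_right (ENNReal.ofReal_le_one.mpr hA.2.1)] at h
  have hdimY : dimH Y = ENNReal.ofReal B := by
    refine le_antisymm ?_ ?_
    · have h := dimH_add_le hr2 hs2 (isTimesInvariant_zero r).subset_Icc hY.subset_Icc hzr.1 hB.1
        (hzr.numCodes_le (isTimesInvariant_zero r) hne0) (hB.numCodes_le hY hYne)
      rwa [Set.singleton_zero, zero_add, zero_add] at h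
    · have h := le_dimH_add hr2 hs2 hrs (isTimesInvariant_zero r) hY hne0 hYne hzr hB
      rwa [Set.singleton_zero, zero_add, zero_add,
        min_eq_right (ENNReal.ofReal_le_one.mpr hB.2.1)] at h
  have hsum : dimH X + dimH Y = ENNReal.ofReal (A + B) := by
    rw [hdimX, hdimY, ENNReal.ofReal_add hA.1 hB.1]
  rw [hsum]
  refine ⟨fun I hI hI0 γ hγ0 hγ => ?_, le_antisymm (le_min ?_ ?_) ?_⟩
  · obtain ⟨h1, h2⟩ := lt_min_iff.mp hγ
    obtain ⟨c₀, hc₀, hcont⟩ := exists_content_ge hr2 hs2 hrs hX hY hXne hYne hA hB hγ0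
      ((ENNReal.ofReal_lt_ofReal_iff_of_nonneg hγ0).mp h1) (ENNReal.ofReal_lt_one.mp h2) hI hI0
    exact hc₀.trans_le (le_iInf₂ fun l hl => le_iInf₂ fun η hη => hcont l hl η hη)
  · exact (dimH_mono (Set.subset_univ _)).trans Real.dimH_univ.le
  · exact dimH_add_le hr2 hs2 hX.subset_Icc hY.subset_Icc hA.1 hB.1 (hA.numCodes_le hX hXne)
      (hB.numCodes_le hY hYne)
  · exact le_dimH_add hr2 hs2 hrs hX hY hXne hYne hA hB
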